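/- **Setting.** Let $P$ be a probability measure on $\mathbb{R}$ with bounded support, let $x^*\sim P^{\otimes N}$, and let $W_{ij}$ ($i<j$) and $z_i$ be independent standard Gaussians, independent of $x^*$. For $r\ge 0$, $s\in\mathbb{R}$ put $$\bar\psi(r,s)=\mathbb{E}_{x^*\sim P,\,z\sim N(0,1)}\log\int e^{\sqrt r zx+sxx^*-\frac r2x^2}\,dP(x),\qquad \psi(r)=\bar\psi(r,r),$$ $F(\lambda,q)=\psi(\lambda q)-\lambda q^2/4$ and $\phi_{RS}(\lambda)=\sup_{q\ge0}F(\lambda,q)$. Let $\mathcal{A}$ be the set of $\lambda>0$ at which $\phi_{RS}$ is twice differentiable (it suffices that $\phi_{RS}$ is differentiable with a second-order expansion at $\lambda$). When $F(\lambda,\cdot)$ has a unique maximizer on $[0,\infty)$, denote it $q^*(\lambda)$. Let $\lambda_c$ be the supremum of the points $\lambda>0$ of differentiability of $\phi_{RS}$ with $q^*(\lambda)=0$; so $\lambda_c\in[-\infty,+\infty]$, with $\lambda_c=-\infty$ if there are none. For $\lambda\ge 0$, $q\ge0$, $t\in[0,1]$, $r=\lambda q$, let $$-H_t(x)=\sum_{i<j}\Big(-\tfrac{t\lambda}{2N}x_i^2x_j^2+\sqrt{\tfrac{t\lambda}{N}}W_{ij}x_ix_j+\tfrac{t\lambda}{N}x_ix_i^*x_jx_j^*\Big)+\sum_i\Big(-\tfrac{(1-t)r}{2}x_i^2+\sqrt{(1-t)r}\,z_ix_i+(1-t)r\,x_ix_i^*\Big),$$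 let $\langle\cdot\rangle_t$ be the average over $x$ under the probability measure proportional to $e^{-H_t(x)}dP^{\otimes N}(x)$, let $R_{1,*}=\frac1N\sum_ix_ix_i^*$, and for $m\in\mathbb{R}$, $\epsilon>0$ let $$\Phi_{N,\epsilon}(m;t)=\frac1N\mathbb{E}\log\int \mathbf 1\{R_{1,*}\in[m,m+\epsilon)\}e^{-H_t(x)}dP^{\otimes N}(x)\in[-\infty,\infty)$$ be the Franz–Parisi potential ($\log 0=-\infty$). Finally let $$\phi_{RS}(\lambda;t)=\sup_{m\ge0}\Big\{\psi\big((1-t)\lambda q+t\lambda m\big)-\tfrac{t\lambda m^2}{4}\Big\}.$$ **(1) Fixed-overlap bound.** There is $K=K(P)>0$ such that for every $\lambda\ge0$ there is $K'=K'(\lambda,P)>0$ such that for every maximizer $q$ of $F(\lambda,\cdot)$ on $[0,\infty)$ (in particular $q=q^*(\lambda)$ when the maximizer is unique), and all $m\in\mathbb{R}$, $\epsilon>0$, $t\in[0,1]$, $N\ge1$, with $r=(1-t)\lambda q+t\lambda|m|$ and $\bar r=(1-t)\lambda q+t\lambda m$, $$\Phi_{N,\epsilon}(m;t)\le\bar\psi(r,\bar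 r)-\tfrac{t\lambda m^2}{4}-K\big(m-\partial_s\bar\psi(r,\bar r)\big)^2+K'\epsilon^2+\tfrac{K'}{N}.$$ Let now $\lambda\in\mathcal{A}$. Then $F(\lambda,\cdot)$ has a unique maximizer $q^*=q^*(\lambda)$ on $[0,\infty)$, and with $q=q^*$ in the definitions above the following holds for every $\epsilon>0$. **(2) Energy gap.** There are $\epsilon'>0$ and a function $c:[0,1]\to[0,\infty)$ (depending on $\lambda,\epsilon,P$ only) such that: (i) $c(t)>0$ for $t<1$; (ii) if $\lambda<\lambda_c$ or $P$ is not symmetric about the origin, then $c\ge c_0$ on $[0,1]$ for some $c_0>0$; (iii) if $\lambda>\lambda_c$ and $P$ is symmetric, then $c(t)\sim c_0(1-t)$ as $t\to1^-$ for some $c_0>0$; (iv) for every $\theta>0$ there is $N_0$ such that for all $N\ge N_0$, all $t\in[0,1]$ with $c(t)\ge\theta$, and all $m\in\mathbb{R}$ with $|m-q^*|\ge\epsilon$: $\ \Phi_{N,\epsilon'}(m;t)\le\phi_{RS}(\lambda;t)-c(t)$; (v) for every $\delta>0$ there is $N_0$ such that for all $N\ge N_0$, all $t\in[0,1]$, and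 all $m$ with $|m-q^*|\ge\epsilon$: $\ \Phi_{N,\epsilon'}(m;t)\le\phi_{RS}(\lambda;t)-c(t)+\delta$. **(3) Convergence in probability of the overlap.** There are $K\ge0$ (depending on $\lambda,\epsilon,P$ only) and a function $c:[0,1]\to[0,\infty)$ with properties (i) and (ii), and with $c(t)\sim c_0(1-t)^2$ as $t\to1^-$ for some $c_0>0$ if $\lambda>\lambda_c$ and $P$ is symmetric, such that for all $t\in[0,1]$, $N\ge1$, $$\mathbb{E}\big\langle\mathbf 1\{|R_{1,*}-q^*|\ge\epsilon\}\big\rangle_t\le Ke^{-c(t)N}.$$ Moreover, if $\lambda>\lambda_c$ and $P$ is symmetric, there is $c>0$ such that for all $N\ge 1$, at $t=1$, $$\mathbb{E}\big\langle\mathbf 1\{\big||R_{1,*}|-q^*\big|\ge\epsilon\}\big\rangle_1\le Ke^{-cN}.$$ -/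

import Mathlib

open MeasureTheory ProbabilityTheory Filter Topology Asymptotics

namespace SpikedWigner

noncomputable section

/-! ### The scalar Gaussian channel and the replica-symmetric formula -/

/-- `ψ̄(r, s) = E_{x*, z} log ∫ exp(√r z x + s x x* - r x² / 2) dP(x)`, with `x* ∼ P` and
`z ∼ N(0, 1)` independent. -/
def psiBar (P : Measure ℝ) (r s : ℝ) : ℝ :=
  ∫ w : ℝ × ℝ,
    Real.log (∫ x, Real.exp (Real.sqrt r * w.2 * x + s * x * w.1 - r / 2 * x ^ 2) ∂P)
    ∂(P.prod (gaussianReal 0 1))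

/-- `ψ(r) = ψ̄(r, r)`. -/
def psi (P : Measure ℝ) (r : ℝ) : ℝ := psiBar P r r

/-- The replica-symmetric potential `F(λ, q) = ψ(λ q) - λ q² / 4`. -/
def rsPotential (P : Measure ℝ) (lam q : ℝ) : ℝ := psi P (lam * q) - lam * q ^ 2 / 4

/-- The replica-symmetric formula `φ_RS(λ) = sup_{q ≥ 0} F(λ, q)`. -/
def phiRS (P : Measure ℝ) (lam : ℝ) : ℝ := sSup (rsPotential P lam '' Set.Ici 0)

/-- `q` maximizes `F(λ, ·)` over `[0, ∞)`. -/
def IsRSMaximizer (P : Measure ℝ) (lam q : ℝ) : Prop :=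
  0 ≤ q ∧ ∀ q' : ℝ, 0 ≤ q' → rsPotential P lam q' ≤ rsPotential P lam q

/-- `q = q*(λ)`: `q` is the unique maximizer of `F(λ, ·)` over `[0, ∞)`. -/
def IsQStar (P : Measure ℝ) (lam q : ℝ) : Prop :=
  IsRSMaximizer P lam q ∧ ∀ q' : ℝ, IsRSMaximizer P lam q' → q' = q

/-- The set `𝒜` of all `λ > 0` at which `φ_RS` is twice differentiable, in the sense of
Alexandrov's theorem on convex functions: `φ_RS` is differentiable at `λ` and has a second order
expansion there. Every point of classical twice differentiability is such a point. -/
def regularSet (P : Measure ℝ) : Set ℝ :=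
  {lam | 0 < lam ∧ DifferentiableAt ℝ (phiRS P) lam ∧
    ∃ b : ℝ, (fun h : ℝ => phiRS P (lam + h) - phiRS P lam - deriv (phiRS P) lam * h
      - b / 2 * h ^ 2) =o[𝓝 0] fun h : ℝ => h ^ 2}

/-- The reconstruction threshold `λ_c = sup {λ > 0 : q*(λ) = 0}`, the supremum being over points
`λ` of differentiability of `φ_RS` (where `q*` is defined). It is `+∞` for the prior `δ₀`, and
`-∞` (every `λ > 0` lies above it) if the set is empty. -/
def lambdaC (P : Measure ℝ) : EReal :=
  sSup ((fun lam : ℝ => (lam : EReal)) ''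
    {lam : ℝ | 0 < lam ∧ DifferentiableAt ℝ (phiRS P) lam ∧ IsQStar P lam 0})

/-- The prior is symmetric about the origin. -/
def IsSymmetricPrior (P : Measure ℝ) : Prop := P.map (fun x => -x) = P

/-- The replica-symmetric formula along the interpolation path, with `q` in the role of `q*(λ)`:
`φ_RS(λ; t) = sup_{m ≥ 0} ψ((1 - t) λ q + t λ m) - t λ m² / 4`. -/
def phiRSt (P : Measure ℝ) (lam q t : ℝ) : ℝ :=
  sSup ((fun m : ℝ => psi P ((1 - t) * lam * q + t * lam * m) - t * lam * m ^ 2 / 4) ''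
    Set.Ici 0)

/-! ### The interpolating Gibbs measure -/

/-- The disorder `(x*, W, z)`: the spike, the matrix noise, and the side-channel noise.
Only the entries `W (i, j)` with `i < j` are used. -/
abbrev Disorder (N : ℕ) : Type :=
  (Fin N → ℝ) × (Fin N × Fin N → ℝ) × (Fin N → ℝ)

/-- The product law `P^{⊗N}`. -/
def priorN (P : Measure ℝ) (N : ℕ) : Measure (Fin N → ℝ) := Measure.pi fun _ => P

/-- The law of the disorder: `x* ∼ P^{⊗N}`, and independent standard Gaussian entries of `W`
and `z`. -/
def disorderLaw (P : Measure ℝ) (N : ℕ) : Measure (Disorder N) :=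
  (priorN P N).prod
    ((Measure.pi fun _ : Fin N × Fin N => gaussianReal 0 1).prod
      (Measure.pi fun _ : Fin N => gaussianReal 0 1))

/-- The overlap `(1 / N) ∑ x_i y_i`. -/
def overlap {N : ℕ} (x y : Fin N → ℝ) : ℝ := (∑ i, x i * y i) / N

/-- Minus the interpolating Hamiltonian, `-H_t(x)`, with `r = λ q`. -/
def negH {N : ℕ} (lam q t : ℝ) (d : Disorder N) (x : Fin N → ℝ) : ℝ :=
  (∑ p : Fin N × Fin N with p.1 < p.2,
    (-(t * lam / (2 * N)) * (x p.1 ^ 2 * x p.2 ^ 2)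
      + Real.sqrt (t * lam / N) * (d.2.1 p * x p.1 * x p.2)
      + t * lam / N * (x p.1 * d.1 p.1 * x p.2 * d.1 p.2)))
  + ∑ i : Fin N,
    (-((1 - t) * (lam * q) / 2) * x i ^ 2
      + Real.sqrt ((1 - t) * (lam * q)) * (d.2.2 i * x i)
      + (1 - t) * (lam * q) * (x i * d.1 i))

/-- The Gibbs average `⟨f⟩_t` of a function of one replica, for given disorder. -/
def gibbsAvg (P : Measure ℝ) {N : ℕ} (lam q t : ℝ) (d : Disorder N) (f : (Fin N → ℝ) → ℝ) : ℝ :=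
  (∫ x, f x * Real.exp (negH lam q t d x) ∂(priorN P N)) /
    ∫ x, Real.exp (negH lam q t d x) ∂(priorN P N)

/-- `E ⟨1{R_{1,*} ∈ S}⟩_t`. -/
def overlapProb (P : Measure ℝ) (N : ℕ) (lam q t : ℝ) (S : Set ℝ) : ℝ :=
  ∫ d : Disorder N,
    gibbsAvg P lam q t d (fun x => S.indicator (fun _ => (1 : ℝ)) (overlap x d.1))
    ∂(disorderLaw P N)

/-! ### The Franz–Parisi potential -/

/-- Expectation of an extended-real random variable: the integral of the positive part minus the
integral of the negative part. -/
def eexpect {Ω : Type*} [MeasurableSpace Ω] (μ : Measure Ω) (f : Ω → EReal) : EReal :=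
  ((∫⁻ w, (f w).toENNReal ∂μ : ENNReal) : EReal) - ((∫⁻ w, (-f w).toENNReal ∂μ : ENNReal) : EReal)

/-- The partition function restricted to the configurations with `R_{1,*} ∈ [m, m + ε)`. -/
def restrictedZ (P : Measure ℝ) {N : ℕ} (lam q t ε m : ℝ) (d : Disorder N) : ENNReal :=
  ∫⁻ x in {x : Fin N → ℝ | overlap x d.1 ∈ Set.Ico m (m + ε)},
    ENNReal.ofReal (Real.exp (negH lam q t d x)) ∂(priorN P N)

/-- The Franz–Parisi potential
`Φ_ε(m; t) = (1 / N) E log ∫ 1{R_{1,*} ∈ [m, m + ε)} exp(-H_t(x)) dP^{⊗N}(x)`, with `log 0 = -∞`;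
its value may be `-∞`. -/
def franzParisi (P : Measure ℝ) (N : ℕ) (lam q t ε m : ℝ) : EReal :=
  ((1 / (N : ℝ) : ℝ) : EReal) *
    eexpect (disorderLaw P N) fun d => ENNReal.log (restrictedZ P lam q t ε m d)

end

end SpikedWigner

/-!
The proof replaces concentration of measure by fractional moments of partition functions.

Let `Z_A` be the partition function restricted to an overlap window `A` at `m`, and `Z` the full
one. For `0 < s ≤ 1` a Gaussian interpolation at fixed spike (`PathData.integral_rpow_le`) compares
`E Z_A ^ s` with the moment of a decoupled system in which the matrix channel is replaced by a scalar
channel of strength `t λ |m|`. Guerra's square `(R_{1,2} - |m|)²` has the favourable sign because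
`s ≤ 1`, and the term of the spike is `(R_{1,*} - m)²`, of order `ε²` on the window. A Chernoff bound
in the overlap with the spike, with tilt proportional to `m - ∂_s ψ̄`, then produces the term
`-K (m - ∂_s ψ̄)²` (`exists_lintegral_restrictedZ_rpow_le`). Since `log z` is bounded by the tangent
of `z ↦ z ^ s / s`, letting `s → 0` gives the bound on the Franz–Parisi potential.

In the other direction, Bayes' rule writes `E Z ^ (-s)` as the moment of order `1 - s` of the
partition function under the null model, to which the same interpolation applies, now with the sign
that gives `E Z ^ (-s) ≤ exp(-s N (ψ(λ q) - t λ q² / 4) + O(s) + O(s² N))`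
(`lintegral_fullZ_rpow_neg_le`). By the Cauchy–Schwarz inequality the Gibbs probability of a window is
bounded by `exp(s N G(t, m) + O(1 + s² N))`, where `G = overlapGap` is the difference of the two
exponents. Choosing `s` proportional to the gap gives exponential decay with a rate quadratic in
the gap (`exists_overlapProb_le`).

It remains to bound `G`. At a maximizer `q` it is a sum of nonpositive terms (`overlapGap_eq`):
`ψ̄(r, r̄) - ψ(r)`, nonpositive by a relative entropy argument and convexity of `ψ̄(r, ·)`;
`-K (m - ∂_s ψ̄)²`; `-λ t (1 - t) (|m| - q)² / 4`; and `F(λ, u) - F(λ, q)`, where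
`u = (1 - t) q + t |m|`. They vanish together only at `m = q`, by the fixed-point equation
`∂_s ψ̄(λ q, λ q) = q`, and, for a symmetric prior and `q > 0`, at `(t, m) = (1, -q)`
(`overlapGap_neg`). Compactness gives a uniform gap away from the latter point. Near it, the side
channel contributes a gap of order `1 - t`, and the second order expansion of `φ_RS` makes
the maximizer `q` nondegenerate, which adds a term of order `(m + q)²`
(`exists_overlapGap_local_le`). Differentiability of `φ_RS` gives uniqueness of the maximizer through
the envelope identity `φ_RS' = q² / 4`, and decides whether `q = 0` on either side of `λ_c`.
-/

namespace SpikedWigner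

/-! ### Gaussian vectors: translation and integration by parts -/

/-- The law of a standard Gaussian vector with coordinates indexed by `ι`. -/
noncomputable abbrev gaussPi (ι : Type*) [Fintype ι] : Measure (ι → ℝ) :=
  Measure.pi fun _ => gaussianReal 0 1

lemma gaussianReal_map_add_const_eq_withDensity (v : ℝ) :
    (gaussianReal 0 1).map (· + v) =
      (gaussianReal 0 1).withDensity fun z => ENNReal.ofReal (Real.exp (v * z - v ^ 2 / 2)) := by
  rw [gaussianReal_map_add_const, zero_add, gaussianReal_of_var_ne_zero _ one_ne_zero,
    gaussianReal_of_var_ne_zero _ one_ne_zero,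
    ← withDensity_mul _ (measurable_gaussianPDF _ _) (by fun_prop)]
  congr 1
  ext z
  simp only [gaussianPDF, Pi.mul_apply]
  rw [← ENNReal.ofReal_mul (gaussianPDFReal_nonneg _ _ _)]
  congr 1
  simp only [gaussianPDFReal, mul_assoc, ← Real.exp_add]
  congr 3
  simp
  ring

variable {ι : Type*} [Fintype ι]

lemma lintegral_prod_pi {α : Type*} [MeasurableSpace α] (μ : ι → Measure α)
    [∀ i, IsProbabilityMeasure (μ i)] (f : ι → α → ENNReal) (hf : ∀ i, Measurable (f i)) :
    ∫⁻ g, ∏ i, f i (g i) ∂(Measure.pi μ) = ∏ i, ∫⁻ x, f i x ∂(μ i) := by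
  have hind : iIndepFun (fun i (g : ι → α) => f i (g i)) (Measure.pi μ) :=
    iIndepFun_pi fun i => (hf i).aemeasurable
  rw [lintegral_prod_eq_prod_lintegral_of_indepFun Finset.univ _ hind
    (fun i => (hf i).comp (measurable_pi_apply i))]
  refine Finset.prod_congr rfl fun i _ => ?_
  exact (measurePreserving_eval μ i).lintegral_comp (hf i)

lemma gaussPi_map_add_eq_withDensity (v : ι → ℝ) :
    (gaussPi ι).map (· + v) =
      (gaussPi ι).withDensity fun g =>
        ENNReal.ofReal (Real.exp (∑ i, (v i * g i - v i ^ 2 / 2))) := by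
  have h1 : (gaussPi ι).map (· + v) = Measure.pi fun i => (gaussianReal 0 1).map (· + v i) := by
    have := Measure.pi_map_pi (μ := fun _ : ι => gaussianReal 0 1) (f := fun i x => x + v i)
      (fun i => by fun_prop)
    rw [← this]; rfl
  rw [h1]
  have : ∀ i, IsProbabilityMeasure ((gaussianReal 0 1).map (· + v i)) := fun i =>
    Measure.isProbabilityMeasure_map (by fun_prop)
  symm
  refine (Measure.pi_eq fun s hs => ?_).symm
  rw [withDensity_apply _ (MeasurableSet.univ_pi hs),
    ← lintegral_indicator (MeasurableSet.univ_pi hs)]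
  have : ∀ g : ι → ℝ, (Set.univ.pi s).indicator (fun g => ENNReal.ofReal
      (Real.exp (∑ i, (v i * g i - v i ^ 2 / 2)))) g =
      ∏ i, (s i).indicator (fun z => ENNReal.ofReal (Real.exp (v i * z - v i ^ 2 / 2))) (g i) := by
    intro g
    by_cases h : g ∈ Set.univ.pi s
    · rw [Set.indicator_of_mem h, Real.exp_sum, ENNReal.ofReal_prod_of_nonneg
        (fun i _ => (Real.exp_pos _).le)]
      refine Finset.prod_congr rfl fun i _ => ?_
      rw [Set.indicator_of_mem (h i trivial)]
    · rw [Set.indicator_of_notMem h]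
      simp only [Set.mem_pi, Set.mem_univ, true_implies, not_forall] at h
      obtain ⟨i, hi⟩ := h
      exact (Finset.prod_eq_zero (Finset.mem_univ i) (Set.indicator_of_notMem hi _)).symm
  simp_rw [this]
  rw [lintegral_prod_pi _ _ (fun i => Measurable.indicator (by fun_prop) (hs i))]
  refine Finset.prod_congr rfl fun i _ => ?_
  rw [gaussianReal_map_add_const_eq_withDensity, withDensity_apply _ (hs i),
    lintegral_indicator (hs i)]

/-- The Cameron–Martin formula for nonnegative functions. -/
lemma lintegral_gaussPi_add (v : ι → ℝ) {f : (ι → ℝ) → ENNReal} (hf : Measurable f) :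
    ∫⁻ g, f (g + v) ∂(gaussPi ι) =
      ∫⁻ g, ENNReal.ofReal (Real.exp (∑ i, (v i * g i - v i ^ 2 / 2))) * f g ∂(gaussPi ι) := by
  rw [← lintegral_map (g := (· + v)) hf (by fun_prop), gaussPi_map_add_eq_withDensity,
    lintegral_withDensity_eq_lintegral_mul _ (by fun_prop) hf]
  rfl

lemma integral_gaussPi_add (v : ι → ℝ) {f : (ι → ℝ) → ℝ} (hf : Measurable f) :
    ∫ g, f (g + v) ∂(gaussPi ι) =
      ∫ g, Real.exp (∑ i, (v i * g i - v i ^ 2 / 2)) * f g ∂(gaussPi ι) := by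
  rw [← integral_map (φ := (· + v)) (by fun_prop) hf.aestronglyMeasurable,
    gaussPi_map_add_eq_withDensity, integral_withDensity_eq_integral_toReal_smul (by fun_prop)
      (ae_of_all _ fun _ => ENNReal.ofReal_lt_top)]
  simp [ENNReal.toReal_ofReal (Real.exp_pos _).le]

lemma integral_gaussianReal_add (v : ℝ) {f : ℝ → ℝ} (hf : Measurable f) :
    ∫ z, f (z + v) ∂(gaussianReal 0 1) =
      ∫ z, Real.exp (v * z - v ^ 2 / 2) * f z ∂(gaussianReal 0 1) := by
  rw [← integral_map (φ := (· + v)) (by fun_prop) hf.aestronglyMeasurable,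
    gaussianReal_map_add_const_eq_withDensity,
    integral_withDensity_eq_integral_toReal_smul (by fun_prop)
      (ae_of_all _ fun _ => ENNReal.ofReal_lt_top)]
  simp [ENNReal.toReal_ofReal (Real.exp_pos _).le]

lemma integrable_exp_mul_abs_gaussianReal (C : ℝ) :
    Integrable (fun z => Real.exp (C * |z|)) (gaussianReal 0 1) :=
  integrable_exp_mul_abs (X := id) (integrable_exp_mul_gaussianReal C)
    (integrable_exp_mul_gaussianReal (-C))

lemma integrable_exp_mul_sum_abs (C : ℝ) :
    Integrable (fun g : ι → ℝ => Real.exp (C * ∑ i, |g i|)) (gaussPi ι) := by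
  simp_rw [Finset.mul_sum, Real.exp_sum]
  exact Integrable.fintype_prod (f := fun _ z => Real.exp (C * |z|))
    fun _ => integrable_exp_mul_abs_gaussianReal C

/-- Exponential growth `|F g| ≤ C exp (C ∑ |g i|)`: the class of functions for which all the
integrals below converge. -/
def ExpGrowth (F : (ι → ℝ) → ℝ) (C : ℝ) : Prop := ∀ g, |F g| ≤ C * Real.exp (C * ∑ i, |g i|)

lemma ExpGrowth.integrable {F : (ι → ℝ) → ℝ} {C : ℝ} (h : ExpGrowth F C) (hF : Measurable F) :
    Integrable F (gaussPi ι) :=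
  ((integrable_exp_mul_sum_abs C).const_mul C).mono' hF.aestronglyMeasurable (ae_of_all _ h)

lemma sum_abs_add_single_le [DecidableEq ι] (g : ι → ℝ) (k : ι) (s : ℝ) :
    ∑ i, |(g + (Pi.single k s : ι → ℝ)) i| ≤ ∑ i, |g i| + |s| := by
  calc ∑ i, |(g + (Pi.single k s : ι → ℝ)) i| ≤ ∑ i, (|g i| + |(Pi.single k s : ι → ℝ) i|) :=
        Finset.sum_le_sum fun i _ => abs_add_le _ _
    _ = _ := by
      rw [Finset.sum_add_distrib]
      congr 1
      rw [Finset.sum_eq_single k (fun b _ hb => by simp [Pi.single_eq_of_ne hb]) (by simp)]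
      simp

/-- Gaussian integration by parts in the `k`-th coordinate, obtained by differentiating the
Cameron–Martin formula. -/
lemma gaussPi_integral_mul_eq [DecidableEq ι] (k : ι) {F dF : (ι → ℝ) → ℝ} {C : ℝ} (hC : 0 ≤ C)
    (hF : Measurable F) (hdF : Measurable dF) (hFC : ExpGrowth F C) (hdFC : ExpGrowth dF C)
    (hd : ∀ g s, HasDerivAt (fun s => F (g + (Pi.single k s : ι → ℝ)))
      (dF (g + (Pi.single k s : ι → ℝ))) s) :
    ∫ g, g k * F g ∂(gaussPi ι) = ∫ g, dF g ∂(gaussPi ι) := by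
  have hshift : ∀ s : ℝ, ∫ g, F (g + (Pi.single k s : ι → ℝ)) ∂(gaussPi ι) =
      ∫ g, Real.exp (s * g k - s ^ 2 / 2) * F g ∂(gaussPi ι) := by
    intro s
    rw [integral_gaussPi_add _ hF]
    congr 1; ext g; congr 2
    rw [Finset.sum_eq_single k (fun b _ hb => by simp [Pi.single_eq_of_ne hb]) (by simp)]
    simp
  have hball : Metric.ball (0 : ℝ) 1 ∈ 𝓝 (0 : ℝ) := Metric.ball_mem_nhds _ one_pos
  have hk : ∀ g : ι → ℝ, |g k| ≤ ∑ i, |g i| := fun g =>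
    Finset.single_le_sum (f := fun i => |g i|) (fun i _ => abs_nonneg _) (Finset.mem_univ k)
  have h1 : HasDerivAt (fun s : ℝ => ∫ g, F (g + (Pi.single k s : ι → ℝ)) ∂(gaussPi ι))
      (∫ g, dF (g + (Pi.single k (0 : ℝ) : ι → ℝ)) ∂(gaussPi ι)) 0 := by
    refine (hasDerivAt_integral_of_dominated_loc_of_deriv_le (s := Metric.ball 0 1)
      (F' := fun s g => dF (g + (Pi.single k s : ι → ℝ)))
      (bound := fun g => C * Real.exp C * Real.exp (C * ∑ i, |g i|)) hball ?_ ?_ ?_ ?_ ?_ ?_).2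
    · exact Eventually.of_forall fun s => (hF.comp (measurable_id.add_const _)).aestronglyMeasurable
    · simpa using hFC.integrable hF
    · simpa using hdF.aestronglyMeasurable
    · refine ae_of_all _ fun g s hs => (hdFC _).trans ?_
      rw [mul_assoc, ← Real.exp_add]
      have hs1 : |s| ≤ 1 := by simpa using (Metric.mem_ball.1 hs).le
      have := sum_abs_add_single_le g k s
      gcongr
      nlinarith
    · exact (integrable_exp_mul_sum_abs C).const_mul _
    · exact ae_of_all _ fun g s _ => hd g s
  have h2 : HasDerivAt (fun s : ℝ => ∫ g, Real.exp (s * g k - s ^ 2 / 2) * F g ∂(gaussPi ι))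
      (∫ g, (g k - 0) * Real.exp ((0:ℝ) * g k - 0 ^ 2 / 2) * F g ∂(gaussPi ι)) 0 := by
    refine (hasDerivAt_integral_of_dominated_loc_of_deriv_le (s := Metric.ball 0 1)
      (F' := fun s g => (g k - s) * Real.exp (s * g k - s ^ 2 / 2) * F g)
      (bound := fun g => C * Real.exp 1 * Real.exp ((C + 2) * ∑ i, |g i|)) hball
      ?_ ?_ ?_ ?_ ?_ ?_).2
    · exact Eventually.of_forall fun s => by
        apply Measurable.aestronglyMeasurable; fun_prop
    · simpa using hFC.integrable hF
    · apply Measurable.aestronglyMeasurable; fun_prop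
    · refine ae_of_all _ fun g s hs => ?_
      have hs1 : |s| ≤ 1 := by simpa using (Metric.mem_ball.1 hs).le
      rw [Real.norm_eq_abs, abs_mul, abs_mul, abs_of_pos (Real.exp_pos _)]
      have e1 : |g k - s| ≤ Real.exp (∑ i, |g i| + 1 - 1 + 0) * Real.exp 1 := by
        rw [← Real.exp_add]
        have := Real.add_one_le_exp (∑ i, |g i| + 1 - 1 + 0 + 1)
        have h3 := abs_sub (g k) s
        have := hk g
        linarith
      have e2 : Real.exp (s * g k - s ^ 2 / 2) ≤ Real.exp (∑ i, |g i|) := by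
        gcongr
        have : s * g k ≤ |s| * |g k| := by rw [← abs_mul]; exact le_abs_self _
        nlinarith [hk g, abs_nonneg (g k), sq_nonneg s]
      calc _ ≤ (Real.exp (∑ i, |g i| + 1 - 1 + 0) * Real.exp 1) * Real.exp (∑ i, |g i|) *
            (C * Real.exp (C * ∑ i, |g i|)) := by
              gcongr
              exact hFC g
        _ = C * Real.exp 1 * (Real.exp (∑ i, |g i| + 1 - 1 + 0) * Real.exp (∑ i, |g i|) *
            Real.exp (C * ∑ i, |g i|)) := by ring
        _ = _ := by rw [← Real.exp_add, ← Real.exp_add]; congr 2; ring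
    · exact (integrable_exp_mul_sum_abs _).const_mul _
    · refine ae_of_all _ fun g s _ => ?_
      have : HasDerivAt (fun s : ℝ => s * g k - s ^ 2 / 2) (g k - s) s := by
        simpa using ((hasDerivAt_id' s).mul_const (g k)).fun_sub ((hasDerivAt_pow 2 s).div_const 2)
      exact (this.exp.mul_const (F g)).congr_deriv (by ring)
  simp_rw [hshift] at h1
  have := h2.unique h1
  simpa using this

end SpikedWigner

namespace SpikedWigner

/-! ### Families of functions of exponential growth -/

variable {ι : Type*} [Fintype ι]

/-- The functions `F u`, `u ∈ s`, have exponential growth with a common constant. -/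
def UniformExpGrowth (s : Set ℝ) (F : ℝ → (ι → ℝ) → ℝ) : Prop :=
  ∃ C : ℝ, 0 ≤ C ∧ ∀ u ∈ s, ExpGrowth (F u) C

lemma sum_abs_nonneg (g : ι → ℝ) : 0 ≤ ∑ i, |g i| := Finset.sum_nonneg fun _ _ => abs_nonneg _

namespace UniformExpGrowth

variable {s : Set ℝ} {F G : ℝ → (ι → ℝ) → ℝ}

lemma of_le {C L : ℝ} (hC : 0 ≤ C) (hL : 0 ≤ L)
    (h : ∀ u ∈ s, ∀ g, |F u g| ≤ C * Real.exp (L * ∑ i, |g i|)) : UniformExpGrowth s F := by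
  refine ⟨C + L, by positivity, fun u hu g => (h u hu g).trans ?_⟩
  have := sum_abs_nonneg g
  gcongr <;> linarith

lemma mul (hF : UniformExpGrowth s F) (hG : UniformExpGrowth s G) :
    UniformExpGrowth s (fun u g => F u g * G u g) := by
  obtain ⟨C, hC, hF⟩ := hF
  obtain ⟨D, hD, hG⟩ := hG
  refine of_le (C := C * D) (L := C + D) (by positivity) (by positivity) fun u hu g => ?_
  rw [abs_mul]
  calc _ ≤ (C * Real.exp (C * ∑ i, |g i|)) * (D * Real.exp (D * ∑ i, |g i|)) :=
        mul_le_mul (hF u hu g) (hG u hu g) (abs_nonneg _) (by positivity)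
    _ = _ := by rw [add_mul, Real.exp_add]; ring

lemma add (hF : UniformExpGrowth s F) (hG : UniformExpGrowth s G) :
    UniformExpGrowth s (fun u g => F u g + G u g) := by
  obtain ⟨C, hC, hF⟩ := hF
  obtain ⟨D, hD, hG⟩ := hG
  refine of_le (C := C + D) (L := C + D) (by positivity) (by positivity) fun u hu g => ?_
  have := sum_abs_nonneg g
  refine (abs_add_le _ _).trans ((add_le_add (hF u hu g) (hG u hu g)).trans ?_)
  rw [add_mul]
  gcongr <;> linarith

lemma sum {κ : Type*} (t : Finset κ) {F : κ → ℝ → (ι → ℝ) → ℝ}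
    (h : ∀ k ∈ t, UniformExpGrowth s (F k)) :
    UniformExpGrowth s (fun u g => ∑ k ∈ t, F k u g) := by
  classical
  induction t using Finset.induction_on with
  | empty => exact ⟨0, le_rfl, fun u _ g => by simp⟩
  | insert k t hk ih =>
    simp_rw [Finset.sum_insert hk]
    exact (h k (by simp)).add (ih fun j hj => h j (by simp [hj]))

lemma bounded {c : ℝ → ℝ} {C : ℝ} (hc : ∀ u ∈ s, |c u| ≤ C) :
    UniformExpGrowth (ι := ι) s (fun u _ => c u) := by
  refine of_le (C := |C|) (L := 0) (abs_nonneg _) le_rfl fun u hu g => ?_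
  simpa using (hc u hu).trans (le_abs_self _)

lemma coord (k : ι) : UniformExpGrowth s (fun _ g => g k) := by
  refine of_le (C := 1) (L := 1) zero_le_one zero_le_one fun u hu g => ?_
  have h1 : |g k| ≤ ∑ i, |g i| :=
    Finset.single_le_sum (f := fun i => |g i|) (fun i _ => abs_nonneg _) (Finset.mem_univ k)
  have := Real.add_one_le_exp (∑ i, |g i|)
  simp only [one_mul]
  linarith

lemma integrable (hF : UniformExpGrowth s F) {u : ℝ} (hu : u ∈ s) (hm : Measurable (F u)) :
    Integrable (F u) (gaussPi ι) := by
  obtain ⟨C, _, h⟩ := hF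
  exact (h u hu).integrable hm

end UniformExpGrowth

/-! ### Exponentially tilted integrals with Gaussian coefficients -/

variable {X : Type*}

/-- The exponent `∑ (c k g k a k(x) - c k² a k(x)² / 2) + b(x)`. -/
noncomputable def tiltExp (a : ι → X → ℝ) (c : ι → ℝ) (b : X → ℝ) (g : ι → ℝ) (x : X) : ℝ :=
  ∑ k, (c k * g k * a k x - c k ^ 2 / 2 * a k x ^ 2) + b x

/-- The integral of `f` against the tilted, unnormalized measure; `f = 1` gives the partition
function. -/
noncomputable def tiltInt [MeasurableSpace X] (ν : Measure X) (a : ι → X → ℝ) (c : ι → ℝ)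
    (b : X → ℝ) (f : X → ℝ) (g : ι → ℝ) : ℝ :=
  ∫ x, f x * Real.exp (tiltExp a c b g x) ∂ν

/-- The coefficient functions are measurable and almost everywhere bounded by `A`. -/
structure TiltData [MeasurableSpace X] (ν : Measure X) (a : ι → X → ℝ) (A : ℝ) : Prop where
  nonneg : 0 ≤ A
  meas : ∀ k, Measurable (a k)
  bound : ∀ᵐ x ∂ν, ∀ k, |a k x| ≤ A

/-- A growth rate for the exponent: `|tiltExp a c b g x| ≤ tiltRate ι A * (1 + ∑ i, |g i|)` if the
coefficients and the weight are bounded by `A`. -/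
noncomputable def tiltRate (ι : Type*) [Fintype ι] (A : ℝ) : ℝ :=
  A ^ 2 + Fintype.card ι * A ^ 4 + A

lemma abs_tiltExp_le {a : ι → X → ℝ} {c : ι → ℝ} {b : X → ℝ} {A : ℝ} (hA : 0 ≤ A)
    (hc : ∀ k, |c k| ≤ A) {x : X} (ha : ∀ k, |a k x| ≤ A) (hb : |b x| ≤ A) (g : ι → ℝ) :
    |tiltExp a c b g x| ≤ tiltRate ι A * (1 + ∑ i, |g i|) := by
  have hg := sum_abs_nonneg g
  have h1 : |∑ k, (c k * g k * a k x - c k ^ 2 / 2 * a k x ^ 2)| ≤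
      ∑ k, (A ^ 2 * |g k| + A ^ 4) := by
    refine (Finset.abs_sum_le_sum_abs _ _).trans (Finset.sum_le_sum fun k _ => ?_)
    refine (abs_sub _ _).trans (add_le_add ?_ ?_)
    · rw [abs_mul, abs_mul]
      nlinarith [mul_le_mul (hc k) (ha k) (abs_nonneg _) hA, abs_nonneg (g k)]
    · rw [abs_mul, abs_div, abs_pow, abs_pow, abs_two]
      have e1 : |c k| ^ 2 ≤ A ^ 2 := by gcongr; exact hc k
      have e2 : |a k x| ^ 2 ≤ A ^ 2 := by gcongr; exact ha k
      calc |c k| ^ 2 / 2 * |a k x| ^ 2 ≤ A ^ 2 / 2 * A ^ 2 := by gcongr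
        _ ≤ A ^ 4 := by nlinarith [sq_nonneg (A ^ 2)]
  rw [Finset.sum_add_distrib, ← Finset.mul_sum, Finset.sum_const, Finset.card_univ,
    nsmul_eq_mul] at h1
  unfold tiltExp tiltRate
  refine (abs_add_le _ _).trans ?_
  have : 0 ≤ (Fintype.card ι * A ^ 4 + A) * ∑ i, |g i| := by positivity
  nlinarith [sq_nonneg A]

lemma tiltRate_nonneg {A : ℝ} (hA : 0 ≤ A) : 0 ≤ tiltRate ι A := by unfold tiltRate; positivity

lemma hasDerivAt_tiltExp_single [DecidableEq ι] (c : ι → ℝ) (b : X → ℝ) (k : ι) (g : ι → ℝ)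
    (x : X) (u : ℝ) :
    HasDerivAt (fun u => tiltExp a c b (g + (Pi.single k u : ι → ℝ)) x) (c k * a k x) u := by
  unfold tiltExp
  have : ∀ j, HasDerivAt (fun u => c j * (g + (Pi.single k u : ι → ℝ)) j * a j x
      - c j ^ 2 / 2 * a j x ^ 2) (if j = k then c k * a k x else 0) u := by
    intro j
    by_cases hj : j = k
    · subst hj
      simp only [Pi.add_apply, Pi.single_eq_same, if_true]
      have := ((((hasDerivAt_id' u).const_add (g j)).const_mul (c j)).mul_const
        (a j x)).sub_const (c j ^ 2 / 2 * a j x ^ 2)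
      simpa only [mul_one] using this
    · simp only [Pi.add_apply, Pi.single_eq_of_ne hj, if_neg hj]
      exact hasDerivAt_const _ _
  have h := (HasDerivAt.fun_sum (u := Finset.univ) fun j _ => this j).add_const (b x)
  simpa only [Finset.sum_ite_eq', Finset.mem_univ, if_true] using h

section Tilt

variable [MeasurableSpace X] {ν : Measure X} [IsFiniteMeasure ν] {a : ι → X → ℝ} {A : ℝ}

lemma measurable_tiltExp (ha : ∀ k, Measurable (a k)) {b : X → ℝ} (hb : Measurable b)
    (c : ι → ℝ) : Measurable fun p : (ι → ℝ) × X => tiltExp a c b p.1 p.2 := by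
  unfold tiltExp
  fun_prop

lemma measurable_tiltExp_right (ha : ∀ k, Measurable (a k)) {b : X → ℝ} (hb : Measurable b)
    (c g : ι → ℝ) : Measurable (tiltExp a c b g) := by
  unfold tiltExp
  fun_prop

lemma measurable_tiltInt (ha : ∀ k, Measurable (a k)) {b f : X → ℝ} (hb : Measurable b)
    (hf : Measurable f) (c : ι → ℝ) : Measurable (tiltInt ν a c b f) := by
  have : StronglyMeasurable fun p : (ι → ℝ) × X => f p.2 * Real.exp (tiltExp a c b p.1 p.2) :=
    ((hf.comp measurable_snd).mul
      (Real.measurable_exp.comp (measurable_tiltExp ha hb c))).stronglyMeasurable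
  exact this.integral_prod_right.measurable

lemma integrable_tilt (hD : TiltData ν a A) {c : ι → ℝ} (hc : ∀ k, |c k| ≤ A) {b : X → ℝ}
    (hb : Measurable b) (hbA : ∀ᵐ x ∂ν, |b x| ≤ A) {f : X → ℝ} (hf : Measurable f) {M : ℝ}
    (hfM : ∀ᵐ x ∂ν, |f x| ≤ M) (g : ι → ℝ) :
    Integrable (fun x => f x * Real.exp (tiltExp a c b g x)) ν := by
  refine Integrable.of_bound (C := M * Real.exp (tiltRate ι A * (1 + ∑ i, |g i|))) ?_ ?_
  · exact (hf.mul (Real.measurable_exp.comp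
      (measurable_tiltExp_right hD.meas hb c g))).aestronglyMeasurable
  · filter_upwards [hD.bound, hbA, hfM] with x h1 h2 h3
    have hM : 0 ≤ M := (abs_nonneg _).trans h3
    rw [Real.norm_eq_abs, abs_mul, abs_of_pos (Real.exp_pos _)]
    gcongr
    exact (le_abs_self _).trans (abs_tiltExp_le hD.nonneg hc h1 h2 g)

lemma abs_tiltInt_le (hD : TiltData ν a A) {c : ι → ℝ} (hc : ∀ k, |c k| ≤ A) {b : X → ℝ}
    (hbA : ∀ᵐ x ∂ν, |b x| ≤ A) {f : X → ℝ} {M : ℝ}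
    (hfM : ∀ᵐ x ∂ν, |f x| ≤ M) (g : ι → ℝ) :
    |tiltInt ν a c b f g| ≤
      M * Real.exp (tiltRate ι A * (1 + ∑ i, |g i|)) * ν.real Set.univ := by
  rw [← Real.norm_eq_abs, tiltInt]
  refine norm_integral_le_of_norm_le_const ?_
  filter_upwards [hD.bound, hbA, hfM] with x h1 h2 h3
  have hM : 0 ≤ M := (abs_nonneg _).trans h3
  rw [Real.norm_eq_abs, abs_mul, abs_of_pos (Real.exp_pos _)]
  gcongr
  exact (le_abs_self _).trans (abs_tiltExp_le hD.nonneg hc h1 h2 g)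

lemma le_tiltInt_one (hD : TiltData ν a A) {c : ι → ℝ} (hc : ∀ k, |c k| ≤ A) {b : X → ℝ}
    (hb : Measurable b) (hbA : ∀ᵐ x ∂ν, |b x| ≤ A) (g : ι → ℝ) :
    Real.exp (-(tiltRate ι A * (1 + ∑ i, |g i|))) * ν.real Set.univ ≤
      tiltInt ν a c b (fun _ => 1) g := by
  have h1 := integrable_tilt hD hc hb hbA (f := fun _ => (1:ℝ)) measurable_const (M := 1)
    (by simp) g
  have : ∫ _, Real.exp (-(tiltRate ι A * (1 + ∑ i, |g i|))) ∂ν ≤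
      tiltInt ν a c b (fun _ => 1) g := by
    refine integral_mono_ae (integrable_const _) h1 ?_
    filter_upwards [hD.bound, hbA] with x h2 h3
    simp only [one_mul]
    gcongr
    exact neg_le_of_abs_le (abs_tiltExp_le hD.nonneg hc h2 h3 g)
  rw [integral_const, smul_eq_mul, mul_comm] at this
  exact this

lemma tiltInt_one_pos (hν : ν ≠ 0) (hD : TiltData ν a A) {c : ι → ℝ} (hc : ∀ k, |c k| ≤ A)
    {b : X → ℝ} (hb : Measurable b) (hbA : ∀ᵐ x ∂ν, |b x| ≤ A) (g : ι → ℝ) :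
    0 < tiltInt ν a c b (fun _ => 1) g := by
  refine lt_of_lt_of_le ?_ (le_tiltInt_one hD hc hb hbA g)
  have : 0 < ν.real Set.univ := by
    rw [measureReal_def]
    exact ENNReal.toReal_pos (by simpa using hν) (measure_ne_top _ _)
  positivity

/-- Differentiation of a tilted integral along a path of exponents. -/
lemma hasDerivAt_integral_mul_exp {f : X → ℝ} (hf : Measurable f) {M R : ℝ}
    (hfM : ∀ᵐ x ∂ν, |f x| ≤ M) {E E' : ℝ → X → ℝ} (hE : ∀ u, Measurable (E u))
    (hE' : ∀ u, Measurable (E' u)) {s : Set ℝ} {u₀ : ℝ} (hs : s ∈ 𝓝 u₀)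
    (hER : ∀ᵐ x ∂ν, ∀ u ∈ s, |E u x| ≤ R ∧ |E' u x| ≤ R)
    (hd : ∀ x, ∀ u ∈ s, HasDerivAt (fun u => E u x) (E' u x) u) :
    HasDerivAt (fun u => ∫ x, f x * Real.exp (E u x) ∂ν)
      (∫ x, f x * E' u₀ x * Real.exp (E u₀ x) ∂ν) u₀ := by
  refine (hasDerivAt_integral_of_dominated_loc_of_deriv_le (s := s)
    (F' := fun u x => f x * E' u x * Real.exp (E u x))
    (bound := fun _ => M * R * Real.exp R) hs ?_ ?_ ?_ ?_ ?_ ?_).2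
  · exact Eventually.of_forall fun u =>
      (hf.mul (Real.measurable_exp.comp (hE u))).aestronglyMeasurable
  · refine Integrable.of_bound (C := M * Real.exp R)
      (hf.mul (Real.measurable_exp.comp (hE u₀))).aestronglyMeasurable ?_
    filter_upwards [hER, hfM] with x h1 h2
    have hM : 0 ≤ M := (abs_nonneg _).trans h2
    rw [Real.norm_eq_abs, abs_mul, abs_of_pos (Real.exp_pos _)]
    gcongr
    exact (le_abs_self _).trans (h1 u₀ (mem_of_mem_nhds hs)).1
  · exact ((hf.mul (hE' u₀)).mul (Real.measurable_exp.comp (hE u₀))).aestronglyMeasurable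
  · filter_upwards [hER, hfM] with x h1 h2 u hu
    have hM : 0 ≤ M := (abs_nonneg _).trans h2
    rw [Real.norm_eq_abs, abs_mul, abs_mul, abs_of_pos (Real.exp_pos _)]
    have hR : 0 ≤ R := (abs_nonneg _).trans (h1 u hu).1
    gcongr
    · exact (h1 u hu).2
    · exact (le_abs_self _).trans (h1 u hu).1
  · exact integrable_const _
  · refine ae_of_all _ fun x u hu => ?_
    exact ((hd x u hu).exp.const_mul (f x)).congr_deriv (by ring)

/-- The derivative of a tilted integral in the `k`-th Gaussian coordinate. -/
lemma hasDerivAt_tiltInt_single [DecidableEq ι] (hD : TiltData ν a A) {c : ι → ℝ}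
    (hc : ∀ k, |c k| ≤ A) {b : X → ℝ} (hb : Measurable b) (hbA : ∀ᵐ x ∂ν, |b x| ≤ A) {f : X → ℝ}
    (hf : Measurable f) {M : ℝ} (hfM : ∀ᵐ x ∂ν, |f x| ≤ M) (k : ι) (g : ι → ℝ) (s : ℝ) :
    HasDerivAt (fun s => tiltInt ν a c b f (g + (Pi.single k s : ι → ℝ)))
      (c k * tiltInt ν a c b (fun x => f x * a k x) (g + (Pi.single k s : ι → ℝ))) s := by
  have hA := hD.nonneg
  have hbound : ∀ᵐ x ∂ν, ∀ u ∈ Metric.ball s 1,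
      |tiltExp a c b (g + (Pi.single k u : ι → ℝ)) x| ≤
        tiltRate ι A * (1 + (∑ i, |g i| + (|s| + 1))) + A * A ∧
      |c k * a k x| ≤ tiltRate ι A * (1 + (∑ i, |g i| + (|s| + 1))) + A * A := by
    filter_upwards [hD.bound, hbA] with x h1 h2 u hu
    have hr := tiltRate_nonneg (ι := ι) hA
    have h3 : |u| ≤ |s| + 1 := by
      have h4 : |u - s| < 1 := by simpa [Real.dist_eq] using Metric.mem_ball.1 hu
      have := abs_add_le s (u - s)
      rw [add_sub_cancel] at this
      linarith
    have hg := sum_abs_nonneg g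
    have hAA : 0 ≤ A * A := mul_nonneg hA hA
    constructor
    · refine (abs_tiltExp_le hA hc h1 h2 _).trans ?_
      have h5 := sum_abs_add_single_le g k u
      have : tiltRate ι A * (1 + ∑ i, |(g + (Pi.single k u : ι → ℝ)) i|) ≤
        tiltRate ι A * (1 + (∑ i, |g i| + (|s| + 1))) := by gcongr; linarith
      linarith
    · rw [abs_mul]
      have := mul_le_mul (hc k) (h1 k) (abs_nonneg _) hA
      have : 0 ≤ tiltRate ι A * (1 + (∑ i, |g i| + (|s| + 1))) := by positivity
      linarith
  have key := hasDerivAt_integral_mul_exp (ν := ν) hf hfM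
    (E := fun s x => tiltExp a c b (g + (Pi.single k s : ι → ℝ)) x)
    (E' := fun _ x => c k * a k x)
    (fun u => measurable_tiltExp_right hD.meas hb c (g + (Pi.single k u : ι → ℝ)))
    (fun u => (hD.meas k).const_mul (c k))
    (Metric.ball_mem_nhds s one_pos) hbound
    (fun x u _ => hasDerivAt_tiltExp_single c b k g x u)
  refine key.congr_deriv ?_
  unfold tiltInt
  rw [← integral_const_mul]
  congr 1; ext x; ring

end Tilt

end SpikedWigner

namespace SpikedWigner

/-! ### Gaussian interpolation for a function of the partition function -/

/-- `Φ` is twice differentiable on `(0, ∞)` with derivatives `Φ₁`, `Φ₂`, and grows at most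
polynomially at infinity and at zero. The examples below are powers and `z log z`. -/
structure IsTame (Φ Φ₁ Φ₂ : ℝ → ℝ) (K : ℝ) (M : ℕ) : Prop where
  nonneg : 0 ≤ K
  deriv : ∀ z, 0 < z → HasDerivAt Φ (Φ₁ z) z
  deriv₁ : ∀ z, 0 < z → HasDerivAt Φ₁ (Φ₂ z) z
  meas : Measurable Φ
  meas₁ : Measurable Φ₁
  meas₂ : Measurable Φ₂
  bound : ∀ z, 0 < z → |Φ z| ≤ K * (z ^ M + z⁻¹ ^ M)
  bound₁ : ∀ z, 0 < z → |Φ₁ z| ≤ K * (z ^ M + z⁻¹ ^ M)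
  bound₂ : ∀ z, 0 < z → |Φ₂ z| ≤ K * (z ^ M + z⁻¹ ^ M)

variable {ι : Type*} {X : Type*}

/-- The coefficients `√(u v₁ + (1 - u) v₀)` along the interpolation. -/
noncomputable def pathCoef (v₀ v₁ : ι → ℝ) (u : ℝ) (k : ι) : ℝ :=
  √(u * v₁ k + (1 - u) * v₀ k)

/-- The weight `u β₁ + (1 - u) β₀` along the interpolation. -/
def pathWeight (β₀ β₁ : X → ℝ) (u : ℝ) (x : X) : ℝ := u * β₁ x + (1 - u) * β₀ x

/-- The derivative of `pathCoef`; when both variances vanish, so does this quotient. -/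
noncomputable def pathCoefDeriv (v₀ v₁ : ι → ℝ) (u : ℝ) (k : ι) : ℝ :=
  (v₁ k - v₀ k) / (2 * pathCoef v₀ v₁ u k)

section PathCoef

variable {v₀ v₁ : ι → ℝ}

lemma path_pos_or_zero (h₀ : ∀ k, 0 ≤ v₀ k) (h₁ : ∀ k, 0 ≤ v₁ k) {u : ℝ} (hu : u ∈ Set.Ioo (0:ℝ) 1)
    (k : ι) : 0 < u * v₁ k + (1 - u) * v₀ k ∨ (v₀ k = 0 ∧ v₁ k = 0) := by
  have hu0 := hu.1
  have hu1 : 0 < 1 - u := by linarith [hu.2]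
  rcases (h₀ k).lt_or_eq with h | h
  · left; have := mul_nonneg hu0.le (h₁ k); have := mul_pos hu1 h; linarith
  · rcases (h₁ k).lt_or_eq with h' | h'
    · left; rw [← h]; have := mul_pos hu0 h'; linarith
    · right; exact ⟨h.symm, h'.symm⟩

lemma hasDerivAt_pathCoef (h₀ : ∀ k, 0 ≤ v₀ k) (h₁ : ∀ k, 0 ≤ v₁ k) {u : ℝ}
    (hu : u ∈ Set.Ioo (0:ℝ) 1) (k : ι) :
    HasDerivAt (fun u => pathCoef v₀ v₁ u k) (pathCoefDeriv v₀ v₁ u k) u := by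
  unfold pathCoefDeriv pathCoef
  rcases path_pos_or_zero h₀ h₁ hu k with h | ⟨h, h'⟩
  · have h1 : HasDerivAt (fun u => u * v₁ k + (1 - u) * v₀ k) (v₁ k - v₀ k) u :=
      (((hasDerivAt_id' u).mul_const (v₁ k)).fun_add
        (((hasDerivAt_id' u).const_sub 1).mul_const (v₀ k))).congr_deriv (by ring)
    exact h1.sqrt h.ne'
  · simp only [h, h']
    simpa using hasDerivAt_const u (0:ℝ)

lemma pathCoef_mul_deriv (h₀ : ∀ k, 0 ≤ v₀ k) (h₁ : ∀ k, 0 ≤ v₁ k) {u : ℝ}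
    (hu : u ∈ Set.Ioo (0:ℝ) 1) (k : ι) :
    pathCoefDeriv v₀ v₁ u k * pathCoef v₀ v₁ u k = (v₁ k - v₀ k) / 2 := by
  unfold pathCoefDeriv pathCoef
  rcases path_pos_or_zero h₀ h₁ hu k with h | ⟨h, h'⟩
  · have := (Real.sqrt_pos.2 h).ne'
    generalize √(u * v₁ k + (1 - u) * v₀ k) = w at *
    field_simp
  · simp [h, h']

lemma continuousAt_pathCoefDeriv (h₀ : ∀ k, 0 ≤ v₀ k) (h₁ : ∀ k, 0 ≤ v₁ k) {u : ℝ}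
    (hu : u ∈ Set.Ioo (0:ℝ) 1) (k : ι) : ContinuousAt (fun u => pathCoefDeriv v₀ v₁ u k) u := by
  unfold pathCoefDeriv pathCoef
  rcases path_pos_or_zero h₀ h₁ hu k with h | ⟨h, h'⟩
  · refine ContinuousAt.div (by fun_prop) (by fun_prop) ?_
    have := Real.sqrt_pos.2 h
    positivity
  · simp only [h, h']
    simpa using continuousAt_const

lemma exists_nhds_bound_pathCoefDeriv [Fintype ι] (h₀ : ∀ k, 0 ≤ v₀ k) (h₁ : ∀ k, 0 ≤ v₁ k) {u : ℝ}
    (hu : u ∈ Set.Ioo (0:ℝ) 1) : ∃ R : ℝ, 0 ≤ R ∧ ∃ s ∈ 𝓝 u, s ⊆ Set.Ioo (0:ℝ) 1 ∧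
      ∀ w ∈ s, ∀ k, |pathCoefDeriv v₀ v₁ w k| ≤ R := by
  refine ⟨∑ k, (|pathCoefDeriv v₀ v₁ u k| + 1), by positivity,
    {w | w ∈ Set.Ioo (0:ℝ) 1 ∧ ∀ k, |pathCoefDeriv v₀ v₁ w k| ≤ |pathCoefDeriv v₀ v₁ u k| + 1},
    ?_, fun w hw => hw.1, fun w hw k => ?_⟩
  · refine Filter.inter_mem (Ioo_mem_nhds hu.1 hu.2) ?_
    refine Filter.eventually_all.2 fun k => ?_
    have := (continuousAt_pathCoefDeriv h₀ h₁ hu k).abs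
    filter_upwards [this.eventually_lt_const (show |pathCoefDeriv v₀ v₁ u k| <
      |pathCoefDeriv v₀ v₁ u k| + 1 by linarith)] with w hw using hw.le
  · refine (hw.2 k).trans ?_
    exact Finset.single_le_sum (f := fun k => |pathCoefDeriv v₀ v₁ u k| + 1)
      (fun i _ => by positivity) (Finset.mem_univ k)

lemma abs_pathCoef_le {A : ℝ} (hA : 0 ≤ A) (h₀ : ∀ k, v₀ k ≤ A ^ 2) (h₁ : ∀ k, v₁ k ≤ A ^ 2)
    {u : ℝ} (hu : u ∈ Set.Icc (0:ℝ) 1) (k : ι) : |pathCoef v₀ v₁ u k| ≤ A := by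
  unfold pathCoef
  rw [abs_of_nonneg (Real.sqrt_nonneg _)]
  refine Real.sqrt_le_iff.2 ⟨hA, ?_⟩
  nlinarith [h₀ k, h₁ k, hu.1, hu.2]

end PathCoef

lemma abs_pathWeight_le {β₀ β₁ : X → ℝ} {A : ℝ} {x : X} (h₀ : |β₀ x| ≤ A) (h₁ : |β₁ x| ≤ A)
    {u : ℝ} (hu : u ∈ Set.Icc (0:ℝ) 1) : |pathWeight β₀ β₁ u x| ≤ A := by
  unfold pathWeight
  rw [abs_le] at *
  have := hu.1
  have := hu.2
  constructor <;> nlinarith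

variable [MeasurableSpace X]

/-- The hypotheses on an interpolation between two Gaussian Hamiltonians with the same coefficient
functions `a`, variances `v₀`, `v₁` and weights `β₀`, `β₁`. -/
structure PathData (ν : Measure X) (a : ι → X → ℝ) (v₀ v₁ : ι → ℝ) (β₀ β₁ : X → ℝ) (A : ℝ) :
    Prop extends TiltData ν a A where
  v₀_nonneg : ∀ k, 0 ≤ v₀ k
  v₁_nonneg : ∀ k, 0 ≤ v₁ k
  v₀_le : ∀ k, v₀ k ≤ A ^ 2
  v₁_le : ∀ k, v₁ k ≤ A ^ 2
  meas₀ : Measurable β₀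
  meas₁ : Measurable β₁
  bound₀ : ∀ᵐ x ∂ν, |β₀ x| ≤ A
  bound₁ : ∀ᵐ x ∂ν, |β₁ x| ≤ A

/-- The tilted integral of `f` at time `u` of the interpolation. -/
noncomputable def pathInt [Fintype ι] (ν : Measure X) (a : ι → X → ℝ) (v₀ v₁ : ι → ℝ)
    (β₀ β₁ : X → ℝ) (f : X → ℝ) (u : ℝ) (g : ι → ℝ) : ℝ :=
  tiltInt ν a (pathCoef v₀ v₁ u) (pathWeight β₀ β₁ u) f g

lemma measurable_pathWeight {β₀ β₁ : X → ℝ} (h₀ : Measurable β₀) (h₁ : Measurable β₁) (u : ℝ) :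
    Measurable (pathWeight β₀ β₁ u) := by
  unfold pathWeight; fun_prop

section Path

variable {ν : Measure X} {a : ι → X → ℝ} {v₀ v₁ : ι → ℝ} {β₀ β₁ : X → ℝ}
  {A : ℝ}

lemma PathData.weight_bound (hD : PathData ν a v₀ v₁ β₀ β₁ A) :
    ∀ᵐ x ∂ν, ∀ u ∈ Set.Icc (0:ℝ) 1, |pathWeight β₀ β₁ u x| ≤ A := by
  filter_upwards [hD.bound₀, hD.bound₁] with x h₀ h₁ u hu
  exact abs_pathWeight_le h₀ h₁ hu

lemma PathData.weight_bound' (hD : PathData ν a v₀ v₁ β₀ β₁ A) {u : ℝ}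
    (hu : u ∈ Set.Icc (0:ℝ) 1) : ∀ᵐ x ∂ν, |pathWeight β₀ β₁ u x| ≤ A :=
  hD.weight_bound.mono fun _ h => h u hu

lemma PathData.coef_bound (hD : PathData ν a v₀ v₁ β₀ β₁ A) {u : ℝ} (hu : u ∈ Set.Icc (0:ℝ) 1) :
    ∀ k, |pathCoef v₀ v₁ u k| ≤ A :=
  abs_pathCoef_le hD.nonneg hD.v₀_le hD.v₁_le hu

variable [Fintype ι] [IsFiniteMeasure ν]

lemma PathData.measurable_pathInt (hD : PathData ν a v₀ v₁ β₀ β₁ A) {f : X → ℝ}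
    (hf : Measurable f) (u : ℝ) : Measurable (pathInt ν a v₀ v₁ β₀ β₁ f u) :=
  measurable_tiltInt hD.meas (measurable_pathWeight hD.meas₀ hD.meas₁ u) hf _

lemma PathData.pathInt_pos (hD : PathData ν a v₀ v₁ β₀ β₁ A) (hν : ν ≠ 0) {u : ℝ}
    (hu : u ∈ Set.Icc (0:ℝ) 1) (g : ι → ℝ) : 0 < pathInt ν a v₀ v₁ β₀ β₁ (fun _ => 1) u g :=
  tiltInt_one_pos hν hD.toTiltData (hD.coef_bound hu)
    (measurable_pathWeight hD.meas₀ hD.meas₁ u) (hD.weight_bound' hu) g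

lemma PathData.growth_pathInt (hD : PathData ν a v₀ v₁ β₀ β₁ A) {f : X → ℝ} {M : ℝ}
    (hM : 0 ≤ M) (hfM : ∀ᵐ x ∂ν, |f x| ≤ M) :
    UniformExpGrowth (Set.Icc 0 1) (pathInt ν a v₀ v₁ β₀ β₁ f) := by
  refine UniformExpGrowth.of_le (C := M * Real.exp (tiltRate ι A) * ν.real Set.univ)
    (L := tiltRate ι A) (by positivity) (tiltRate_nonneg hD.nonneg) fun u hu g => ?_
  refine (abs_tiltInt_le hD.toTiltData (hD.coef_bound hu) (hD.weight_bound' hu) hfM g).trans_eq ?_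
  rw [mul_add, mul_one, Real.exp_add]
  ring

/-- A tame function of the partition function has exponential growth, uniformly along the path. -/
lemma PathData.growth_comp (hD : PathData ν a v₀ v₁ β₀ β₁ A) (hν : ν ≠ 0) {Φ : ℝ → ℝ} {K : ℝ}
    {M : ℕ} (hK : 0 ≤ K) (hΦ : ∀ z, 0 < z → |Φ z| ≤ K * (z ^ M + z⁻¹ ^ M)) :
    UniformExpGrowth (Set.Icc 0 1)
      (fun u g => Φ (pathInt ν a v₀ v₁ β₀ β₁ (fun _ => 1) u g)) := by
  have hn : 0 < ν.real Set.univ := by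
    rw [measureReal_def]
    exact ENNReal.toReal_pos (by simpa using hν) (measure_ne_top _ _)
  set n := ν.real Set.univ
  set L := tiltRate ι A
  refine UniformExpGrowth.of_le
    (C := K * ((Real.exp L * n) ^ M + (Real.exp L * n⁻¹) ^ M))
    (L := M * L) (by positivity)
    (mul_nonneg (Nat.cast_nonneg _) (tiltRate_nonneg hD.nonneg)) fun u hu g => ?_
  have hpos := hD.pathInt_pos hν hu g
  set z := pathInt ν a v₀ v₁ β₀ β₁ (fun _ => 1) u g
  have hz1 : z ≤ Real.exp L * n * Real.exp (L * ∑ i, |g i|) := by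
    have := abs_tiltInt_le hD.toTiltData (hD.coef_bound hu) (hD.weight_bound' hu)
      (f := fun _ => (1:ℝ)) (M := 1) (by simp) g
    refine (le_abs_self _).trans (this.trans_eq ?_)
    rw [mul_add, mul_one, Real.exp_add]
    ring
  have hz2 : z⁻¹ ≤ Real.exp L * n⁻¹ * Real.exp (L * ∑ i, |g i|) := by
    have := le_tiltInt_one hD.toTiltData (hD.coef_bound hu)
      (measurable_pathWeight hD.meas₀ hD.meas₁ u) (hD.weight_bound' hu) g
    have h2 : Real.exp L * n⁻¹ * Real.exp (L * ∑ i, |g i|) =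
        (Real.exp (-(L * (1 + ∑ i, |g i|))) * n)⁻¹ := by
      rw [Real.exp_neg, mul_add, mul_one, Real.exp_add]
      field_simp
    rw [h2]
    exact inv_anti₀ (by positivity) this
  calc |Φ z| ≤ K * (z ^ M + z⁻¹ ^ M) := hΦ z hpos
    _ ≤ K * ((Real.exp L * n * Real.exp (L * ∑ i, |g i|)) ^ M +
        (Real.exp L * n⁻¹ * Real.exp (L * ∑ i, |g i|)) ^ M) := by gcongr
    _ = _ := by
      rw [mul_pow _ (Real.exp (L * ∑ i, |g i|)), mul_pow _ (Real.exp (L * ∑ i, |g i|)),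
        ← Real.exp_nat_mul, ← mul_assoc]
      ring

/-- Continuity of the expectation along the interpolation, endpoints included. -/
lemma PathData.continuousOn_integral (hD : PathData ν a v₀ v₁ β₀ β₁ A) (hν : ν ≠ 0)
    {Φ Φ₁ Φ₂ : ℝ → ℝ} {K : ℝ} {M : ℕ} (hΦ : IsTame Φ Φ₁ Φ₂ K M) :
    ContinuousOn (fun u => ∫ g, Φ (pathInt ν a v₀ v₁ β₀ β₁ (fun _ => 1) u g) ∂(gaussPi ι))
      (Set.Icc 0 1) := by
  obtain ⟨C, hC, hG⟩ := hD.growth_comp hν hΦ.nonneg hΦ.bound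
  refine continuousOn_of_dominated (bound := fun g => C * Real.exp (C * ∑ i, |g i|)) ?_ ?_ ?_ ?_
  · exact fun u _ => (hΦ.meas.comp (hD.measurable_pathInt measurable_const u)).aestronglyMeasurable
  · exact fun u hu => ae_of_all _ (hG u hu)
  · exact (integrable_exp_mul_sum_abs C).const_mul C
  · refine ae_of_all _ fun g u hu => ?_
    refine ContinuousAt.comp_continuousWithinAt (f := fun u => pathInt ν a v₀ v₁ β₀ β₁
      (fun _ => 1) u g) (hΦ.deriv _ (hD.pathInt_pos hν hu g)).continuousAt ?_
    refine continuousWithinAt_of_dominated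
      (bound := fun _ => Real.exp (tiltRate ι A * (1 + ∑ i, |g i|))) ?_ ?_ (integrable_const _) ?_
    · exact Eventually.of_forall fun w => (measurable_const.mul (Real.measurable_exp.comp
        (measurable_tiltExp_right hD.meas (measurable_pathWeight hD.meas₀ hD.meas₁ w) _
          g))).aestronglyMeasurable
    · filter_upwards [self_mem_nhdsWithin] with w hw
      filter_upwards [hD.bound, hD.weight_bound' hw] with x h1 h2
      rw [one_mul, Real.norm_eq_abs, abs_of_pos (Real.exp_pos _)]
      gcongr
      exact (le_abs_self _).trans (abs_tiltExp_le hD.nonneg (hD.coef_bound hw) h1 h2 g)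
    · refine ae_of_all _ fun x => ?_
      unfold tiltExp pathCoef pathWeight
      fun_prop

end Path

end SpikedWigner

namespace SpikedWigner

variable {ι : Type*} [Fintype ι] {X : Type*} [MeasurableSpace X]

lemma UniformExpGrowth.mono {s t : Set ℝ} {F : ℝ → (ι → ℝ) → ℝ} (h : UniformExpGrowth t F)
    (hst : s ⊆ t) : UniformExpGrowth s F := by
  obtain ⟨C, hC, h⟩ := h
  exact ⟨C, hC, fun u hu => h u (hst hu)⟩

section Path

variable {ν : Measure X} [IsFiniteMeasure ν] {a : ι → X → ℝ} {v₀ v₁ : ι → ℝ} {β₀ β₁ : X → ℝ}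
  {A : ℝ}

/-- The derivative of the partition function along the path, for fixed Gaussian vector. -/
lemma PathData.hasDerivAt_pathInt (hD : PathData ν a v₀ v₁ β₀ β₁ A) {u : ℝ}
    (hu : u ∈ Set.Ioo (0:ℝ) 1) (g : ι → ℝ) :
    HasDerivAt (fun u => pathInt ν a v₀ v₁ β₀ β₁ (fun _ => 1) u g)
      (∑ k, (pathCoefDeriv v₀ v₁ u k * (g k * pathInt ν a v₀ v₁ β₀ β₁ (a k) u g)
        - (v₁ k - v₀ k) / 2 * pathInt ν a v₀ v₁ β₀ β₁ (fun x => a k x * a k x) u g)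
        + pathInt ν a v₀ v₁ β₀ β₁ (fun x => β₁ x - β₀ x) u g) u := by
  obtain ⟨R, hR, s, hs, hs01, hsR⟩ := exists_nhds_bound_pathCoefDeriv hD.v₀_nonneg hD.v₁_nonneg hu
  have hA := hD.nonneg
  have hg := sum_abs_nonneg g
  have hIcc : u ∈ Set.Icc (0:ℝ) 1 := Set.Ioo_subset_Icc_self hu
  set E' : ℝ → X → ℝ := fun w x => ∑ k, (pathCoefDeriv v₀ v₁ w k * g k * a k x
    - (v₁ k - v₀ k) / 2 * a k x ^ 2) + (β₁ x - β₀ x) with hE'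
  have hm := hD.meas
  have hm0 := hD.meas₀
  have hm1 := hD.meas₁
  have hE'b : ∀ᵐ x ∂ν, ∀ w ∈ s, |E' w x| ≤ ∑ k, (R * |g k| * A + A ^ 2 * A ^ 2) + (A + A) := by
    filter_upwards [hD.bound, hD.bound₀, hD.bound₁] with x h1 h2 h3 w hw
    refine (abs_add_le _ _).trans (add_le_add ?_ ((abs_sub _ _).trans (add_le_add h3 h2)))
    refine (Finset.abs_sum_le_sum_abs _ _).trans (Finset.sum_le_sum fun k _ => ?_)
    refine (abs_sub _ _).trans (add_le_add ?_ ?_)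
    · rw [abs_mul, abs_mul]
      gcongr
      exacts [hsR w hw k, h1 k]
    · rw [abs_mul, abs_pow]
      gcongr
      · rw [abs_le]
        constructor <;> linarith [hD.v₀_nonneg k, hD.v₁_nonneg k, hD.v₀_le k, hD.v₁_le k]
      · exact h1 k
  have key := hasDerivAt_integral_mul_exp (ν := ν) (f := fun _ => 1) measurable_const
    (M := 1) (by simp)
    (E := fun w x => tiltExp a (pathCoef v₀ v₁ w) (pathWeight β₀ β₁ w) g x) (E' := E')
    (R := tiltRate ι A * (1 + ∑ i, |g i|) + (∑ k, (R * |g k| * A + A ^ 2 * A ^ 2) + (A + A)))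
    (fun w => measurable_tiltExp_right hm (measurable_pathWeight hm0 hm1 w) _ g)
    (fun w => by rw [hE']; fun_prop) hs ?_ ?_
  · refine key.congr_deriv ?_
    have hi : ∀ {f : X → ℝ} {M : ℝ}, Measurable f → (∀ᵐ x ∂ν, |f x| ≤ M) →
        Integrable (fun x => f x * Real.exp (tiltExp a (pathCoef v₀ v₁ u)
          (pathWeight β₀ β₁ u) g x)) ν := fun hf hM =>
      integrable_tilt hD.toTiltData (hD.coef_bound hIcc)
        (measurable_pathWeight hm0 hm1 u) (hD.weight_bound' hIcc) hf hM g
    have hak : ∀ k, ∀ᵐ x ∂ν, |a k x| ≤ A := fun k => hD.bound.mono fun x h => h k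
    have haak : ∀ k, ∀ᵐ x ∂ν, |a k x * a k x| ≤ A * A := fun k => (hak k).mono fun x h => by
      rw [abs_mul]; gcongr
    have hβ : ∀ᵐ x ∂ν, |β₁ x - β₀ x| ≤ A + A := by
      filter_upwards [hD.bound₀, hD.bound₁] with x h2 h3
      exact (abs_sub _ _).trans (add_le_add h3 h2)
    unfold pathInt tiltInt
    simp_rw [← mul_assoc (pathCoefDeriv _ _ _ _), ← integral_const_mul]
    have e1 : ∀ k ∈ Finset.univ, Integrable (fun x => pathCoefDeriv v₀ v₁ u k * g k *
        (a k x * Real.exp (tiltExp a (pathCoef v₀ v₁ u) (pathWeight β₀ β₁ u) g x)) -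
        (v₁ k - v₀ k) / 2 * (a k x * a k x *
          Real.exp (tiltExp a (pathCoef v₀ v₁ u) (pathWeight β₀ β₁ u) g x))) ν := fun k _ =>
      ((hi (hm k) (hak k)).const_mul _).sub ((hi ((hm k).mul (hm k)) (haak k)).const_mul _)
    have e2 : ∀ k, ∫ x, pathCoefDeriv v₀ v₁ u k * g k *
        (a k x * Real.exp (tiltExp a (pathCoef v₀ v₁ u) (pathWeight β₀ β₁ u) g x)) ∂ν -
        ∫ x, (v₁ k - v₀ k) / 2 * (a k x * a k x *
          Real.exp (tiltExp a (pathCoef v₀ v₁ u) (pathWeight β₀ β₁ u) g x)) ∂ν =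
        ∫ x, (pathCoefDeriv v₀ v₁ u k * g k *
        (a k x * Real.exp (tiltExp a (pathCoef v₀ v₁ u) (pathWeight β₀ β₁ u) g x)) -
        (v₁ k - v₀ k) / 2 * (a k x * a k x *
          Real.exp (tiltExp a (pathCoef v₀ v₁ u) (pathWeight β₀ β₁ u) g x))) ∂ν := fun k =>
      (integral_sub ((hi (hm k) (hak k)).const_mul _)
        ((hi ((hm k).mul (hm k)) (haak k)).const_mul _)).symm
    simp_rw [e2]
    rw [← integral_finsetSum _ e1, ← integral_add (integrable_finsetSum _ e1)
      (hi (f := fun x => β₁ x - β₀ x) (hm1.sub hm0) hβ)]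
    congr 1; ext x
    simp only [hE']
    simp only [one_mul, add_mul, Finset.sum_mul]
    congr 1
    refine Finset.sum_congr rfl fun k _ => ?_
    ring
  · filter_upwards [hD.bound, hD.weight_bound, hE'b] with x h1 h2 h3 w hw
    have hr := tiltRate_nonneg (ι := ι) hA
    have hw' := Set.Ioo_subset_Icc_self (hs01 hw)
    have p1 := abs_tiltExp_le hA (hD.coef_bound hw') h1 (h2 w hw') g
    have p2 := h3 w hw
    have q1 : 0 ≤ tiltRate ι A * (1 + ∑ i, |g i|) := by positivity
    have q2 := (abs_nonneg _).trans p2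
    exact ⟨by linarith, by linarith⟩
  · intro x w hw
    have hw' := hs01 hw
    have h1 : ∀ k, HasDerivAt (fun w => pathCoef v₀ v₁ w k * g k * a k x -
        pathCoef v₀ v₁ w k ^ 2 / 2 * a k x ^ 2)
        (pathCoefDeriv v₀ v₁ w k * g k * a k x - (v₁ k - v₀ k) / 2 * a k x ^ 2) w := by
      intro k
      have h := hasDerivAt_pathCoef hD.v₀_nonneg hD.v₁_nonneg hw' k
      have h' := pathCoef_mul_deriv hD.v₀_nonneg hD.v₁_nonneg hw' k
      refine (((h.mul_const (g k)).mul_const (a k x)).fun_sub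
        (((h.fun_pow 2).div_const 2).mul_const (a k x ^ 2))).congr_deriv ?_
      rw [← h']; push_cast; ring
    have h2 : HasDerivAt (fun w => pathWeight β₀ β₁ w x) (β₁ x - β₀ x) w :=
      (((hasDerivAt_id' w).mul_const (β₁ x)).fun_add
        (((hasDerivAt_id' w).const_sub 1).mul_const (β₀ x))).congr_deriv (by ring)
    exact (HasDerivAt.fun_sum (u := Finset.univ) fun k _ => h1 k).fun_add h2

/-- Gaussian interpolation: the derivative of `E Φ(Z_u)`. Integration by parts turns the derivative
of the Gaussian part into one half of `∑ (v₁ k - v₀ k) E Φ''(Z) (∫ a k)²`. -/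
theorem PathData.hasDerivAt_integral (hD : PathData ν a v₀ v₁ β₀ β₁ A) (hν : ν ≠ 0)
    {Φ Φ₁ Φ₂ : ℝ → ℝ} {K : ℝ} {M : ℕ} (hΦ : IsTame Φ Φ₁ Φ₂ K M) {u : ℝ}
    (hu : u ∈ Set.Ioo (0:ℝ) 1) :
    Integrable (fun g => ∑ k, (v₁ k - v₀ k) / 2 * (Φ₂ (pathInt ν a v₀ v₁ β₀ β₁ (fun _ => 1) u g) *
        pathInt ν a v₀ v₁ β₀ β₁ (a k) u g ^ 2) +
        Φ₁ (pathInt ν a v₀ v₁ β₀ β₁ (fun _ => 1) u g) *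
          pathInt ν a v₀ v₁ β₀ β₁ (fun x => β₁ x - β₀ x) u g) (gaussPi ι) ∧
    HasDerivAt (fun u => ∫ g, Φ (pathInt ν a v₀ v₁ β₀ β₁ (fun _ => 1) u g) ∂(gaussPi ι))
      (∫ g, (∑ k, (v₁ k - v₀ k) / 2 * (Φ₂ (pathInt ν a v₀ v₁ β₀ β₁ (fun _ => 1) u g) *
        pathInt ν a v₀ v₁ β₀ β₁ (a k) u g ^ 2) +
        Φ₁ (pathInt ν a v₀ v₁ β₀ β₁ (fun _ => 1) u g) *
          pathInt ν a v₀ v₁ β₀ β₁ (fun x => β₁ x - β₀ x) u g) ∂(gaussPi ι)) u := by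
  classical
  obtain ⟨R, hR, s, hs, hs01, hsR⟩ := exists_nhds_bound_pathCoefDeriv hD.v₀_nonneg hD.v₁_nonneg hu
  have hA := hD.nonneg
  have hIcc : u ∈ Set.Icc (0:ℝ) 1 := Set.Ioo_subset_Icc_self hu
  have hsI : s ⊆ Set.Icc 0 1 := hs01.trans Set.Ioo_subset_Icc_self
  have hm := hD.meas
  have hak : ∀ k, ∀ᵐ x ∂ν, |a k x| ≤ A := fun k => hD.bound.mono fun x h => h k
  have haak : ∀ k, ∀ᵐ x ∂ν, |a k x * a k x| ≤ A * A := fun k => (hak k).mono fun x h => by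
    rw [abs_mul]; gcongr
  have hβ : ∀ᵐ x ∂ν, |β₁ x - β₀ x| ≤ A + A := by
    filter_upwards [hD.bound₀, hD.bound₁] with x h2 h3
    exact (abs_sub _ _).trans (add_le_add h3 h2)
  set J := pathInt ν a v₀ v₁ β₀ β₁ with hJ
  have gZ := hD.growth_comp hν hΦ.nonneg hΦ.bound
  have gZ1 := hD.growth_comp hν hΦ.nonneg hΦ.bound₁
  have gZ2 := hD.growth_comp hν hΦ.nonneg hΦ.bound₂
  have ga : ∀ k, UniformExpGrowth (Set.Icc 0 1) (J (a k)) := fun k => hD.growth_pathInt hA (hak k)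
  have gaa : ∀ k, UniformExpGrowth (Set.Icc 0 1) (J fun x => a k x * a k x) := fun k =>
    hD.growth_pathInt (mul_nonneg hA hA) (haak k)
  have gβ : UniformExpGrowth (Set.Icc 0 1) (J fun x => β₁ x - β₀ x) :=
    hD.growth_pathInt (add_nonneg hA hA) hβ
  have mJ : ∀ {f : X → ℝ}, Measurable f → ∀ w, Measurable (J f w) := fun hf w =>
    hD.measurable_pathInt hf w
  have mΦ1 : ∀ w, Measurable fun g => Φ₁ (J (fun _ => 1) w g) := fun w =>
    hΦ.meas₁.comp (mJ measurable_const w)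
  have mΦ2 : ∀ w, Measurable fun g => Φ₂ (J (fun _ => 1) w g) := fun w =>
    hΦ.meas₂.comp (mJ measurable_const w)
  have ma := fun k w => mJ (hm k) w
  have maa := fun k w => mJ ((hm k).mul (hm k)) w
  have mβ := fun w => mJ (hD.meas₁.sub hD.meas₀) w
  set F' : ℝ → (ι → ℝ) → ℝ := fun w g =>
    ∑ k, (pathCoefDeriv v₀ v₁ w k * (g k * (Φ₁ (J (fun _ => 1) w g) * J (a k) w g))
      - (v₁ k - v₀ k) / 2 * (Φ₁ (J (fun _ => 1) w g) * J (fun x => a k x * a k x) w g))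
      + Φ₁ (J (fun _ => 1) w g) * J (fun x => β₁ x - β₀ x) w g with hF'
  have gterm : ∀ k, UniformExpGrowth s (fun w g => pathCoefDeriv v₀ v₁ w k *
      (g k * (Φ₁ (J (fun _ => 1) w g) * J (a k) w g))) := fun k =>
    (UniformExpGrowth.bounded (C := R) fun w hw => hsR w hw k).mul
      ((UniformExpGrowth.coord k).mul ((gZ1.mul (ga k)).mono hsI))
  have gterm2 : ∀ k, UniformExpGrowth s (fun w g => (v₁ k - v₀ k) / 2 *
      (Φ₁ (J (fun _ => 1) w g) * J (fun x => a k x * a k x) w g)) := fun k =>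
    (UniformExpGrowth.bounded (c := fun _ => (v₁ k - v₀ k) / 2) fun w _ => le_rfl).mul
      ((gZ1.mul (gaa k)).mono hsI)
  have gF' : UniformExpGrowth s F' := by
    refine (UniformExpGrowth.sum Finset.univ fun k _ => ?_).add ((gZ1.mul gβ).mono hsI)
    have := (gterm k).add ((UniformExpGrowth.bounded (c := fun _ => (-1:ℝ))
      fun w _ => le_rfl).mul (gterm2 k))
    simpa [sub_eq_add_neg] using this
  obtain ⟨C, hC, hCF⟩ := gF'
  have mF' : ∀ w, Measurable (F' w) := by
    intro w
    refine Measurable.add (Finset.measurable_fun_sum _ fun k _ => ?_) ((mΦ1 w).mul (mβ w))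
    exact (((measurable_pi_apply k).mul ((mΦ1 w).mul (ma k w))).const_mul _).sub
      (((mΦ1 w).mul (maa k w)).const_mul _)
  -- Differentiation under the integral sign.
  have key : HasDerivAt (fun u => ∫ g, Φ (J (fun _ => 1) u g) ∂(gaussPi ι))
      (∫ g, F' u g ∂(gaussPi ι)) u := by
    refine (hasDerivAt_integral_of_dominated_loc_of_deriv_le (s := s) (F' := F')
      (bound := fun g => C * Real.exp (C * ∑ i, |g i|)) hs ?_ ?_ ?_ ?_ ?_ ?_).2
    · exact Eventually.of_forall fun w =>
        (hΦ.meas.comp (mJ measurable_const w)).aestronglyMeasurable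
    · exact gZ.integrable hIcc (hΦ.meas.comp (mJ measurable_const u))
    · exact (mF' u).aestronglyMeasurable
    · exact ae_of_all _ fun g w hw => hCF w hw g
    · exact (integrable_exp_mul_sum_abs C).const_mul C
    · refine ae_of_all _ fun g w hw => ?_
      have h1 := hΦ.deriv _ (hD.pathInt_pos hν (hsI hw) g)
      refine (h1.comp w (hD.hasDerivAt_pathInt (hs01 hw) g)).congr_deriv ?_
      rw [hF']
      simp only [mul_add, Finset.mul_sum]
      congr 1
      refine Finset.sum_congr rfl fun k _ => ?_
      rw [hJ]; ring
  -- Gaussian integration by parts; the terms with `a k ^ 2` cancel those of the normalization.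
  have ibp : ∀ k, ∫ g, g k * (Φ₁ (J (fun _ => 1) u g) * J (a k) u g) ∂(gaussPi ι) =
      ∫ g, pathCoef v₀ v₁ u k * (Φ₂ (J (fun _ => 1) u g) * J (a k) u g ^ 2 +
        Φ₁ (J (fun _ => 1) u g) * J (fun x => a k x * a k x) u g) ∂(gaussPi ι) := by
    intro k
    have g1 := gZ1.mul (ga k)
    have g2 := (UniformExpGrowth.bounded (s := Set.Icc 0 1) (C := A)
      (c := fun _ => pathCoef v₀ v₁ u k) (fun w _ => hD.coef_bound hIcc k)).mul
      ((gZ2.mul ((ga k).mul (ga k))).add (gZ1.mul (gaa k)))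
    obtain ⟨C1, hC1, h1⟩ := g1
    obtain ⟨C2, hC2, h2⟩ := g2
    have up : ∀ {F : (ι → ℝ) → ℝ} {c d : ℝ}, 0 ≤ c → c ≤ d → ExpGrowth F c → ExpGrowth F d := by
      intro F c d hc hcd h g
      refine (h g).trans ?_
      have := sum_abs_nonneg g
      have := hc.trans hcd
      gcongr
    refine gaussPi_integral_mul_eq k (C := C1 + C2) (by positivity) ((mΦ1 u).mul (ma k u))
      ((((mΦ2 u).mul ((ma k u).pow_const 2)).add ((mΦ1 u).mul (maa k u))).const_mul _)
      (up hC1 (by linarith) (h1 u hIcc)) (up hC2 (by linarith) fun g => ?_) fun g t => ?_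
    · simpa only [sq] using h2 u hIcc g
    · have wm := measurable_pathWeight hD.meas₀ hD.meas₁ u
      have d1 := hasDerivAt_tiltInt_single hD.toTiltData (hD.coef_bound hIcc) wm
        (hD.weight_bound' hIcc) (f := fun _ => (1:ℝ)) measurable_const (M := 1) (by simp) k g t
      have d2 := hasDerivAt_tiltInt_single hD.toTiltData (hD.coef_bound hIcc) wm
        (hD.weight_bound' hIcc) (hm k) (hak k) k g t
      simp only [one_mul] at d1
      have d0 := hΦ.deriv₁ _ (hD.pathInt_pos hν hIcc (g + (Pi.single k t : ι → ℝ)))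
      refine ((d0.comp t d1).mul d2).congr_deriv ?_
      rw [hJ]
      unfold pathInt
      simp only [Function.comp]
      ring
  have i1 : ∀ k, Integrable (fun g => pathCoefDeriv v₀ v₁ u k *
      (g k * (Φ₁ (J (fun _ => 1) u g) * J (a k) u g))) (gaussPi ι) := fun k =>
    (gterm k).integrable (mem_of_mem_nhds hs)
      (((measurable_pi_apply k).mul ((mΦ1 u).mul (ma k u))).const_mul _)
  have i2 : ∀ k, Integrable (fun g => (v₁ k - v₀ k) / 2 *
      (Φ₁ (J (fun _ => 1) u g) * J (fun x => a k x * a k x) u g)) (gaussPi ι) := fun k =>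
    (gterm2 k).integrable (mem_of_mem_nhds hs) (((mΦ1 u).mul (maa k u)).const_mul _)
  have i3 : Integrable (fun g => Φ₁ (J (fun _ => 1) u g) * J (fun x => β₁ x - β₀ x) u g)
      (gaussPi ι) := (gZ1.mul gβ).integrable hIcc ((mΦ1 u).mul (mβ u))
  have i4 : ∀ k, Integrable (fun g => Φ₂ (J (fun _ => 1) u g) * J (a k) u g ^ 2) (gaussPi ι) :=
    fun k => by
      have := (gZ2.mul ((ga k).mul (ga k))).integrable hIcc
        ((mΦ2 u).mul ((ma k u).mul (ma k u)))
      simpa only [sq] using this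
  have i5 : ∀ k, Integrable (fun g => Φ₁ (J (fun _ => 1) u g) * J (fun x => a k x * a k x) u g)
      (gaussPi ι) := fun k =>
    (gZ1.mul (gaa k)).integrable hIcc ((mΦ1 u).mul (maa k u))
  have i12 : ∀ k ∈ Finset.univ, Integrable (fun g => pathCoefDeriv v₀ v₁ u k *
      (g k * (Φ₁ (J (fun _ => 1) u g) * J (a k) u g)) - (v₁ k - v₀ k) / 2 *
      (Φ₁ (J (fun _ => 1) u g) * J (fun x => a k x * a k x) u g)) (gaussPi ι) := fun k _ =>
    (i1 k).sub (i2 k)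
  have i4' : ∀ k ∈ Finset.univ, Integrable (fun g => (v₁ k - v₀ k) / 2 *
      (Φ₂ (J (fun _ => 1) u g) * J (a k) u g ^ 2)) (gaussPi ι) := fun k _ => (i4 k).const_mul _
  refine ⟨(integrable_finsetSum _ i4').add i3, key.congr_deriv ?_⟩
  simp only [hF']
  rw [integral_add (integrable_finsetSum _ i12) i3, integral_finsetSum _ i12,
    integral_add (integrable_finsetSum _ i4') i3, integral_finsetSum _ i4']
  congr 1
  refine Finset.sum_congr rfl fun k _ => ?_
  rw [integral_sub (i1 k) (i2 k), integral_const_mul, ibp, integral_const_mul, integral_const_mul,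
    integral_const_mul, integral_add (i4 k) (i5 k), ← mul_assoc,
    pathCoef_mul_deriv hD.v₀_nonneg hD.v₁_nonneg hu]
  ring

end Path

end SpikedWigner

namespace SpikedWigner

/-! ### Comparison of moments of partition functions -/

lemma rpow_le_pow_add_inv_pow {z e : ℝ} (hz : 0 < z) {M : ℕ} (he : |e| ≤ M) :
    z ^ e ≤ z ^ M + z⁻¹ ^ M := by
  have he' := abs_le.1 he
  rcases le_total 1 z with h | h
  · have : z ^ e ≤ z ^ (M : ℝ) := Real.rpow_le_rpow_of_exponent_le h he'.2
    rw [Real.rpow_natCast] at this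
    have : 0 ≤ z⁻¹ ^ M := by positivity
    linarith
  · have : z ^ e ≤ z ^ (-(M : ℝ)) := Real.rpow_le_rpow_of_exponent_ge hz h he'.1
    rw [Real.rpow_neg hz.le, Real.rpow_natCast, ← inv_pow] at this
    have : 0 ≤ z ^ M := by positivity
    linarith

lemma isTame_rpow {p : ℝ} (hp : 0 < p) (hp1 : p ≤ 1) :
    IsTame (fun z => z ^ p) (fun z => p * z ^ (p - 1)) (fun z => p * ((p - 1) * z ^ (p - 2)))
      1 2 where
  nonneg := zero_le_one
  deriv z hz := Real.hasDerivAt_rpow_const (Or.inl hz.ne')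
  deriv₁ z hz := by
    have := (Real.hasDerivAt_rpow_const (x := z) (p := p - 1) (Or.inl hz.ne')).const_mul p
    exact this.congr_deriv (by rw [show p - 1 - 1 = p - 2 by ring])
  meas := by fun_prop
  meas₁ := by fun_prop
  meas₂ := by fun_prop
  bound z hz := by
    rw [abs_of_pos (Real.rpow_pos_of_pos hz _), one_mul]
    exact rpow_le_pow_add_inv_pow hz (by rw [abs_le]; constructor <;> push_cast <;> linarith)
  bound₁ z hz := by
    have h := rpow_le_pow_add_inv_pow (e := p - 1) (M := 2) hz
      (by rw [abs_le]; constructor <;> push_cast <;> linarith)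
    rw [abs_mul, abs_of_pos hp, abs_of_pos (Real.rpow_pos_of_pos hz _)]
    have := Real.rpow_pos_of_pos hz (p - 1)
    nlinarith
  bound₂ z hz := by
    have h := rpow_le_pow_add_inv_pow (e := p - 2) (M := 2) hz
      (by rw [abs_le]; constructor <;> push_cast <;> linarith)
    rw [abs_mul, abs_mul, abs_of_pos hp, abs_of_pos (Real.rpow_pos_of_pos hz _),
      abs_of_nonpos (by linarith : p - 1 ≤ 0), ← mul_assoc]
    have := Real.rpow_pos_of_pos hz (p - 2)
    have : p * -(p - 1) ≤ 1 := by nlinarith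
    nlinarith

lemma isTame_mul_log :
    IsTame (fun z => z * Real.log z) (fun z => Real.log z + 1) (fun z => z⁻¹) 3 2 where
  nonneg := by norm_num
  deriv z hz := Real.hasDerivAt_mul_log hz.ne'
  deriv₁ z hz := (Real.hasDerivAt_log hz.ne').add_const 1
  meas := by fun_prop
  meas₁ := by fun_prop
  meas₂ := by fun_prop
  bound z hz := by
    have h1 := Real.log_le_sub_one_of_pos hz
    have h2 := Real.log_le_sub_one_of_pos (inv_pos.2 hz)
    rw [Real.log_inv] at h2
    have hzz : z * z⁻¹ = 1 := mul_inv_cancel₀ hz.ne'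
    have hi := inv_pos.2 hz
    rw [abs_mul, abs_of_pos hz]
    have : |Real.log z| ≤ z + z⁻¹ := by rw [abs_le]; constructor <;> linarith
    calc z * |Real.log z| ≤ z * (z + z⁻¹) := by gcongr
      _ = z ^ 2 + z * z⁻¹ := by ring
      _ ≤ _ := by nlinarith [sq_nonneg (z - z⁻¹)]
  bound₁ z hz := by
    have h1 := Real.log_le_sub_one_of_pos hz
    have h2 := Real.log_le_sub_one_of_pos (inv_pos.2 hz)
    rw [Real.log_inv] at h2
    have hzz : z * z⁻¹ = 1 := mul_inv_cancel₀ hz.ne'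
    have hi := inv_pos.2 hz
    have : |Real.log z + 1| ≤ z + z⁻¹ + 1 := by rw [abs_le]; constructor <;> linarith
    refine this.trans ?_
    nlinarith [sq_nonneg (z - 1), sq_nonneg (z⁻¹ - 1), sq_nonneg (z - z⁻¹)]
  bound₂ z hz := by
    have hzz : z * z⁻¹ = 1 := mul_inv_cancel₀ hz.ne'
    have hi := inv_pos.2 hz
    rw [abs_of_pos hi]
    nlinarith [sq_nonneg (z⁻¹ - 1), sq_nonneg (z - z⁻¹)]

variable {ι : Type*} [Fintype ι] {X : Type*} [MeasurableSpace X]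
  {ν : Measure X} [IsFiniteMeasure ν] {a : ι → X → ℝ} {v₀ v₁ : ι → ℝ} {β₀ β₁ : X → ℝ}
  {A : ℝ}

/-- If `(p - 1)/2 ∑ (v₁ - v₀)_k a_k(x) a_k(y) + β₁(x) - β₀(x)` is at most `D` for all replicas
`x`, `y`, then so is its Gibbs average with two replicas. -/
lemma PathData.two_replica_le (hD : PathData ν a v₀ v₁ β₀ β₁ A) {p D : ℝ}
    (h : ∀ᵐ x ∂ν, ∀ᵐ y ∂ν,
      (p - 1) / 2 * ∑ k, (v₁ k - v₀ k) * (a k x * a k y) + (β₁ x - β₀ x) ≤ D)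
    {u : ℝ} (hu : u ∈ Set.Icc (0:ℝ) 1) (g : ι → ℝ) :
    (p - 1) / 2 * ∑ k, (v₁ k - v₀ k) * pathInt ν a v₀ v₁ β₀ β₁ (a k) u g ^ 2 +
      pathInt ν a v₀ v₁ β₀ β₁ (fun _ => 1) u g *
        pathInt ν a v₀ v₁ β₀ β₁ (fun x => β₁ x - β₀ x) u g ≤
      D * pathInt ν a v₀ v₁ β₀ β₁ (fun _ => 1) u g ^ 2 := by
  have hak : ∀ k, ∀ᵐ x ∂ν, |a k x| ≤ A := fun k => hD.bound.mono fun x h => h k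
  have hβ : ∀ᵐ x ∂ν, |β₁ x - β₀ x| ≤ A + A := by
    filter_upwards [hD.bound₀, hD.bound₁] with x h2 h3
    exact (abs_sub _ _).trans (add_le_add h3 h2)
  set w : X → ℝ := fun x => Real.exp (tiltExp a (pathCoef v₀ v₁ u) (pathWeight β₀ β₁ u) g x)
    with hw
  have hi : ∀ {f : X → ℝ} {M : ℝ}, Measurable f → (∀ᵐ x ∂ν, |f x| ≤ M) →
      Integrable (fun x => f x * w x) ν := fun hf hM =>
    integrable_tilt hD.toTiltData (hD.coef_bound hu)
      (measurable_pathWeight hD.meas₀ hD.meas₁ u) (hD.weight_bound' hu) hf hM g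
  have i0 := hi (f := fun _ => (1:ℝ)) measurable_const (M := 1) (by simp)
  have ia := fun k => hi (hD.meas k) (hak k)
  have iβ := hi (f := fun x => β₁ x - β₀ x) (hD.meas₁.sub hD.meas₀) hβ
  have e0 : pathInt ν a v₀ v₁ β₀ β₁ (fun _ => 1) u g = ∫ x, 1 * w x ∂ν := rfl
  have ea : ∀ k, pathInt ν a v₀ v₁ β₀ β₁ (a k) u g = ∫ x, a k x * w x ∂ν := fun k => rfl
  have eβ : pathInt ν a v₀ v₁ β₀ β₁ (fun x => β₁ x - β₀ x) u g =
    ∫ x, (β₁ x - β₀ x) * w x ∂ν := rfl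
  simp_rw [e0, ea, eβ]
  set Z := ∫ x, 1 * w x ∂ν with hZ
  set J : ι → ℝ := fun k => ∫ x, a k x * w x ∂ν with hJ
  -- The bound for two replicas is integrated first in `y`, then in `x`.
  have step1 : ∀ᵐ x ∂ν, (p - 1) / 2 * ∑ k, (v₁ k - v₀ k) * (a k x * J k) +
      (β₁ x - β₀ x) * Z ≤ D * Z := by
    filter_upwards [h] with x hx
    have hint : ∀ k ∈ Finset.univ, Integrable
        (fun y => (v₁ k - v₀ k) * (a k x * (a k y * w y))) ν := fun k _ =>
      ((ia k).const_mul _).const_mul _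
    have e : (p - 1) / 2 * ∑ k, (v₁ k - v₀ k) * (a k x * J k) + (β₁ x - β₀ x) * Z =
        ∫ y, ((p - 1) / 2 * ∑ k, (v₁ k - v₀ k) * (a k x * (a k y * w y)) +
          (β₁ x - β₀ x) * (1 * w y)) ∂ν := by
      rw [integral_add ((integrable_finsetSum _ hint).const_mul _) (i0.const_mul _),
        integral_const_mul, integral_const_mul, integral_finsetSum _ hint]
      congr 2
      exact Finset.sum_congr rfl fun k _ => by rw [integral_const_mul, integral_const_mul]
    rw [e, hZ, ← integral_const_mul]
    refine integral_mono_ae (((integrable_finsetSum _ hint).const_mul _).add (i0.const_mul _))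
      (i0.const_mul _) ?_
    filter_upwards [hx] with y hy
    have hwy : 0 < w y := Real.exp_pos _
    calc (p - 1) / 2 * ∑ k, (v₁ k - v₀ k) * (a k x * (a k y * w y)) + (β₁ x - β₀ x) * (1 * w y)
        = ((p - 1) / 2 * ∑ k, (v₁ k - v₀ k) * (a k x * a k y) + (β₁ x - β₀ x)) * w y := by
          have : ∑ k, (v₁ k - v₀ k) * (a k x * (a k y * w y)) =
              (∑ k, (v₁ k - v₀ k) * (a k x * a k y)) * w y := by
            rw [Finset.sum_mul]
            exact Finset.sum_congr rfl fun k _ => by ring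
          rw [this]; ring
      _ ≤ D * w y := by gcongr
      _ = D * (1 * w y) := by ring
  have hint : ∀ k ∈ Finset.univ, Integrable
      (fun x => (v₁ k - v₀ k) * (J k * (a k x * w x))) ν := fun k _ =>
    ((ia k).const_mul _).const_mul _
  have e : (p - 1) / 2 * ∑ k, (v₁ k - v₀ k) * J k ^ 2 + Z * ∫ x, (β₁ x - β₀ x) * w x ∂ν =
      ∫ x, ((p - 1) / 2 * ∑ k, (v₁ k - v₀ k) * (J k * (a k x * w x)) +
        Z * ((β₁ x - β₀ x) * w x)) ∂ν := by
    rw [integral_add ((integrable_finsetSum _ hint).const_mul _) (iβ.const_mul _),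
      integral_const_mul, integral_const_mul, integral_finsetSum _ hint]
    congr 2
    exact Finset.sum_congr rfl fun k _ => by rw [integral_const_mul, integral_const_mul, sq]
  have e' : D * Z ^ 2 = ∫ x, D * Z * (1 * w x) ∂ν := by
    rw [integral_const_mul, ← hZ]; ring
  rw [e, e']
  refine integral_mono_ae (((integrable_finsetSum _ hint).const_mul _).add (iβ.const_mul _))
    (i0.const_mul _) ?_
  filter_upwards [step1] with x hx
  have hwx : 0 < w x := Real.exp_pos _
  calc (p - 1) / 2 * ∑ k, (v₁ k - v₀ k) * (J k * (a k x * w x)) + Z * ((β₁ x - β₀ x) * w x)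
      = ((p - 1) / 2 * ∑ k, (v₁ k - v₀ k) * (a k x * J k) + (β₁ x - β₀ x) * Z) * w x := by
        have : ∑ k, (v₁ k - v₀ k) * (J k * (a k x * w x)) =
            (∑ k, (v₁ k - v₀ k) * (a k x * J k)) * w x := by
          rw [Finset.sum_mul]
          exact Finset.sum_congr rfl fun k _ => by ring
        rw [this]; ring
    _ ≤ D * Z * w x := by gcongr
    _ = D * Z * (1 * w x) := by ring

/-- Comparison of the `p`-th moments, `0 < p ≤ 1`, of two partition functions. The factor `p - 1`
makes this Guerra's bound for `p` near `0`, and, with `p` near `1`, the opposite bound under the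
law tilted by the partition function, where the replicas include the planted configuration. -/
theorem PathData.integral_rpow_le (hD : PathData ν a v₀ v₁ β₀ β₁ A) (hν : ν ≠ 0) {p D : ℝ}
    (hp : 0 < p) (hp1 : p ≤ 1)
    (h : ∀ᵐ x ∂ν, ∀ᵐ y ∂ν,
      (p - 1) / 2 * ∑ k, (v₁ k - v₀ k) * (a k x * a k y) + (β₁ x - β₀ x) ≤ D) :
    ∫ g, tiltInt ν a (fun k => √(v₁ k)) β₁ (fun _ => 1) g ^ p ∂(gaussPi ι) ≤
      Real.exp (p * D) * ∫ g, tiltInt ν a (fun k => √(v₀ k)) β₀ (fun _ => 1) g ^ p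
        ∂(gaussPi ι) := by
  have hT := isTame_rpow hp hp1
  set φ : ℝ → ℝ := fun u => ∫ g, pathInt ν a v₀ v₁ β₀ β₁ (fun _ => 1) u g ^ p ∂(gaussPi ι) with hφ
  have hcont : ContinuousOn φ (Set.Icc 0 1) := hD.continuousOn_integral hν hT
  have e1 : φ 1 = ∫ g, tiltInt ν a (fun k => √(v₁ k)) β₁ (fun _ => 1) g ^ p ∂(gaussPi ι) := by
    have h1 : pathCoef v₀ v₁ 1 = fun k => √(v₁ k) := by ext k; simp [pathCoef]
    have h2 : pathWeight β₀ β₁ 1 = β₁ := by ext x; simp [pathWeight]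
    simp only [hφ, pathInt, h1, h2]
  have e0 : φ 0 = ∫ g, tiltInt ν a (fun k => √(v₀ k)) β₀ (fun _ => 1) g ^ p ∂(gaussPi ι) := by
    have h1 : pathCoef v₀ v₁ 0 = fun k => √(v₀ k) := by ext k; simp [pathCoef]
    have h2 : pathWeight β₀ β₁ 0 = β₀ := by ext x; simp [pathWeight]
    simp only [hφ, pathInt, h1, h2]
  rw [← e1, ← e0]
  have hanti : AntitoneOn (fun u => Real.exp (-(p * D * u)) * φ u) (Set.Icc 0 1) := by
    have hd : ∀ u ∈ Set.Ioo (0:ℝ) 1, ∃ d, HasDerivAt φ d u ∧ d ≤ p * D * φ u := by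
      intro u hu
      have hI := Set.Ioo_subset_Icc_self hu
      obtain ⟨hdint, hder⟩ := hD.hasDerivAt_integral hν hT hu
      refine ⟨_, hder, ?_⟩
      rw [hφ, ← integral_const_mul]
      obtain ⟨C, hC, hG⟩ := hD.growth_comp hν hT.nonneg hT.bound
      have hint : Integrable (fun g => pathInt ν a v₀ v₁ β₀ β₁ (fun _ => 1) u g ^ p)
          (gaussPi ι) := (hG u hI).integrable
            (hT.meas.comp (hD.measurable_pathInt measurable_const u))
      refine integral_mono hdint (hint.const_mul _) ?_
      · intro g
        dsimp only
        have hz := hD.pathInt_pos hν hI g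
        have h2 := hD.two_replica_le h hI g
        set z := pathInt ν a v₀ v₁ β₀ β₁ (fun _ => 1) u g
        have hz2 : 0 < z ^ (p - 2) := Real.rpow_pos_of_pos hz _
        have hz1 : z ^ (p - 1) = z ^ (p - 2) * z := by
          rw [← Real.rpow_add_one hz.ne']; congr 1; ring
        have hz0 : z ^ p = z ^ (p - 2) * z ^ 2 := by
          rw [← Real.rpow_natCast, ← Real.rpow_add hz]; congr 1; push_cast; ring
        rw [hz1, hz0]
        calc _ = p * z ^ (p - 2) * ((p - 1) / 2 * ∑ k, (v₁ k - v₀ k) *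
              pathInt ν a v₀ v₁ β₀ β₁ (a k) u g ^ 2 +
              z * pathInt ν a v₀ v₁ β₀ β₁ (fun x => β₁ x - β₀ x) u g) := by
              rw [mul_add, Finset.mul_sum, Finset.mul_sum]
              congr 1
              · exact Finset.sum_congr rfl fun k _ => by ring
              · ring
          _ ≤ p * z ^ (p - 2) * (D * z ^ 2) := by gcongr
          _ = _ := by ring
    choose! d hd1 hd2 using hd
    refine antitoneOn_of_hasDerivWithinAt_nonpos (convex_Icc 0 1)
      (f' := fun u => Real.exp (-(p * D * u)) * (d u - p * D * φ u)) ?_ ?_ ?_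
    · exact (by fun_prop : Continuous fun u : ℝ => Real.exp (-(p * D * u))).continuousOn.mul hcont
    · intro u hu
      rw [interior_Icc] at hu
      have h1 : HasDerivAt (fun u : ℝ => Real.exp (-(p * D * u)))
          (Real.exp (-(p * D * u)) * (-(p * D))) u := by
        have := ((hasDerivAt_id' u).const_mul (p * D)).fun_neg.exp
        simpa using this
      exact ((h1.mul (hd1 u hu)).congr_deriv (by ring)).hasDerivWithinAt
    · intro u hu
      rw [interior_Icc] at hu
      exact mul_nonpos_of_nonneg_of_nonpos (Real.exp_pos _).le (by linarith [hd2 u hu])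
  have := hanti (Set.left_mem_Icc.2 zero_le_one) (Set.right_mem_Icc.2 zero_le_one) zero_le_one
  simp only [mul_one, mul_zero, neg_zero, Real.exp_zero, one_mul] at this
  rw [Real.exp_neg] at this
  rwa [← div_le_iff₀' (Real.exp_pos _), div_eq_inv_mul]

end SpikedWigner

namespace SpikedWigner

/-! ### The scalar channel -/

/-- The exponent in `psiBar`, at `w = (x*, z)`. -/
noncomputable def chanExp (r s : ℝ) (w : ℝ × ℝ) (x : ℝ) : ℝ :=
  √r * w.2 * x + s * x * w.1 - r / 2 * x ^ 2

/-- The partition function of the scalar channel. -/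
noncomputable def chanZ (P : Measure ℝ) (r s : ℝ) (w : ℝ × ℝ) : ℝ :=
  ∫ x, Real.exp (chanExp r s w x) ∂P

/-- The Gibbs mean of the scalar channel. -/
noncomputable def chanMean (P : Measure ℝ) (r s : ℝ) (w : ℝ × ℝ) : ℝ :=
  (∫ x, x * Real.exp (chanExp r s w x) ∂P) / chanZ P r s w

/-- The mean overlap `E x* ⟨x⟩` of the scalar channel, which is `∂_s psiBar`. -/
noncomputable def chanOverlap (P : Measure ℝ) (r s : ℝ) : ℝ :=
  ∫ w : ℝ × ℝ, w.1 * chanMean P r s w ∂(P.prod (gaussianReal 0 1))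

lemma psiBar_eq_integral_log_chanZ (P : Measure ℝ) (r s : ℝ) :
    psiBar P r s = ∫ w : ℝ × ℝ, Real.log (chanZ P r s w) ∂(P.prod (gaussianReal 0 1)) := rfl

/-- A bound for the exponent when `|x| ≤ B`. -/
noncomputable def chanBound (B r s : ℝ) (w : ℝ × ℝ) : ℝ :=
  √r * |w.2| * B + |s| * |w.1| * B + |r| / 2 * B ^ 2

lemma abs_chanExp_le {B x : ℝ} (hx : |x| ≤ B) (r s : ℝ) (w : ℝ × ℝ) :
    |chanExp r s w x| ≤ chanBound B r s w := by
  unfold chanExp chanBound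
  have hB : 0 ≤ B := (abs_nonneg _).trans hx
  have h1 : |√r * w.2 * x| ≤ √r * |w.2| * B := by
    rw [abs_mul, abs_mul, abs_of_nonneg (Real.sqrt_nonneg r)]; gcongr
  have h2 : |s * x * w.1| ≤ |s| * |w.1| * B := by
    rw [abs_mul, abs_mul, mul_right_comm]; gcongr
  have h3 : |r / 2 * x ^ 2| ≤ |r| / 2 * B ^ 2 := by
    rw [abs_mul, abs_div, abs_two, abs_pow]; gcongr
  calc _ ≤ |√r * w.2 * x + s * x * w.1| + |r / 2 * x ^ 2| := abs_sub _ _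
    _ ≤ _ := by linarith [abs_add_le (√r * w.2 * x) (s * x * w.1)]

lemma measurable_chanExp (r s : ℝ) : Measurable fun p : (ℝ × ℝ) × ℝ => chanExp r s p.1 p.2 := by
  unfold chanExp; fun_prop

lemma measurable_chanExp_right (r s : ℝ) (w : ℝ × ℝ) : Measurable (chanExp r s w) := by
  unfold chanExp; fun_prop

section

variable {P : Measure ℝ} {B : ℝ}

lemma ae_prod_fst (hP : ∀ᵐ x ∂P, |x| ≤ B) :
    ∀ᵐ w : ℝ × ℝ ∂(P.prod (gaussianReal 0 1)), |w.1| ≤ B :=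
  Measure.quasiMeasurePreserving_fst.ae hP

variable [IsProbabilityMeasure P]

lemma measurable_chanInt {f : ℝ → ℝ} (hf : Measurable f) (r s : ℝ) :
    Measurable fun w => ∫ x, f x * Real.exp (chanExp r s w x) ∂P := by
  have : StronglyMeasurable fun p : (ℝ × ℝ) × ℝ => f p.2 * Real.exp (chanExp r s p.1 p.2) :=
    ((hf.comp measurable_snd).mul
      (Real.measurable_exp.comp (measurable_chanExp r s))).stronglyMeasurable
  exact this.integral_prod_right.measurable

lemma measurable_chanZ (r s : ℝ) : Measurable (chanZ P r s) := by
  have := measurable_chanInt (P := P) (f := fun _ => 1) measurable_const r s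
  simp only [one_mul] at this
  exact this

lemma measurable_chanMean (r s : ℝ) : Measurable (chanMean P r s) :=
  (measurable_chanInt measurable_id r s).div (measurable_chanZ r s)

lemma integrable_chanInt (hP : ∀ᵐ x ∂P, |x| ≤ B) {f : ℝ → ℝ} (hf : Measurable f) {M : ℝ}
    (hfM : ∀ᵐ x ∂P, |f x| ≤ M) (r s : ℝ) (w : ℝ × ℝ) :
    Integrable (fun x => f x * Real.exp (chanExp r s w x)) P := by
  refine Integrable.of_bound (C := M * Real.exp (chanBound B r s w))
    (hf.mul (Real.measurable_exp.comp (measurable_chanExp_right r s w))).aestronglyMeasurable ?_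
  filter_upwards [hP, hfM] with x hx hx'
  have : 0 ≤ M := (abs_nonneg _).trans hx'
  rw [Real.norm_eq_abs, abs_mul, abs_of_pos (Real.exp_pos _)]
  gcongr
  exact (le_abs_self _).trans (abs_chanExp_le hx r s w)

lemma integrable_exp_chanExp (hP : ∀ᵐ x ∂P, |x| ≤ B) (r s : ℝ) (w : ℝ × ℝ) :
    Integrable (fun x => Real.exp (chanExp r s w x)) P := by
  simpa using integrable_chanInt hP (f := fun _ => 1) measurable_const (M := 1) (by simp) r s w

lemma chanZ_le (hP : ∀ᵐ x ∂P, |x| ≤ B) (r s : ℝ) (w : ℝ × ℝ) :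
    chanZ P r s w ≤ Real.exp (chanBound B r s w) := by
  have : chanZ P r s w ≤ ∫ _, Real.exp (chanBound B r s w) ∂P := by
    refine integral_mono_ae (integrable_exp_chanExp hP r s w) (integrable_const _) ?_
    filter_upwards [hP] with x hx
    exact Real.exp_le_exp.2 ((le_abs_self _).trans (abs_chanExp_le hx r s w))
  simpa using this

lemma le_chanZ (hP : ∀ᵐ x ∂P, |x| ≤ B) (r s : ℝ) (w : ℝ × ℝ) :
    Real.exp (-chanBound B r s w) ≤ chanZ P r s w := by
  have : ∫ _, Real.exp (-chanBound B r s w) ∂P ≤ chanZ P r s w := by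
    refine integral_mono_ae (integrable_const _) (integrable_exp_chanExp hP r s w) ?_
    filter_upwards [hP] with x hx
    exact Real.exp_le_exp.2 (neg_le_of_abs_le (abs_chanExp_le hx r s w))
  simpa using this

lemma chanZ_pos (hP : ∀ᵐ x ∂P, |x| ≤ B) (r s : ℝ) (w : ℝ × ℝ) : 0 < chanZ P r s w :=
  (Real.exp_pos _).trans_le (le_chanZ hP r s w)

lemma abs_log_chanZ_le (hP : ∀ᵐ x ∂P, |x| ≤ B) (r s : ℝ) (w : ℝ × ℝ) :
    |Real.log (chanZ P r s w)| ≤ chanBound B r s w := by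
  have h := chanZ_pos hP r s w
  rw [abs_le]
  exact ⟨(Real.le_log_iff_exp_le h).2 (le_chanZ hP r s w),
    (Real.log_le_iff_le_exp h).2 (chanZ_le hP r s w)⟩

lemma abs_chanMean_le (hP : ∀ᵐ x ∂P, |x| ≤ B) (r s : ℝ) (w : ℝ × ℝ) :
    |chanMean P r s w| ≤ B := by
  have h := chanZ_pos hP r s w
  unfold chanMean
  rw [abs_div, abs_of_pos h, div_le_iff₀ h]
  calc |∫ x, x * Real.exp (chanExp r s w x) ∂P| ≤ ∫ x, B * Real.exp (chanExp r s w x) ∂P := by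
        refine norm_integral_le_of_norm_le (f := fun x => x * Real.exp (chanExp r s w x))
          ((integrable_exp_chanExp hP r s w).const_mul B) ?_
        filter_upwards [hP] with x hx
        rw [Real.norm_eq_abs, abs_mul, abs_of_pos (Real.exp_pos _)]
        gcongr
    _ = _ := integral_const_mul _ _

lemma integrable_abs_gaussianReal : Integrable (fun z : ℝ => |z|) (gaussianReal 0 1) := by
  refine (integrable_exp_mul_abs_gaussianReal 1).mono' (by fun_prop) (ae_of_all _ fun z => ?_)
  rw [Real.norm_eq_abs, abs_abs, one_mul]
  linarith [Real.add_one_le_exp |z|]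

lemma integrable_affine_abs_snd (a b : ℝ) :
    Integrable (fun w : ℝ × ℝ => a * |w.2| + b) (P.prod (gaussianReal 0 1)) :=
  ((integrable_abs_gaussianReal.comp_snd P).const_mul a).add (integrable_const b)

lemma chanBound_le_of_le {r s R : ℝ} {w : ℝ × ℝ} (hr : |r| ≤ R) (hs : |s| ≤ R)
    (hw : |w.1| ≤ B) : chanBound B r s w ≤ √R * B * |w.2| + (R * B * B + R / 2 * B ^ 2) := by
  unfold chanBound
  have hB : 0 ≤ B := (abs_nonneg _).trans hw
  have h1 : √r ≤ √R := Real.sqrt_le_sqrt ((le_abs_self r).trans hr)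
  have hR : 0 ≤ R := (abs_nonneg _).trans hr
  have e1 : √r * |w.2| * B ≤ √R * |w.2| * B := by gcongr
  have e2 : |s| * |w.1| * B ≤ R * B * B := by gcongr
  have e3 : |r| / 2 * B ^ 2 ≤ R / 2 * B ^ 2 := by gcongr
  linarith

lemma integrable_log_chanZ (hP : ∀ᵐ x ∂P, |x| ≤ B) (r s : ℝ) :
    Integrable (fun w => Real.log (chanZ P r s w)) (P.prod (gaussianReal 0 1)) := by
  refine (integrable_affine_abs_snd (√(|r| + |s|) * B) ((|r| + |s|) * B * B +
    (|r| + |s|) / 2 * B ^ 2)).mono' (measurable_chanZ r s).log.aestronglyMeasurable ?_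
  filter_upwards [ae_prod_fst hP] with w hw
  refine (abs_log_chanZ_le hP r s w).trans (chanBound_le_of_le ?_ ?_ hw)
  · linarith [abs_nonneg s]
  · linarith [abs_nonneg r]

lemma integrable_mul_chanMean (hP : ∀ᵐ x ∂P, |x| ≤ B) (r s : ℝ) :
    Integrable (fun w : ℝ × ℝ => w.1 * chanMean P r s w) (P.prod (gaussianReal 0 1)) := by
  refine Integrable.of_bound (C := B * B)
    (measurable_fst.mul (measurable_chanMean r s)).aestronglyMeasurable ?_
  filter_upwards [ae_prod_fst hP] with w hw
  have hB : 0 ≤ B := (abs_nonneg _).trans hw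
  rw [Real.norm_eq_abs, abs_mul]
  exact mul_le_mul hw (abs_chanMean_le hP r s w) (abs_nonneg _) hB

lemma abs_chanOverlap_le (hP : ∀ᵐ x ∂P, |x| ≤ B) (r s : ℝ) : |chanOverlap P r s| ≤ B ^ 2 := by
  have : ‖∫ w : ℝ × ℝ, w.1 * chanMean P r s w ∂(P.prod (gaussianReal 0 1))‖ ≤
      B ^ 2 * (P.prod (gaussianReal 0 1)).real Set.univ := by
    refine norm_integral_le_of_norm_le_const ?_
    filter_upwards [ae_prod_fst hP] with w hw
    have hB : 0 ≤ B := (abs_nonneg _).trans hw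
    rw [Real.norm_eq_abs, abs_mul, sq]
    exact mul_le_mul hw (abs_chanMean_le hP r s w) (abs_nonneg _) hB
  rw [probReal_univ, mul_one] at this
  exact this

/-! ### Continuity of the scalar functions -/

lemma eventually_abs_le (q : ℝ × ℝ) :
    ∀ᶠ p : ℝ × ℝ in 𝓝 q, |p.1| ≤ |q.1| + |q.2| + 1 ∧ |p.2| ≤ |q.1| + |q.2| + 1 := by
  have h1 : ∀ᶠ p : ℝ × ℝ in 𝓝 q, |p.1| < |q.1| + |q.2| + 1 :=
    (continuous_fst.abs.tendsto q).eventually_lt_const (by linarith [abs_nonneg q.2])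
  have h2 : ∀ᶠ p : ℝ × ℝ in 𝓝 q, |p.2| < |q.1| + |q.2| + 1 :=
    (continuous_snd.abs.tendsto q).eventually_lt_const (by linarith [abs_nonneg q.1])
  filter_upwards [h1, h2] with p hp1 hp2 using ⟨hp1.le, hp2.le⟩

lemma continuous_chanInt (hP : ∀ᵐ x ∂P, |x| ≤ B) {f : ℝ → ℝ} (hf : Measurable f) {M : ℝ}
    (hfM : ∀ᵐ x ∂P, |f x| ≤ M) (w : ℝ × ℝ) :
    Continuous fun q : ℝ × ℝ => ∫ x, f x * Real.exp (chanExp q.1 q.2 w x) ∂P := by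
  refine continuous_iff_continuousAt.2 fun q => ?_
  set R := |q.1| + |q.2| + 1
  refine continuousAt_of_dominated (bound := fun _ =>
    M * Real.exp (√R * |w.2| * B + R * |w.1| * B + R / 2 * B ^ 2)) ?_ ?_ (integrable_const _) ?_
  · exact Eventually.of_forall fun p => (hf.mul (Real.measurable_exp.comp
      (measurable_chanExp_right _ _ w))).aestronglyMeasurable
  · filter_upwards [eventually_abs_le q] with p hp
    filter_upwards [hP, hfM] with x hx hx'
    have : 0 ≤ M := (abs_nonneg _).trans hx'
    have hB : 0 ≤ B := (abs_nonneg _).trans hx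
    rw [Real.norm_eq_abs, abs_mul, abs_of_pos (Real.exp_pos _)]
    gcongr
    refine (le_abs_self _).trans ((abs_chanExp_le hx _ _ w).trans ?_)
    unfold chanBound
    have := Real.sqrt_le_sqrt ((le_abs_self p.1).trans hp.1)
    gcongr
    exacts [hp.2, hp.1]
  · refine ae_of_all _ fun x => ?_
    unfold chanExp
    fun_prop

lemma continuous_chanZ (hP : ∀ᵐ x ∂P, |x| ≤ B) (w : ℝ × ℝ) :
    Continuous fun q : ℝ × ℝ => chanZ P q.1 q.2 w := by
  simpa [chanZ] using continuous_chanInt hP (f := fun _ => 1) measurable_const (M := 1) (by simp) w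

lemma continuous_chanMean (hP : ∀ᵐ x ∂P, |x| ≤ B) (w : ℝ × ℝ) :
    Continuous fun q : ℝ × ℝ => chanMean P q.1 q.2 w :=
  (continuous_chanInt hP measurable_id hP w).div (continuous_chanZ hP w)
    fun q => (chanZ_pos hP q.1 q.2 w).ne'

lemma continuous_psiBar (hP : ∀ᵐ x ∂P, |x| ≤ B) :
    Continuous fun q : ℝ × ℝ => psiBar P q.1 q.2 := by
  simp_rw [psiBar_eq_integral_log_chanZ]
  refine continuous_iff_continuousAt.2 fun q => ?_
  set R := |q.1| + |q.2| + 1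
  refine continuousAt_of_dominated (bound := fun w =>
    √R * B * |w.2| + (R * B * B + R / 2 * B ^ 2)) ?_ ?_ (integrable_affine_abs_snd _ _) ?_
  · exact Eventually.of_forall fun p => (measurable_chanZ _ _).log.aestronglyMeasurable
  · filter_upwards [eventually_abs_le q] with p hp
    filter_upwards [ae_prod_fst hP] with w hw
    exact (abs_log_chanZ_le hP _ _ w).trans (chanBound_le_of_le hp.1 hp.2 hw)
  · exact ae_of_all _ fun w =>
      ((continuous_chanZ hP w).log fun q => (chanZ_pos hP q.1 q.2 w).ne').continuousAt

lemma continuous_psi (hP : ∀ᵐ x ∂P, |x| ≤ B) : Continuous (psi P) :=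
  (continuous_psiBar hP).comp (f := fun r : ℝ => (r, r)) (by fun_prop)

lemma continuous_chanOverlap (hP : ∀ᵐ x ∂P, |x| ≤ B) :
    Continuous fun q : ℝ × ℝ => chanOverlap P q.1 q.2 := by
  unfold chanOverlap
  refine continuous_of_dominated (bound := fun _ => B * B) ?_ ?_ (integrable_const _) ?_
  · exact fun p => (measurable_fst.mul (measurable_chanMean _ _)).aestronglyMeasurable
  · intro p
    filter_upwards [ae_prod_fst hP] with w hw
    have hB : 0 ≤ B := (abs_nonneg _).trans hw
    rw [Real.norm_eq_abs, abs_mul]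
    exact mul_le_mul hw (abs_chanMean_le hP _ _ w) (abs_nonneg _) hB
  · exact ae_of_all _ fun w => continuous_const.mul (continuous_chanMean hP w)

/-! ### Dependence of `psiBar` on its second argument -/

/-- Jensen's inequality and Hoeffding's lemma for the Gibbs measure of the scalar channel. -/
lemma log_chanZ_add_bounds (hP : ∀ᵐ x ∂P, |x| ≤ B) (r s σ : ℝ) {w : ℝ × ℝ} (hw : |w.1| ≤ B) :
    σ * (w.1 * chanMean P r s w) ≤ Real.log (chanZ P r (s + σ) w) - Real.log (chanZ P r s w) ∧
    Real.log (chanZ P r (s + σ) w) - Real.log (chanZ P r s w) ≤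
      σ * (w.1 * chanMean P r s w) + σ ^ 2 * B ^ 4 / 2 := by
  have hB : 0 ≤ B := (abs_nonneg _).trans hw
  have hi := integrable_exp_chanExp hP r s w
  have hZ := chanZ_pos hP r s w
  have hZ' := chanZ_pos hP r (s + σ) w
  -- The increment is a cumulant generating function of `x * w.1` under the tilted measure `μ`:
  -- Jensen's inequality bounds it below, Hoeffding's lemma above.
  set μ := P.tilted (chanExp r s w) with hμ
  have : IsProbabilityMeasure μ := isProbabilityMeasure_tilted hi
  have hac : μ ≪ P := tilted_absolutelyContinuous _ _
  have hbd : ∀ᵐ x ∂μ, x * w.1 ∈ Set.Icc (-B ^ 2) (B ^ 2) := by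
    filter_upwards [hac.ae_le hP] with x hx
    rw [Set.mem_Icc, ← abs_le, abs_mul, sq]
    exact mul_le_mul hx hw (abs_nonneg _) hB
  have hsub := hasSubgaussianMGF_of_mem_Icc (μ := μ) (X := fun x => x * w.1)
    (by fun_prop) hbd
  have hmean : ∫ x, x * w.1 ∂μ = w.1 * chanMean P r s w := by
    rw [hμ, integral_tilted, chanMean, chanZ, mul_div_assoc', mul_comm w.1, ← integral_mul_const,
      ← integral_div]
    congr 1; ext x; simp only [smul_eq_mul]; ring
  have hratio : ∫ x, Real.exp (σ * (x * w.1)) ∂μ = chanZ P r (s + σ) w / chanZ P r s w := by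
    rw [hμ, integral_exp_tilted]
    unfold chanZ
    congr 2; ext x; congr 1
    simp only [Pi.add_apply, chanExp]; ring
  set m := w.1 * chanMean P r s w
  have hX : mgf (fun x => x * w.1 - ∫ x, x * w.1 ∂μ) μ σ =
      Real.exp (-(σ * m)) * (chanZ P r (s + σ) w / chanZ P r s w) := by
    rw [← hratio, mgf, hmean, ← integral_const_mul]
    congr 1; ext x
    rw [← Real.exp_add]; ring_nf
  rw [← Real.log_div hZ'.ne' hZ.ne']
  constructor
  · rw [Real.le_log_iff_exp_le (by positivity)]
    have h1 : (1:ℝ) ≤ mgf (fun x => x * w.1 - ∫ x, x * w.1 ∂μ) μ σ := by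
      have hint : Integrable (fun x => x * w.1) μ := by
        refine Integrable.of_bound (C := B ^ 2) (by fun_prop) ?_
        filter_upwards [hbd] with x hx
        rw [Real.norm_eq_abs, abs_le]; exact hx
      have : ∫ x, (σ * (x * w.1 - ∫ x, x * w.1 ∂μ) + 1) ∂μ ≤
          mgf (fun x => x * w.1 - ∫ x, x * w.1 ∂μ) μ σ :=
        integral_mono (((hint.sub (integrable_const _)).const_mul σ).add (integrable_const _))
          (hsub.integrable_exp_mul σ) fun x => Real.add_one_le_exp _
      have hi1 : Integrable (fun x => σ * (x * w.1 - ∫ x, x * w.1 ∂μ)) μ :=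
        (hint.sub (integrable_const _)).const_mul σ
      rw [integral_add hi1 (integrable_const _),
        integral_const_mul, integral_sub hint (integrable_const _)] at this
      simpa using this
    rw [hX, Real.exp_neg, ← div_eq_inv_mul, le_div_iff₀ (Real.exp_pos _), one_mul] at h1
    exact h1
  · rw [Real.log_le_iff_le_exp (by positivity), Real.exp_add]
    have h1 := hsub.mgf_le σ
    rw [hX, Real.exp_neg, ← div_eq_inv_mul, div_le_iff₀ (Real.exp_pos _)] at h1
    rw [mul_comm]
    refine h1.trans_eq ?_
    congr 2
    have : ‖B ^ 2 - -B ^ 2‖ = 2 * B ^ 2 := by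
      rw [Real.norm_eq_abs, abs_of_nonneg (by nlinarith [sq_nonneg B])]; ring
    push_cast
    rw [this]; ring

lemma psiBar_add_bounds (hP : ∀ᵐ x ∂P, |x| ≤ B) (r s σ : ℝ) :
    σ * chanOverlap P r s ≤ psiBar P r (s + σ) - psiBar P r s ∧
    psiBar P r (s + σ) - psiBar P r s ≤ σ * chanOverlap P r s + σ ^ 2 * B ^ 4 / 2 := by
  have hi := integrable_log_chanZ hP r s
  have hi' := integrable_log_chanZ hP r (s + σ)
  have hm := (integrable_mul_chanMean hP r s).const_mul σ
  rw [psiBar_eq_integral_log_chanZ, psiBar_eq_integral_log_chanZ, chanOverlap,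
    ← integral_sub hi' hi, ← integral_const_mul]
  constructor
  · refine integral_mono_ae hm (hi'.sub hi) ?_
    filter_upwards [ae_prod_fst hP] with w hw
    exact (log_chanZ_add_bounds hP r s σ hw).1
  · have : σ ^ 2 * B ^ 4 / 2 = ∫ _, σ ^ 2 * B ^ 4 / 2 ∂(P.prod (gaussianReal 0 1)) := by simp
    rw [this, ← integral_add hm (integrable_const _)]
    refine integral_mono_ae (hi'.sub hi) (hm.add (integrable_const _)) ?_
    filter_upwards [ae_prod_fst hP] with w hw
    exact (log_chanZ_add_bounds hP r s σ hw).2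

lemma hasDerivAt_psiBar (hP : ∀ᵐ x ∂P, |x| ≤ B) (r s : ℝ) :
    HasDerivAt (fun s => psiBar P r s) (chanOverlap P r s) s := by
  rw [hasDerivAt_iff_isLittleO_nhds_zero]
  have h1 : (fun σ : ℝ => psiBar P r (s + σ) - psiBar P r s - σ • chanOverlap P r s) =O[𝓝 0]
      fun σ : ℝ => σ ^ 2 := by
    refine IsBigO.of_bound (B ^ 4 / 2) (Eventually.of_forall fun σ => ?_)
    have h := psiBar_add_bounds hP r s σ
    rw [Real.norm_eq_abs, Real.norm_eq_abs, smul_eq_mul, abs_of_nonneg (by linarith),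
      abs_of_nonneg (sq_nonneg σ)]
    linarith
  exact h1.trans_isLittleO (isLittleO_pow_id one_lt_two)

lemma deriv_psiBar (hP : ∀ᵐ x ∂P, |x| ≤ B) (r s : ℝ) :
    deriv (fun s => psiBar P r s) s = chanOverlap P r s := (hasDerivAt_psiBar hP r s).deriv

lemma psiBar_tangent_le (hP : ∀ᵐ x ∂P, |x| ≤ B) (r s s' : ℝ) :
    psiBar P r s + (s' - s) * chanOverlap P r s ≤ psiBar P r s' := by
  have := (psiBar_add_bounds hP r s (s' - s)).1
  rw [add_sub_cancel] at this
  linarith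

lemma psiBar_convex (hP : ∀ᵐ x ∂P, |x| ≤ B) (r s s' : ℝ) {α : ℝ} (h₀ : 0 ≤ α) (h₁ : α ≤ 1) :
    psiBar P r ((1 - α) * s + α * s') ≤ (1 - α) * psiBar P r s + α * psiBar P r s' := by
  have h1 := psiBar_tangent_le hP r ((1 - α) * s + α * s') s
  have h2 := psiBar_tangent_le hP r ((1 - α) * s + α * s') s'
  have e1 := mul_le_mul_of_nonneg_left h1 (by linarith : 0 ≤ 1 - α)
  have e2 := mul_le_mul_of_nonneg_left h2 h₀
  nlinarith

end

end SpikedWigner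

namespace SpikedWigner

/-! ### Bayes' rule for the scalar channel -/

/-- The density, with respect to the standard Gaussian law, of the observation `z + √r x*`. -/
noncomputable def obsDensity (P : Measure ℝ) (r z : ℝ) : ℝ := chanZ P r 0 (0, z)

lemma chanExp_diag {r : ℝ} (hr : 0 ≤ r) (w : ℝ × ℝ) (x : ℝ) :
    chanExp r r w x = chanExp r 0 (0, w.2 + √r * w.1) x := by
  unfold chanExp
  have := Real.mul_self_sqrt hr
  linear_combination (-(x * w.1)) * this

lemma chanExp_antidiag {r : ℝ} (hr : 0 ≤ r) (w : ℝ × ℝ) (x : ℝ) :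
    chanExp r (-r) w x = chanExp r 0 (0, w.2 - √r * w.1) x := by
  unfold chanExp
  have := Real.mul_self_sqrt hr
  linear_combination (x * w.1) * this

lemma chanZ_diag (P : Measure ℝ) {r : ℝ} (hr : 0 ≤ r) (w : ℝ × ℝ) :
    chanZ P r r w = obsDensity P r (w.2 + √r * w.1) := by
  simp only [chanZ, obsDensity, chanExp_diag hr]

lemma chanZ_antidiag (P : Measure ℝ) {r : ℝ} (hr : 0 ≤ r) (w : ℝ × ℝ) :
    chanZ P r (-r) w = obsDensity P r (w.2 - √r * w.1) := by
  simp only [chanZ, obsDensity, chanExp_antidiag hr]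

lemma chanMean_diag (P : Measure ℝ) {r : ℝ} (hr : 0 ≤ r) (w : ℝ × ℝ) :
    chanMean P r r w = chanMean P r 0 (0, w.2 + √r * w.1) := by
  simp only [chanMean, chanZ, chanExp_diag hr]

lemma chanExp_zero_eq {r : ℝ} (hr : 0 ≤ r) (x z : ℝ) :
    chanExp r 0 (0, z) x = √r * x * z - (√r * x) ^ 2 / 2 := by
  unfold chanExp
  rw [mul_pow, Real.sq_sqrt hr]
  ring

section

variable {P : Measure ℝ} [IsProbabilityMeasure P] {B : ℝ}

lemma measurable_obsDensity (r : ℝ) : Measurable (obsDensity P r) :=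
  (measurable_chanZ r 0).comp (by fun_prop : Measurable fun z : ℝ => ((0:ℝ), z))

lemma obsDensity_pos (hP : ∀ᵐ x ∂P, |x| ≤ B) (r z : ℝ) : 0 < obsDensity P r z :=
  chanZ_pos hP r 0 _

lemma map_observation (hP : ∀ᵐ x ∂P, |x| ≤ B) {r : ℝ} (hr : 0 ≤ r) :
    (P.prod (gaussianReal 0 1)).map (fun w : ℝ × ℝ => w.2 + √r * w.1) =
      (gaussianReal 0 1).withDensity fun z => ENNReal.ofReal (obsDensity P r z) := by
  refine Measure.ext_of_lintegral _ fun f hf => ?_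
  have hm : Measurable fun p : ℝ × ℝ => ENNReal.ofReal (Real.exp (√r * p.1 * p.2 -
      (√r * p.1) ^ 2 / 2)) * f p.2 := by fun_prop
  rw [lintegral_map hf (by fun_prop), lintegral_prod _ (by fun_prop),
    lintegral_withDensity_eq_lintegral_mul _ (measurable_obsDensity r).ennreal_ofReal hf]
  have h1 : ∀ x : ℝ, ∫⁻ z, f (z + √r * x) ∂(gaussianReal 0 1) =
      ∫⁻ z, ENNReal.ofReal (Real.exp (√r * x * z - (√r * x) ^ 2 / 2)) * f z
        ∂(gaussianReal 0 1) := by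
    intro x
    rw [← lintegral_map (g := (· + √r * x)) hf (by fun_prop),
      gaussianReal_map_add_const_eq_withDensity,
      lintegral_withDensity_eq_lintegral_mul _ (by fun_prop) hf]
    rfl
  simp_rw [h1]
  rw [lintegral_lintegral_swap hm.aemeasurable]
  refine lintegral_congr fun z => ?_
  rw [lintegral_mul_const _ (by fun_prop), Pi.mul_apply, obsDensity, chanZ,
    ofReal_integral_eq_lintegral_ofReal (integrable_exp_chanExp hP r 0 _)
      (ae_of_all _ fun _ => (Real.exp_pos _).le)]
  simp_rw [chanExp_zero_eq hr]

lemma integral_observation (hP : ∀ᵐ x ∂P, |x| ≤ B) {r : ℝ} (hr : 0 ≤ r) {f : ℝ → ℝ}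
    (hf : Measurable f) :
    ∫ w : ℝ × ℝ, f (w.2 + √r * w.1) ∂(P.prod (gaussianReal 0 1)) =
      ∫ z, obsDensity P r z * f z ∂(gaussianReal 0 1) := by
  rw [← integral_map (φ := fun w : ℝ × ℝ => w.2 + √r * w.1) (by fun_prop)
    hf.aestronglyMeasurable, map_observation hP hr,
    integral_withDensity_eq_integral_toReal_smul (measurable_obsDensity r).ennreal_ofReal
      (ae_of_all _ fun _ => ENNReal.ofReal_lt_top)]
  simp [ENNReal.toReal_ofReal (obsDensity_pos hP r _).le]

lemma psi_eq_integral (hP : ∀ᵐ x ∂P, |x| ≤ B) {r : ℝ} (hr : 0 ≤ r) :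
    psi P r = ∫ z, obsDensity P r z * Real.log (obsDensity P r z) ∂(gaussianReal 0 1) := by
  rw [psi, psiBar_eq_integral_log_chanZ,
    ← integral_observation hP hr (f := fun z => Real.log (obsDensity P r z))
    (measurable_obsDensity r).log]
  simp_rw [chanZ_diag P hr]

lemma psiBar_antidiag_eq_integral (hP : ∀ᵐ x ∂P, |x| ≤ B) {r : ℝ} (hr : 0 ≤ r) :
    psiBar P r (-r) =
      ∫ z, obsDensity P r z * Real.log (obsDensity P r (-z)) ∂(gaussianReal 0 1) := by
  have hneg : MeasurePreserving (fun z : ℝ => -z) (gaussianReal 0 1) (gaussianReal 0 1) :=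
    ⟨measurable_neg, by rw [gaussianReal_map_neg, neg_zero]⟩
  have hprod := (MeasurePreserving.id P).prod hneg
  rw [← integral_observation hP hr (f := fun z => Real.log (obsDensity P r (-z)))
    ((measurable_obsDensity r).comp measurable_neg).log, psiBar_eq_integral_log_chanZ,
    ← hprod.map_eq, integral_map hprod.measurable.aemeasurable, hprod.map_eq]
  · refine integral_congr_ae (ae_of_all _ fun w => ?_)
    simp only [chanZ_antidiag P hr, Prod.map, id]
    congr 2; ring
  · exact (measurable_chanZ r (-r)).log.aestronglyMeasurable

/-- On the diagonal `s = r`, where the channel is Bayes optimal, the planted configuration is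
distributed as a replica (the Nishimori identity). -/
lemma chanOverlap_diag (hP : ∀ᵐ x ∂P, |x| ≤ B) {r : ℝ} (hr : 0 ≤ r) :
    chanOverlap P r r = ∫ z, (∫ x, x * Real.exp (chanExp r 0 (0, z) x) ∂P) ^ 2 /
      obsDensity P r z ∂(gaussianReal 0 1) := by
  have hmm : Measurable fun z : ℝ => chanMean P r 0 (0, z) :=
    (measurable_chanMean r 0).comp (by fun_prop : Measurable fun z : ℝ => ((0:ℝ), z))
  have hm : Measurable fun p : ℝ × ℝ => p.1 * (Real.exp (chanExp r 0 (0, p.2) p.1) *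
      chanMean P r 0 (0, p.2)) := by
    have : Measurable fun p : ℝ × ℝ => chanExp r 0 (0, p.2) p.1 := by unfold chanExp; fun_prop
    exact measurable_fst.mul ((Real.measurable_exp.comp this).mul (hmm.comp measurable_snd))
  have hi : Integrable (fun p : ℝ × ℝ => p.1 * (Real.exp (chanExp r 0 (0, p.2) p.1) *
      chanMean P r 0 (0, p.2))) (P.prod (gaussianReal 0 1)) := by
    have hb : Integrable (fun p : ℝ × ℝ => B * B * Real.exp (|r| / 2 * B ^ 2) *
        Real.exp (√r * B * |p.2|)) (P.prod (gaussianReal 0 1)) :=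
      ((integrable_exp_mul_abs_gaussianReal (√r * B)).comp_snd P).const_mul _
    refine hb.mono' hm.aestronglyMeasurable ?_
    filter_upwards [ae_prod_fst hP] with p hp
    have hB : 0 ≤ B := (abs_nonneg _).trans hp
    have h1 := (le_abs_self _).trans (abs_chanExp_le hp r 0 (0, p.2))
    have h2 : chanBound B r 0 (0, p.2) = |r| / 2 * B ^ 2 + √r * B * |p.2| := by
      simp only [chanBound, abs_zero, zero_mul]; ring
    rw [h2] at h1
    rw [Real.norm_eq_abs, abs_mul, abs_mul, abs_of_pos (Real.exp_pos _), mul_assoc, ← Real.exp_add]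
    calc _ ≤ B * (Real.exp (|r| / 2 * B ^ 2 + √r * B * |p.2|) * B) := by
          gcongr
          exact abs_chanMean_le hP r 0 _
      _ = _ := by ring
  have e1 : chanOverlap P r r = ∫ x, ∫ z, x * (Real.exp (chanExp r 0 (0, z) x) *
      chanMean P r 0 (0, z)) ∂(gaussianReal 0 1) ∂P := by
    rw [chanOverlap, integral_prod _ (integrable_mul_chanMean hP r r)]
    congr 1; ext x
    rw [integral_const_mul, integral_const_mul]
    congr 1
    simp_rw [chanMean_diag P hr, chanExp_zero_eq hr]
    exact integral_gaussianReal_add (√r * x) hmm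
  rw [e1, integral_integral_swap hi]
  congr 1; ext z
  have : ∀ x, x * (Real.exp (chanExp r 0 (0, z) x) * chanMean P r 0 (0, z)) =
      x * Real.exp (chanExp r 0 (0, z) x) * chanMean P r 0 (0, z) := fun x => by ring
  simp_rw [this]
  rw [integral_mul_const, chanMean, ← obsDensity]
  ring

lemma chanOverlap_diag_nonneg (hP : ∀ᵐ x ∂P, |x| ≤ B) {r : ℝ} (hr : 0 ≤ r) :
    0 ≤ chanOverlap P r r := by
  rw [chanOverlap_diag hP hr]
  exact integral_nonneg fun z => div_nonneg (sq_nonneg _) (obsDensity_pos hP r z).le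

/-- `ψ' = E x*⟨x⟩ / 2` (the I-MMSE relation). -/
lemma hasDerivAt_psi (hP : ∀ᵐ x ∂P, |x| ≤ B) (hB : 0 ≤ B) {r : ℝ} (hr : 0 < r) :
    HasDerivAt (psi P) (chanOverlap P r r / 2) r := by
  -- `psi` is the integral of `z log z` of the observation density, which is interpolated from
  -- signal `0` to signal `2 * r`; so `r` is the midpoint, in the interior of the path.
  set R := 2 * r with hR
  have hR0 : 0 < R := by positivity
  have hD : PathData P (fun (_ : Unit) (x : ℝ) => x) (fun _ => 0) (fun _ => R) (fun _ => 0)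
      (fun _ => 0) (B + R + 1) := by
    refine ⟨⟨by positivity, fun _ => measurable_id, ?_⟩, fun _ => le_rfl, fun _ => hR0.le,
      fun _ => by positivity, fun _ => by nlinarith, measurable_const, measurable_const, ?_, ?_⟩
    · filter_upwards [hP] with x hx _; linarith
    · exact ae_of_all _ fun _ => by rw [abs_zero]; positivity
    · exact ae_of_all _ fun _ => by rw [abs_zero]; positivity
  have heq : ∀ (f : ℝ → ℝ) (u : ℝ), 0 ≤ u → ∀ g : Unit → ℝ,
      pathInt P (fun (_ : Unit) (x : ℝ) => x) (fun _ => 0) (fun _ => R) (fun _ => 0)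
        (fun _ => 0) f u g = ∫ x, f x * Real.exp (chanExp (u * R) 0 (0, g ()) x) ∂P := by
    intro f u hu g
    unfold pathInt tiltInt
    congr 1; ext x
    congr 2
    simp only [tiltExp, pathCoef, pathWeight, chanExp, Finset.univ_unique, Finset.sum_singleton,
      mul_zero, add_zero]
    rw [Real.sq_sqrt (by positivity)]
  have hZ : ∀ u : ℝ, 0 ≤ u → ∀ g : Unit → ℝ,
      pathInt P (fun (_ : Unit) (x : ℝ) => x) (fun _ => 0) (fun _ => R) (fun _ => 0)
        (fun _ => 0) (fun _ => 1) u g = obsDensity P (u * R) (g ()) := by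
    intro u hu g
    rw [heq _ u hu, obsDensity, chanZ]
    simp_rw [one_mul]
  have hev : MeasurePreserving (fun g : Unit → ℝ => g ()) (gaussPi Unit) (gaussianReal 0 1) :=
    measurePreserving_eval (fun _ : Unit => gaussianReal 0 1) ()
  have hint : ∀ f : ℝ → ℝ, Measurable f →
      ∫ g, f (g ()) ∂(gaussPi Unit) = ∫ z, f z ∂(gaussianReal 0 1) := fun f hf => by
    conv_rhs => rw [← hev.map_eq]
    exact (integral_map hev.measurable.aemeasurable hf.aestronglyMeasurable).symm
  have hu : (1 / 2 : ℝ) ∈ Set.Ioo (0:ℝ) 1 := by constructor <;> norm_num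
  have hder := (hD.hasDerivAt_integral (IsProbabilityMeasure.ne_zero P) isTame_mul_log hu).2
  have hpsi : ∀ u : ℝ, 0 ≤ u → ∫ g, pathInt P (fun (_ : Unit) (x : ℝ) => x) (fun _ => 0)
      (fun _ => R) (fun _ => 0) (fun _ => 0) (fun _ => 1) u g *
      Real.log (pathInt P (fun (_ : Unit) (x : ℝ) => x) (fun _ => 0) (fun _ => R) (fun _ => 0)
        (fun _ => 0) (fun _ => 1) u g) ∂(gaussPi Unit) = psi P (u * R) := by
    intro u hu
    simp_rw [hZ u hu]
    rw [hint (fun z => obsDensity P (u * R) z * Real.log (obsDensity P (u * R) z))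
      ((measurable_obsDensity _).mul (measurable_obsDensity _).log),
      psi_eq_integral hP (by positivity)]
  have hRr : (1 / 2 : ℝ) * R = r := by rw [hR]; ring
  have hval : (∫ g, (∑ k : Unit, (R - 0) / 2 *
      ((pathInt P (fun (_ : Unit) (x : ℝ) => x) (fun _ => 0) (fun _ => R) (fun _ => 0)
        (fun _ => 0) (fun _ => 1) (1 / 2) g)⁻¹ *
      pathInt P (fun (_ : Unit) (x : ℝ) => x) (fun _ => 0) (fun _ => R) (fun _ => 0)
        (fun _ => 0) (fun x => x) (1 / 2) g ^ 2) +
      (Real.log (pathInt P (fun (_ : Unit) (x : ℝ) => x) (fun _ => 0) (fun _ => R) (fun _ => 0)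
        (fun _ => 0) (fun _ => 1) (1 / 2) g) + 1) *
      pathInt P (fun (_ : Unit) (x : ℝ) => x) (fun _ => 0) (fun _ => R) (fun _ => 0)
        (fun _ => 0) (fun x => 0 - 0) (1 / 2) g) ∂(gaussPi Unit)) =
      R / 2 * chanOverlap P r r := by
    simp_rw [hZ (1 / 2) (by norm_num), heq _ (1 / 2) (by norm_num), hRr]
    simp only [Finset.univ_unique, Finset.sum_singleton, sub_self, zero_mul, integral_zero,
      mul_zero, add_zero, sub_zero]
    have hm : Measurable fun z : ℝ => ∫ x, x * Real.exp (chanExp r 0 (0, z) x) ∂P :=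
      (measurable_chanInt measurable_id r 0).comp
        (by fun_prop : Measurable fun z : ℝ => ((0:ℝ), z))
    rw [integral_const_mul, hint (fun z => (obsDensity P r z)⁻¹ *
      (∫ x, x * Real.exp (chanExp r 0 (0, z) x) ∂P) ^ 2)
      ((measurable_obsDensity r).inv.mul (hm.pow_const 2)), chanOverlap_diag hP hr.le]
    simp_rw [div_eq_inv_mul]
  have hder' := hder.congr_deriv hval
  have hcomp : HasDerivAt (fun ρ : ℝ => ρ / R) (1 / R) r := (hasDerivAt_id' r).div_const R
  have hrR : r / R = 1 / 2 := by rw [hR]; field_simp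
  rw [← hrR] at hder'
  have := hder'.comp r hcomp
  refine (this.congr_of_eventuallyEq ?_).congr_deriv (by field_simp)
  filter_upwards [lt_mem_nhds hr] with ρ hρ
  simp only [Function.comp]
  rw [hpsi _ (by positivity), div_mul_cancel₀ _ hR0.ne']

/-! ### The anti-planted direction `s = -r` -/

lemma obsDensity_le (hP : ∀ᵐ x ∂P, |x| ≤ B) (r z : ℝ) :
    obsDensity P r z ≤ Real.exp (√r * B * |z| + |r| / 2 * B ^ 2) := by
  refine (chanZ_le hP r 0 (0, z)).trans_eq ?_
  simp only [chanBound, abs_zero, zero_mul]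
  ring_nf

lemma abs_log_obsDensity_le (hP : ∀ᵐ x ∂P, |x| ≤ B) (r z : ℝ) :
    |Real.log (obsDensity P r z)| ≤ √r * B * |z| + |r| / 2 * B ^ 2 := by
  refine (abs_log_chanZ_le hP r 0 (0, z)).trans_eq ?_
  simp only [chanBound, abs_zero, zero_mul]
  ring

lemma integrable_obsDensity_mul_log (hP : ∀ᵐ x ∂P, |x| ≤ B) (r : ℝ) {ε : ℝ → ℝ}
    (hε : Measurable ε) (hε' : ∀ z, |ε z| = |z|) :
    Integrable (fun z => obsDensity P r z * Real.log (obsDensity P r (ε z)))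
      (gaussianReal 0 1) := by
  refine ((integrable_exp_mul_abs_gaussianReal (2 * (√r * B))).const_mul
    (Real.exp (2 * (|r| / 2 * B ^ 2)))).mono' ((measurable_obsDensity r).mul
      ((measurable_obsDensity r).comp hε).log).aestronglyMeasurable (ae_of_all _ fun z => ?_)
  have h1 := obsDensity_le hP r z
  have h2 := abs_log_obsDensity_le hP r (ε z)
  rw [hε'] at h2
  have h3 := Real.add_one_le_exp (√r * B * |z| + |r| / 2 * B ^ 2)
  rw [Real.norm_eq_abs, abs_mul, abs_of_pos (obsDensity_pos hP r z)]
  calc _ ≤ Real.exp (√r * B * |z| + |r| / 2 * B ^ 2) *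
        Real.exp (√r * B * |z| + |r| / 2 * B ^ 2) := by gcongr; linarith
    _ = _ := by rw [← Real.exp_add, ← Real.exp_add]; congr 1; ring

lemma integrable_obsDensity (hP : ∀ᵐ x ∂P, |x| ≤ B) (r : ℝ) :
    Integrable (obsDensity P r) (gaussianReal 0 1) := by
  refine ((integrable_exp_mul_abs_gaussianReal (√r * B)).const_mul
    (Real.exp (|r| / 2 * B ^ 2))).mono' (measurable_obsDensity r).aestronglyMeasurable
    (ae_of_all _ fun z => ?_)
  rw [Real.norm_eq_abs, abs_of_pos (obsDensity_pos hP r z), ← Real.exp_add, add_comm]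
  exact obsDensity_le hP r z

lemma continuous_obsDensity (hP : ∀ᵐ x ∂P, |x| ≤ B) (r : ℝ) : Continuous (obsDensity P r) := by
  refine continuous_iff_continuousAt.2 fun z => ?_
  unfold obsDensity chanZ
  refine continuousAt_of_dominated (bound := fun _ => Real.exp (chanBound B r 0 (0, |z| + 1)))
    ?_ ?_ (integrable_const _) ?_
  · exact Eventually.of_forall fun y => (Real.measurable_exp.comp
      (measurable_chanExp_right r 0 _)).aestronglyMeasurable
  · have : ∀ᶠ y in 𝓝 z, |y| < |z| + 1 :=
      (continuous_abs.tendsto z).eventually_lt_const (by linarith)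
    filter_upwards [this] with y hy
    filter_upwards [hP] with x hx
    have hB : 0 ≤ B := (abs_nonneg _).trans hx
    rw [Real.norm_eq_abs, abs_of_pos (Real.exp_pos _)]
    refine Real.exp_le_exp.2 ((le_abs_self _).trans ((abs_chanExp_le hx r 0 _).trans ?_))
    unfold chanBound
    have : |(|z| + 1)| = |z| + 1 := abs_of_nonneg (by positivity)
    simp only [this]
    gcongr
  · refine ae_of_all _ fun x => ?_
    unfold chanExp
    fun_prop

lemma sub_le_mul_log_sub {a b : ℝ} (ha : 0 < a) (hb : 0 < b) :
    a - b ≤ a * Real.log a - a * Real.log b := by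
  have := Real.log_le_sub_one_of_pos (div_pos hb ha)
  rw [Real.log_div hb.ne' ha.ne'] at this
  have h2 := mul_le_mul_of_nonneg_left this ha.le
  have : a * (b / a - 1) = b - a := by field_simp
  nlinarith

/-- The difference as a relative entropy. Subtracting `f z - f (-z)`, whose integral vanishes, makes
the integrand nonnegative. -/
lemma psi_sub_psiBar_antidiag (hP : ∀ᵐ x ∂P, |x| ≤ B) {r : ℝ} (hr : 0 ≤ r) :
    Integrable (fun z => obsDensity P r z * Real.log (obsDensity P r z) -
      obsDensity P r z * Real.log (obsDensity P r (-z)) -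
      (obsDensity P r z - obsDensity P r (-z))) (gaussianReal 0 1) ∧
    psi P r - psiBar P r (-r) = ∫ z, (obsDensity P r z * Real.log (obsDensity P r z) -
      obsDensity P r z * Real.log (obsDensity P r (-z)) -
      (obsDensity P r z - obsDensity P r (-z))) ∂(gaussianReal 0 1) := by
  have hneg : MeasurePreserving (fun z : ℝ => -z) (gaussianReal 0 1) (gaussianReal 0 1) :=
    ⟨measurable_neg, by rw [gaussianReal_map_neg, neg_zero]⟩
  have i1 := integrable_obsDensity_mul_log hP r measurable_id fun z => rfl
  have i2 := integrable_obsDensity_mul_log hP r measurable_neg abs_neg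
  have i3 := integrable_obsDensity hP r
  have i4 : Integrable (fun z => obsDensity P r (-z)) (gaussianReal 0 1) :=
    hneg.integrable_comp_of_integrable i3
  simp only [id] at i1
  have i12 : Integrable (fun z => obsDensity P r z * Real.log (obsDensity P r z) -
      obsDensity P r z * Real.log (obsDensity P r (-z))) (gaussianReal 0 1) := i1.sub i2
  have i34 : Integrable (fun z => obsDensity P r z - obsDensity P r (-z)) (gaussianReal 0 1) :=
    i3.sub i4
  refine ⟨i12.sub i34, ?_⟩
  have e4 : ∫ z, obsDensity P r (-z) ∂(gaussianReal 0 1) =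
      ∫ z, obsDensity P r z ∂(gaussianReal 0 1) := by
    conv_rhs => rw [← hneg.map_eq]
    rw [integral_map hneg.measurable.aemeasurable (measurable_obsDensity r).aestronglyMeasurable]
  rw [integral_sub i12 i34, integral_sub i1 i2, integral_sub i3 i4, e4, sub_self,
    sub_zero, psi_eq_integral hP hr, psiBar_antidiag_eq_integral hP hr]

/-- The difference `ψ(r) - psiBar(r, -r)` is the relative entropy of the observation with respect
to its reflection. -/
lemma psiBar_antidiag_le (hP : ∀ᵐ x ∂P, |x| ≤ B) {r : ℝ} (hr : 0 ≤ r) :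
    psiBar P r (-r) ≤ psi P r := by
  rw [← sub_nonneg, (psi_sub_psiBar_antidiag hP hr).2]
  exact integral_nonneg fun z => by
    have := sub_le_mul_log_sub (obsDensity_pos hP r z) (obsDensity_pos hP r (-z))
    simp only [Pi.zero_apply]
    linarith

lemma psiBar_le_psi (hP : ∀ᵐ x ∂P, |x| ≤ B) {r s : ℝ} (hr : 0 ≤ r) (hs : |s| ≤ r) :
    psiBar P r s ≤ psi P r := by
  rcases hr.eq_or_lt with h | h
  · rw [← h] at hs
    have : s = 0 := abs_eq_zero.1 (le_antisymm hs (abs_nonneg _))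
    rw [psi, ← h, this]
  · have h1 := abs_le.1 hs
    have hc := psiBar_convex hP r r (-r) (α := (r - s) / (2 * r))
      (div_nonneg (by linarith) (by positivity))
      (by rw [div_le_one (by positivity)]; linarith)
    have e : (1 - (r - s) / (2 * r)) * r + (r - s) / (2 * r) * -r = s := by field_simp; ring
    rw [e] at hc
    have h2 := psiBar_antidiag_le hP hr
    have h3 : 0 ≤ (r - s) / (2 * r) := div_nonneg (by linarith) (by positivity)
    rw [← psi] at hc
    nlinarith

end

end SpikedWigner

namespace SpikedWigner

section

variable {P : Measure ℝ} [IsProbabilityMeasure P] {B : ℝ}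

/-! ### Strictness for asymmetric priors -/

/-- A prior whose observation density is even is symmetric: the observation density is a moment
generating function of the prior tilted by `exp(-r x²/2)`. -/
lemma isSymmetricPrior_of_obsDensity_even (hP : ∀ᵐ x ∂P, |x| ≤ B) {r : ℝ} (hr : 0 < r)
    (h : ∀ z, obsDensity P r z = obsDensity P r (-z)) : IsSymmetricPrior P := by
  set e : ℝ → ℝ := fun x => -(r / 2 * x ^ 2) with he
  have hie : Integrable (fun x => Real.exp (e x)) P := by
    simpa [chanExp, he] using integrable_exp_chanExp hP r 0 (0, 0)
  set κ := P.tilted e with hκ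
  have : IsProbabilityMeasure κ := isProbabilityMeasure_tilted hie
  have hsr : 0 < √r := Real.sqrt_pos.2 hr
  have hmgf : ∀ t, mgf id κ t = obsDensity P r (t / √r) / ∫ x, Real.exp (e x) ∂P := by
    intro t
    rw [mgf, hκ, integral_exp_tilted]
    congr 1
    unfold obsDensity chanZ
    congr 1; ext x; congr 1
    simp only [Pi.add_apply, chanExp, he, id]
    field_simp
    ring
  have hmgf' : mgf id κ = mgf (fun x => -x) κ := by
    ext t
    have : mgf (fun x => -x) κ t = mgf id κ (-t) := by
      simp only [mgf]; congr 1; ext x; congr 1; simp only [id]; ring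
    rw [this, hmgf, hmgf, h, neg_div]
  have hset : integrableExpSet id κ = Set.univ := by
    refine Set.eq_univ_of_forall fun t => ?_
    have hb : ∀ᵐ x ∂κ, |x| ≤ B := (tilted_absolutelyContinuous _ _).ae_le hP
    refine Integrable.of_bound (C := Real.exp (|t| * B)) (by fun_prop) ?_
    filter_upwards [hb] with x hx
    rw [Real.norm_eq_abs, abs_of_pos (Real.exp_pos _)]
    refine Real.exp_le_exp.2 ?_
    calc t * id x ≤ |t * x| := le_abs_self _
      _ = |t| * |x| := abs_mul _ _
      _ ≤ |t| * B := by gcongr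
  -- The moment generating functions agree on the real line, hence so do the complex ones, and these
  -- determine the measure.
  have hc : complexMGF id κ = complexMGF (fun x => -x) κ := by
    ext z
    refine eqOn_complexMGF_of_mgf hmgf' ?_
    simp [hset]
  have hmap := Measure.ext_of_complexMGF_eq aemeasurable_id (by fun_prop) hc
  rw [Measure.map_id] at hmap
  -- The tilt is even, so that undoing it preserves the symmetry.
  have hback : κ.tilted (fun x => -e x) = P := by
    rw [hκ, tilted_tilted hie]
    have : e + (fun x => -e x) = 0 := by ext x; simp
    rw [this, tilted_zero]
  have heven : ∀ x, e (-x) = e x := fun x => by simp [he]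
  have hem : Measurable e := by fun_prop
  have hpres : MeasurePreserving (fun x => -x) κ κ := ⟨measurable_neg, hmap.symm⟩
  clear_value κ
  unfold IsSymmetricPrior
  rw [← hback]
  refine Measure.ext_of_lintegral _ fun f hf => ?_
  rw [lintegral_map hf measurable_neg, lintegral_tilted, lintegral_tilted]
  have := hpres.lintegral_comp (f := fun x => ENNReal.ofReal (Real.exp (-e x) /
    ∫ x, Real.exp (-e x) ∂κ) * f x) (by fun_prop)
  simpa only [heven] using this

lemma psiBar_antidiag_lt (hP : ∀ᵐ x ∂P, |x| ≤ B) (hS : ¬ IsSymmetricPrior P) {r : ℝ}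
    (hr : 0 < r) : psiBar P r (-r) < psi P r := by
  refine (psiBar_antidiag_le hP hr.le).lt_of_ne fun heq => hS ?_
  obtain ⟨hint, hval⟩ := psi_sub_psiBar_antidiag hP hr.le
  rw [heq, sub_self, eq_comm, integral_eq_zero_iff_of_nonneg _ hint] at hval
  · have hv := (gaussianReal_absolutelyContinuous' 0 one_ne_zero).ae_le hval
    have hcont := continuous_obsDensity hP r
    have h2 : (obsDensity P r) =ᵐ[volume] fun z => obsDensity P r (-z) := by
      filter_upwards [hv] with z hz
      by_contra hne
      have ha := obsDensity_pos hP r z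
      have hb := obsDensity_pos hP r (-z)
      have hlt := Real.log_lt_sub_one_of_pos (div_pos hb ha) fun h1 => hne
        ((div_eq_one_iff_eq ha.ne').1 h1).symm
      rw [Real.log_div hb.ne' ha.ne'] at hlt
      have h3 := mul_lt_mul_of_pos_left hlt ha
      have h4 : obsDensity P r z * (obsDensity P r (-z) / obsDensity P r z - 1) =
        obsDensity P r (-z) - obsDensity P r z := by field_simp
      simp only [Pi.zero_apply] at hz
      nlinarith
    have h3 := (hcont.ae_eq_iff_eq volume (hcont.comp continuous_neg)).1 h2
    exact isSymmetricPrior_of_obsDensity_even hP hr fun z => congrFun h3 z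
  · intro z
    have := sub_le_mul_log_sub (obsDensity_pos hP r z) (obsDensity_pos hP r (-z))
    simp only [Pi.zero_apply]
    linarith

/-! ### Exponential moments of the scalar free energy -/

lemma exp_le_one_add_add (y : ℝ) : Real.exp y ≤ 1 + y + y ^ 2 * Real.exp |y| := by
  rcases le_total |y| 1 with h | h
  · have := Real.abs_exp_sub_one_sub_id_le h
    have h1 := Real.one_le_exp (abs_nonneg y)
    nlinarith [le_abs_self (Real.exp y - 1 - y), sq_nonneg y]
  · rcases le_total 0 y with hy | hy
    · rw [abs_of_nonneg hy] at *
      have h1 : Real.exp y ≤ y ^ 2 * Real.exp y :=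
        le_mul_of_one_le_left (Real.exp_pos y).le (one_le_pow₀ h)
      linarith
    · rw [abs_of_nonpos hy] at *
      have h1 := Real.add_one_le_exp (-y)
      have h2 : Real.exp y ≤ 1 := Real.exp_le_one_iff.2 hy
      nlinarith [sq_nonneg y, mul_le_mul_of_nonneg_left h1 (sq_nonneg y)]

/-- A real random variable dominated by `a |z| + b` has a cumulant generating function which is
quadratic near the origin. -/
lemma exists_exp_moment_bound (a b : ℝ) : ∃ C : ℝ, 0 ≤ C ∧ ∀ X : ℝ × ℝ → ℝ,
    Measurable X → (∀ᵐ w ∂(P.prod (gaussianReal 0 1)), |X w| ≤ a * |w.2| + b) →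
    ∀ t : ℝ, |t| ≤ 1 → Integrable (fun w => Real.exp (t * X w)) (P.prod (gaussianReal 0 1)) ∧
      ∫ w, Real.exp (t * X w) ∂(P.prod (gaussianReal 0 1)) ≤
        Real.exp (t * ∫ w, X w ∂(P.prod (gaussianReal 0 1)) + C * t ^ 2) := by
  have hb : Integrable (fun w : ℝ × ℝ => Real.exp (3 * b) * Real.exp (3 * a * |w.2|))
      (P.prod (gaussianReal 0 1)) :=
    ((integrable_exp_mul_abs_gaussianReal (3 * a)).comp_snd P).const_mul _
  refine ⟨_, integral_nonneg (μ := P.prod (gaussianReal 0 1))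
    (f := fun w : ℝ × ℝ => Real.exp (3 * b) * Real.exp (3 * a * |w.2|))
    (fun w => by positivity), fun X hX hXb t ht => ?_⟩
  have hdom : ∀ᵐ w ∂(P.prod (gaussianReal 0 1)),
      Real.exp (3 * |X w|) ≤ Real.exp (3 * b) * Real.exp (3 * a * |w.2|) := by
    filter_upwards [hXb] with w hw
    rw [← Real.exp_add]
    gcongr
    linarith
  have hX1 : Integrable X (P.prod (gaussianReal 0 1)) := by
    refine hb.mono' hX.aestronglyMeasurable ?_
    filter_upwards [hdom] with w hw
    refine le_trans ?_ hw
    rw [Real.norm_eq_abs]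
    linarith [Real.add_one_le_exp (3 * |X w|), abs_nonneg (X w)]
  have hX2 : Integrable (fun w => Real.exp (t * X w)) (P.prod (gaussianReal 0 1)) := by
    refine hb.mono' (by fun_prop) ?_
    filter_upwards [hdom] with w hw
    refine le_trans ?_ hw
    rw [Real.norm_eq_abs, abs_of_pos (Real.exp_pos _)]
    refine Real.exp_le_exp.2 ?_
    have := (le_abs_self (t * X w)).trans_eq (abs_mul _ _)
    have := mul_le_of_le_one_left (abs_nonneg (X w)) ht
    linarith [abs_nonneg (X w)]
  refine ⟨hX2, ?_⟩
  set C := ∫ w : ℝ × ℝ, Real.exp (3 * b) * Real.exp (3 * a * |w.2|) ∂(P.prod (gaussianReal 0 1))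
  calc ∫ w, Real.exp (t * X w) ∂(P.prod (gaussianReal 0 1))
      ≤ ∫ w : ℝ × ℝ, ((1 + t * X w) + t ^ 2 * (Real.exp (3 * b) * Real.exp (3 * a * |w.2|)))
          ∂(P.prod (gaussianReal 0 1)) := by
        refine integral_mono_ae hX2 (((integrable_const 1).add (hX1.const_mul t)).add
          (hb.const_mul _)) ?_
        filter_upwards [hdom] with w hw
        refine (exp_le_one_add_add _).trans ?_
        have h1 : (t * X w) ^ 2 * Real.exp |t * X w| ≤ t ^ 2 * Real.exp (3 * |X w|) := by
          rw [mul_pow, mul_assoc]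
          gcongr
          have h2 : X w ^ 2 ≤ Real.exp |X w| * Real.exp |X w| := by
            rw [← sq_abs, sq]
            have := Real.add_one_le_exp |X w|
            have := abs_nonneg (X w)
            gcongr <;> linarith
          have h3 : Real.exp |t * X w| ≤ Real.exp |X w| := by
            refine Real.exp_le_exp.2 ?_
            rw [abs_mul]
            exact mul_le_of_le_one_left (abs_nonneg (X w)) ht
          calc _ ≤ Real.exp |X w| * Real.exp |X w| * Real.exp |X w| := by gcongr
            _ = _ := by rw [← Real.exp_add, ← Real.exp_add]; congr 1; ring
        have : t ^ 2 * Real.exp (3 * |X w|) ≤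
          t ^ 2 * (Real.exp (3 * b) * Real.exp (3 * a * |w.2|)) := by gcongr
        linarith
    _ = 1 + t * ∫ w, X w ∂(P.prod (gaussianReal 0 1)) + t ^ 2 * C := by
        have i1 : Integrable (fun w => 1 + t * X w) (P.prod (gaussianReal 0 1)) :=
          (integrable_const 1).add (hX1.const_mul t)
        rw [integral_add i1 (hb.const_mul _),
          integral_add (integrable_const 1) (hX1.const_mul t), integral_const_mul,
          integral_const_mul]
        simp [C]
    _ ≤ _ := by
        have := Real.add_one_le_exp (t * ∫ w, X w ∂(P.prod (gaussianReal 0 1)) + C * t ^ 2)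
        linarith

/-- Fractional moments of the scalar partition function, uniformly for bounded `r` and `s`. -/
lemma exists_rpow_chanZ_bound (hP : ∀ᵐ x ∂P, |x| ≤ B) (R : ℝ) : ∃ C : ℝ, 0 ≤ C ∧
    ∀ r s : ℝ, |r| ≤ R → |s| ≤ R → ∀ t : ℝ, |t| ≤ 1 →
    ∫⁻ w, ENNReal.ofReal (chanZ P r s w ^ t) ∂(P.prod (gaussianReal 0 1)) ≤
      ENNReal.ofReal (Real.exp (t * psiBar P r s + C * t ^ 2)) := by
  obtain ⟨C, hC, h⟩ := exists_exp_moment_bound (P := P) (√R * B) (R * B * B + R / 2 * B ^ 2)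
  refine ⟨C, hC, fun r s hr hs t ht => ?_⟩
  have hb : ∀ᵐ w ∂(P.prod (gaussianReal 0 1)), |Real.log (chanZ P r s w)| ≤
      √R * B * |w.2| + (R * B * B + R / 2 * B ^ 2) := by
    filter_upwards [ae_prod_fst hP] with w hw
    exact (abs_log_chanZ_le hP r s w).trans (chanBound_le_of_le hr hs hw)
  obtain ⟨hi, hle⟩ := h _ (measurable_chanZ r s).log hb t ht
  have e : ∀ w, chanZ P r s w ^ t = Real.exp (t * Real.log (chanZ P r s w)) := fun w => by
    rw [Real.rpow_def_of_pos (chanZ_pos hP r s w), mul_comm]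
  simp_rw [e]
  rw [← ofReal_integral_eq_lintegral_ofReal hi (ae_of_all _ fun _ => (Real.exp_pos _).le)]
  exact ENNReal.ofReal_le_ofReal hle

end

end SpikedWigner

namespace SpikedWigner

/-! ### The interpolating Hamiltonian as a Gaussian tilt -/

variable {N : ℕ}

/-- The coordinates of the Gaussian disorder: the matrix entries and the side channel. -/
abbrev NoiseIndex (N : ℕ) : Type := (Fin N × Fin N) ⊕ Fin N

/-- The coefficient functions of the Gaussian disorder in the Hamiltonian, without variances. The
matrix entries that are not above the diagonal get the coefficient `0`. -/
def spinCoef (N : ℕ) : NoiseIndex N → (Fin N → ℝ) → ℝ :=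
  Sum.elim (fun p x => if p.1 < p.2 then x p.1 * x p.2 else 0) (fun i x => x i)

/-- The variances: `α` for the matrix entries and `τ` for the side channel. -/
def noiseVar (N : ℕ) (α τ : ℝ) : NoiseIndex N → ℝ := Sum.elim (fun _ => α) (fun _ => τ)

/-- The part of the Hamiltonian due to the spike `y`. -/
def spikeTerm (N : ℕ) (α τ : ℝ) (y x : Fin N → ℝ) : ℝ :=
  ∑ k, noiseVar N α τ k * (spinCoef N k x * spinCoef N k y)

lemma sum_lt_mul_eq (c : Fin N → ℝ) :
    ∑ p : Fin N × Fin N, (if p.1 < p.2 then c p.1 * c p.2 else 0) =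
      ((∑ i, c i) ^ 2 - ∑ i, c i ^ 2) / 2 := by
  have h1 : (∑ i, c i) ^ 2 = ∑ p : Fin N × Fin N, c p.1 * c p.2 := by
    rw [sq, Finset.sum_mul_sum, ← Finset.univ_product_univ, Finset.sum_product]
  have h2 : ∀ p : Fin N × Fin N, c p.1 * c p.2 = (if p.1 < p.2 then c p.1 * c p.2 else 0) +
      (if p.1 = p.2 then c p.1 * c p.2 else 0) + (if p.2 < p.1 then c p.1 * c p.2 else 0) := by
    intro p
    rcases lt_trichotomy p.1 p.2 with h | h | h
    · simp [h, h.ne, h.not_gt]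
    · simp [h]
    · simp [h, h.ne', h.not_gt]
  have h3 : ∑ p : Fin N × Fin N, (if p.2 < p.1 then c p.1 * c p.2 else 0) =
      ∑ p : Fin N × Fin N, (if p.1 < p.2 then c p.1 * c p.2 else 0) := by
    rw [← (Equiv.prodComm (Fin N) (Fin N)).sum_comp]
    refine Finset.sum_congr rfl fun p _ => ?_
    simp [mul_comm]
  have h4 : ∑ p : Fin N × Fin N, (if p.1 = p.2 then c p.1 * c p.2 else 0) = ∑ i, c i ^ 2 := by
    rw [Fintype.sum_prod_type]
    refine Finset.sum_congr rfl fun i _ => ?_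
    simp [sq]
  rw [h1, Finset.sum_congr rfl fun p _ => h2 p, Finset.sum_add_distrib, Finset.sum_add_distrib,
    h3, h4]
  ring

/-- The covariance of the Hamiltonian at two configurations. -/
lemma sum_noiseVar_mul (α τ : ℝ) (x y : Fin N → ℝ) :
    ∑ k, noiseVar N α τ k * (spinCoef N k x * spinCoef N k y) =
      α * (((∑ i, x i * y i) ^ 2 - ∑ i, (x i * y i) ^ 2) / 2) + τ * ∑ i, x i * y i := by
  rw [Fintype.sum_sum_type, ← sum_lt_mul_eq fun i => x i * y i, Finset.mul_sum, Finset.mul_sum]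
  congr 1
  refine Finset.sum_congr rfl fun p _ => ?_
  simp only [noiseVar, spinCoef, Sum.elim_inl]
  split_ifs <;> ring

lemma negH_eq_tiltExp {lam q t : ℝ} (h₁ : 0 ≤ t * lam / N) (h₂ : 0 ≤ (1 - t) * (lam * q))
    (y : Fin N → ℝ) (g : NoiseIndex N → ℝ) (x : Fin N → ℝ) :
    negH lam q t (y, (fun p => g (Sum.inl p)), fun i => g (Sum.inr i)) x =
      tiltExp (spinCoef N) (fun k => √(noiseVar N (t * lam / N) ((1 - t) * (lam * q)) k))
        (spikeTerm N (t * lam / N) ((1 - t) * (lam * q)) y) g x := by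
  unfold tiltExp spikeTerm negH
  rw [← Finset.sum_add_distrib, Fintype.sum_sum_type, Finset.sum_filter]
  congr 1
  · refine Finset.sum_congr rfl fun p _ => ?_
    simp only [noiseVar, spinCoef, Sum.elim_inl, Real.sq_sqrt h₁]
    split_ifs
    · ring
    · ring
  · refine Finset.sum_congr rfl fun i _ => ?_
    simp only [noiseVar, spinCoef, Sum.elim_inr, Real.sq_sqrt h₂]
    ring

lemma measurable_spinCoef (k : NoiseIndex N) : Measurable (spinCoef N k) := by
  rcases k with p | i
  · simp only [spinCoef, Sum.elim_inl]
    split_ifs <;> fun_prop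
  · simp only [spinCoef, Sum.elim_inr]
    fun_prop

lemma abs_spinCoef_le {B : ℝ} (hB : 0 ≤ B) {x : Fin N → ℝ} (hx : ∀ i, |x i| ≤ B)
    (k : NoiseIndex N) : |spinCoef N k x| ≤ B ^ 2 + B := by
  rcases k with p | i
  · simp only [spinCoef, Sum.elim_inl]
    split_ifs
    · rw [abs_mul]
      have := mul_le_mul (hx p.1) (hx p.2) (abs_nonneg _) hB
      nlinarith
    · rw [abs_zero]; positivity
  · simp only [spinCoef, Sum.elim_inr]
    nlinarith [hx i, sq_nonneg B]

lemma measurable_spikeTerm (α τ : ℝ) (y : Fin N → ℝ) : Measurable (spikeTerm N α τ y) :=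
  Finset.measurable_fun_sum _ fun k _ => ((measurable_spinCoef k).mul_const _).const_mul _

lemma noiseVar_nonneg {α τ : ℝ} (hα : 0 ≤ α) (hτ : 0 ≤ τ) (k : NoiseIndex N) :
    0 ≤ noiseVar N α τ k := by
  rcases k with p | i
  exacts [hα, hτ]

lemma abs_spikeTerm_le {B α τ : ℝ} (hB : 0 ≤ B) (hα : 0 ≤ α) (hτ : 0 ≤ τ) {x y : Fin N → ℝ}
    (hx : ∀ i, |x i| ≤ B) (hy : ∀ i, |y i| ≤ B) :
    |spikeTerm N α τ y x| ≤ (∑ k, noiseVar N α τ k) * (B ^ 2 + B) ^ 2 := by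
  unfold spikeTerm
  rw [Finset.sum_mul]
  refine (Finset.abs_sum_le_sum_abs _ _).trans (Finset.sum_le_sum fun k _ => ?_)
  rw [abs_mul, abs_mul, abs_of_nonneg (noiseVar_nonneg hα hτ k), sq]
  have := abs_spinCoef_le hB hx k
  have := abs_spinCoef_le hB hy k
  have := noiseVar_nonneg hα hτ k
  gcongr

/-- The hypotheses of the Gaussian interpolation hold for spin configurations in a cube. -/
lemma exists_pathData {ν : Measure (Fin N → ℝ)} {B : ℝ} (hB : 0 ≤ B)
    (hν : ∀ᵐ x ∂ν, ∀ i, |x i| ≤ B) {α₀ τ₀ α₁ τ₁ : ℝ} (hα₀ : 0 ≤ α₀) (hτ₀ : 0 ≤ τ₀)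
    (hα₁ : 0 ≤ α₁) (hτ₁ : 0 ≤ τ₁) {β₀ β₁ : (Fin N → ℝ) → ℝ} (h₀ : Measurable β₀)
    (h₁ : Measurable β₁) {D : ℝ} (hD₀ : ∀ᵐ x ∂ν, |β₀ x| ≤ D) (hD₁ : ∀ᵐ x ∂ν, |β₁ x| ≤ D) :
    ∃ A, PathData ν (spinCoef N) (noiseVar N α₀ τ₀) (noiseVar N α₁ τ₁) β₀ β₁ A := by
  have key : ∀ {α τ : ℝ}, 0 ≤ α → 0 ≤ τ → ∀ k, noiseVar N α τ k ≤ α + τ := by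
    intro α τ hα hτ k
    rcases k with p | i
    · simpa [noiseVar] using hτ
    · simpa [noiseVar] using hα
  have hsq : ∀ {a : ℝ}, a ≤ 1 + |D| + (B ^ 2 + B) + (α₀ + τ₀) + (α₁ + τ₁) →
      a ≤ (1 + |D| + (B ^ 2 + B) + (α₀ + τ₀) + (α₁ + τ₁)) ^ 2 := fun h =>
    h.trans (le_self_pow₀ (by linarith [abs_nonneg D, sq_nonneg B]) two_ne_zero)
  have hD := abs_nonneg D
  have hB2 := sq_nonneg B
  refine ⟨1 + |D| + (B ^ 2 + B) + (α₀ + τ₀) + (α₁ + τ₁), ⟨by positivity, measurable_spinCoef, ?_⟩,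
    noiseVar_nonneg hα₀ hτ₀, noiseVar_nonneg hα₁ hτ₁,
    fun k => hsq ((key hα₀ hτ₀ k).trans (by linarith)),
    fun k => hsq ((key hα₁ hτ₁ k).trans (by linarith)), h₀, h₁, ?_, ?_⟩
  · filter_upwards [hν] with x hx k
    linarith [abs_spinCoef_le hB hx k]
  · filter_upwards [hD₀] with x hx
    linarith [le_abs_self D]
  · filter_upwards [hD₁] with x hx
    linarith [le_abs_self D]

/-! ### The prior and the disorder -/

variable {P : Measure ℝ} {B : ℝ}

lemma lintegral_disorderLaw {F : Disorder N → ENNReal} (hF : Measurable F) :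
    ∫⁻ d, F d ∂(disorderLaw P N) = ∫⁻ y, ∫⁻ g : NoiseIndex N → ℝ,
      F (y, (fun p => g (Sum.inl p)), fun i => g (Sum.inr i)) ∂(gaussPi (NoiseIndex N))
      ∂(priorN P N) := by
  rw [disorderLaw, lintegral_prod _ hF.aemeasurable]
  refine lintegral_congr fun y => ?_
  have hmp := measurePreserving_sumPiEquivProdPi (fun _ : NoiseIndex N => gaussianReal 0 1)
  exact (hmp.lintegral_comp (f := fun p => F (y, p)) (hF.comp measurable_prodMk_left)).symm

variable [IsProbabilityMeasure P]

instance : IsProbabilityMeasure (priorN P N) := by unfold priorN; infer_instance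

instance : IsProbabilityMeasure (disorderLaw P N) := by unfold disorderLaw; infer_instance

lemma ae_priorN (hP : ∀ᵐ x ∂P, |x| ≤ B) : ∀ᵐ x ∂(priorN P N), ∀ i, |x i| ≤ B :=
  ae_all_iff.2 fun i => (measurePreserving_eval (fun _ : Fin N => P) i).quasiMeasurePreserving.ae hP

lemma ae_disorder (hP : ∀ᵐ x ∂P, |x| ≤ B) : ∀ᵐ d ∂(disorderLaw P N), ∀ i, |d.1 i| ≤ B :=
  Measure.quasiMeasurePreserving_fst.ae (ae_priorN hP)

lemma measurable_negH (lam q t : ℝ) :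
    Measurable fun p : Disorder N × (Fin N → ℝ) => negH lam q t p.1 p.2 := by
  unfold negH
  fun_prop

lemma measurable_overlap : Measurable fun p : (Fin N → ℝ) × (Fin N → ℝ) => overlap p.1 p.2 := by
  unfold overlap
  fun_prop

/-- The unrestricted partition function. -/
noncomputable def fullZ (P : Measure ℝ) {N : ℕ} (lam q t : ℝ) (d : Disorder N) : ENNReal :=
  ∫⁻ x, ENNReal.ofReal (Real.exp (negH lam q t d x)) ∂(priorN P N)

lemma measurable_fullZ (lam q t : ℝ) : Measurable (fullZ (N := N) P lam q t) :=
  Measurable.lintegral_prod_right' (f := fun p : Disorder N × (Fin N → ℝ) =>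
    ENNReal.ofReal (Real.exp (negH lam q t p.1 p.2)))
    (Real.measurable_exp.comp (measurable_negH lam q t)).ennreal_ofReal

lemma measurableSet_window (m ε : ℝ) (y : Fin N → ℝ) :
    MeasurableSet {x : Fin N → ℝ | overlap x y ∈ Set.Ico m (m + ε)} :=
  (measurable_overlap.comp (by fun_prop : Measurable fun x : Fin N → ℝ => (x, y)))
    measurableSet_Ico

lemma measurable_restrictedZ (lam q t ε m : ℝ) :
    Measurable (restrictedZ (N := N) P lam q t ε m) := by
  have hs : MeasurableSet {p : Disorder N × (Fin N → ℝ) | overlap p.2 p.1.1 ∈ Set.Ico m (m + ε)} :=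
    (measurable_overlap.comp (by fun_prop :
      Measurable fun p : Disorder N × (Fin N → ℝ) => (p.2, p.1.1))) measurableSet_Ico
  have h := Measurable.lintegral_prod_right' (ν := priorN P N)
    (f := {p : Disorder N × (Fin N → ℝ) | overlap p.2 p.1.1 ∈ Set.Ico m (m + ε)}.indicator
      fun p => ENNReal.ofReal (Real.exp (negH lam q t p.1 p.2)))
    ((Real.measurable_exp.comp (measurable_negH lam q t)).ennreal_ofReal.indicator hs)
  convert h using 2 with d
  rw [restrictedZ, ← lintegral_indicator (measurableSet_window m ε d.1)]
  rfl

/-- Partition functions over product measures factorize. -/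
lemma integral_exp_sum_chanExp (r s : ℝ) (y z : Fin N → ℝ) :
    ∫ x, Real.exp (∑ i, chanExp r s (y i, z i) (x i)) ∂(priorN P N) =
      ∏ i, chanZ P r s (y i, z i) := by
  simp_rw [Real.exp_sum]
  exact integral_fintype_prod_eq_prod (fun i x => Real.exp (chanExp r s (y i, z i) x))

lemma tiltExp_side {r s : ℝ} (hr : 0 ≤ r) (y : Fin N → ℝ) (g : NoiseIndex N → ℝ)
    (x : Fin N → ℝ) :
    tiltExp (spinCoef N) (fun k => √(noiseVar N 0 r k)) (fun x => s * ∑ i, x i * y i) g x =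
      ∑ i, chanExp r s (y i, g (Sum.inr i)) (x i) := by
  unfold tiltExp
  rw [Fintype.sum_sum_type]
  simp only [noiseVar, spinCoef, Sum.elim_inl, Sum.elim_inr, Real.sqrt_zero, zero_mul, ne_eq,
    OfNat.ofNat_ne_zero, not_false_eq_true, zero_pow, zero_div, sub_self, Finset.sum_const_zero,
    zero_add, Real.sq_sqrt hr, Finset.mul_sum, ← Finset.sum_add_distrib]
  refine Finset.sum_congr rfl fun i _ => ?_
  unfold chanExp
  ring

end SpikedWigner

namespace SpikedWigner

/-! ### Fractional moments of the restricted partition function -/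

section

variable {ι : Type*} [Fintype ι] {X : Type*} [MeasurableSpace X]
  {ν : Measure X} [IsFiniteMeasure ν] {a : ι → X → ℝ} {v₀ v₁ : ι → ℝ} {β₀ β₁ : X → ℝ} {A : ℝ}

lemma PathData.lintegral_rpow_le (hD : PathData ν a v₀ v₁ β₀ β₁ A) (hν : ν ≠ 0) {p D : ℝ}
    (hp : 0 < p) (hp1 : p ≤ 1)
    (h : ∀ᵐ x ∂ν, ∀ᵐ y ∂ν,
      (p - 1) / 2 * ∑ k, (v₁ k - v₀ k) * (a k x * a k y) + (β₁ x - β₀ x) ≤ D) :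
    ∫⁻ g, ENNReal.ofReal (tiltInt ν a (fun k => √(v₁ k)) β₁ (fun _ => 1) g ^ p) ∂(gaussPi ι) ≤
      ENNReal.ofReal (Real.exp (p * D)) *
        ∫⁻ g, ENNReal.ofReal (tiltInt ν a (fun k => √(v₀ k)) β₀ (fun _ => 1) g ^ p)
          ∂(gaussPi ι) := by
  have hT := isTame_rpow hp hp1
  obtain ⟨C, hC, hG⟩ := hD.growth_comp hν hT.nonneg hT.bound
  have hi : ∀ u ∈ Set.Icc (0:ℝ) 1,
      Integrable (fun g => pathInt ν a v₀ v₁ β₀ β₁ (fun _ => 1) u g ^ p) (gaussPi ι) := fun u hu =>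
    (hG u hu).integrable (hT.meas.comp (hD.measurable_pathInt measurable_const u))
  have h1 : pathInt ν a v₀ v₁ β₀ β₁ (fun _ => 1) 1 =
      tiltInt ν a (fun k => √(v₁ k)) β₁ (fun _ => 1) := by
    have h1 : pathCoef v₀ v₁ 1 = fun k => √(v₁ k) := by ext k; simp [pathCoef]
    have h2 : pathWeight β₀ β₁ 1 = β₁ := by ext x; simp [pathWeight]
    unfold pathInt
    rw [h1, h2]
  have h0 : pathInt ν a v₀ v₁ β₀ β₁ (fun _ => 1) 0 =
      tiltInt ν a (fun k => √(v₀ k)) β₀ (fun _ => 1) := by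
    have h1 : pathCoef v₀ v₁ 0 = fun k => √(v₀ k) := by ext k; simp [pathCoef]
    have h2 : pathWeight β₀ β₁ 0 = β₀ := by ext x; simp [pathWeight]
    unfold pathInt
    rw [h1, h2]
  have i1 := hi 1 (by simp)
  have i0 := hi 0 (by simp)
  have p1 := fun g => Real.rpow_nonneg (hD.pathInt_pos hν (u := 1) (by simp) g).le p
  have p0 := fun g => Real.rpow_nonneg (hD.pathInt_pos hν (u := 0) (by simp) g).le p
  rw [h1] at i1 p1
  rw [h0] at i0 p0
  rw [← ofReal_integral_eq_lintegral_ofReal i1 (ae_of_all _ p1),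
    ← ofReal_integral_eq_lintegral_ofReal i0 (ae_of_all _ p0),
    ← ENNReal.ofReal_mul (Real.exp_pos _).le]
  exact ENNReal.ofReal_le_ofReal (hD.integral_rpow_le hν hp hp1 h)

end

variable {N : ℕ} {P : Measure ℝ} [IsProbabilityMeasure P] {B : ℝ}

lemma noiseVar_sub (α τ α' τ' : ℝ) (k : NoiseIndex N) :
    noiseVar N α τ k - noiseVar N α' τ' k = noiseVar N (α - α') (τ - τ') k := by
  rcases k with p | i <;> rfl

lemma sum_sq_mul_le {x y : Fin N → ℝ} (hx : ∀ i, |x i| ≤ B) (hy : ∀ i, |y i| ≤ B) :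
    ∑ i, (x i * y i) ^ 2 ≤ N * B ^ 4 := by
  have : ∀ i ∈ Finset.univ, (x i * y i) ^ 2 ≤ B ^ 4 := by
    intro i _
    have hB : 0 ≤ B := (abs_nonneg _).trans (hx i)
    have h1 : |x i * y i| ≤ B * B := by rw [abs_mul]; gcongr; exacts [hx i, hy i]
    calc (x i * y i) ^ 2 = |x i * y i| ^ 2 := (sq_abs _).symm
      _ ≤ (B * B) ^ 2 := by gcongr
      _ = B ^ 4 := by ring
  simpa using Finset.sum_le_card_nsmul _ _ _ this

lemma window_bounds (hN : 1 ≤ N) {m ε : ℝ} {x y : Fin N → ℝ}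
    (h : overlap x y ∈ Set.Ico m (m + ε)) :
    N * m ≤ ∑ i, x i * y i ∧ ∑ i, x i * y i ≤ N * m + N * ε := by
  have hN' : (0:ℝ) < N := by exact_mod_cast hN
  obtain ⟨h1, h2⟩ := h
  unfold overlap at h1 h2
  rw [le_div_iff₀ hN'] at h1
  rw [div_lt_iff₀ hN'] at h2
  constructor <;> nlinarith

/-- Completing the squares in the interpolation inequality: the square of the replica overlap `T`
is centred at `N |m|`, the square of the planted overlap `S` at `N m`. -/
lemma interpolation_bracket_le {n κ m ε s T Q Q' S b : ℝ} (hn : 0 < n) (hκ : 0 ≤ κ) (hs : 0 < s)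
    (hs1 : s ≤ 1) (hQ' : Q' ≤ n * b) (hb : 0 ≤ b) (hQ : 0 ≤ Q) (h1 : n * m ≤ S)
    (h2 : S ≤ n * m + n * ε) :
    (s - 1) / 2 * (κ / n * ((T ^ 2 - Q') / 2) - κ * |m| * T) +
      (κ / n * ((S ^ 2 - Q) / 2) - κ * m * S) ≤ κ * (-(n * m ^ 2) / 4 + n * ε ^ 2 / 2 + b / 4) := by
  have hX : -(κ * (n * m ^ 2 / 2 + b / 2)) ≤ κ / n * ((T ^ 2 - Q') / 2) - κ * |m| * T := by
    have : κ / n * ((T ^ 2 - Q') / 2) - κ * |m| * T + κ * (n * m ^ 2 / 2 + b / 2) =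
        κ / (2 * n) * ((T - n * |m|) ^ 2 + (n * b - Q')) := by
      rw [← sq_abs m]; field_simp; ring
    have h3 : 0 ≤ κ / (2 * n) * ((T - n * |m|) ^ 2 + (n * b - Q')) := by
      have := sub_nonneg.2 hQ'
      positivity
    linarith
  have hY : κ / n * ((S ^ 2 - Q) / 2) - κ * m * S ≤ κ * (n * ε ^ 2 / 2 - n * m ^ 2 / 2) := by
    have : κ * (n * ε ^ 2 / 2 - n * m ^ 2 / 2) - (κ / n * ((S ^ 2 - Q) / 2) - κ * m * S) =
        κ / (2 * n) * (((n * ε) ^ 2 - (S - n * m) ^ 2) + Q) := by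
      field_simp; ring
    have h3 : (S - n * m) ^ 2 ≤ (n * ε) ^ 2 := pow_le_pow_left₀ (by linarith) (by linarith) 2
    have h4 : 0 ≤ κ / (2 * n) * (((n * ε) ^ 2 - (S - n * m) ^ 2) + Q) := by
      have := sub_nonneg.2 h3
      positivity
    linarith
  have hc : 0 ≤ κ * (n * m ^ 2 / 2 + b / 2) := by positivity
  have : (s - 1) / 2 * (κ / n * ((T ^ 2 - Q') / 2) - κ * |m| * T) ≤
      (1 - s) / 2 * (κ * (n * m ^ 2 / 2 + b / 2)) := by
    have := mul_le_mul_of_nonneg_left hX (by linarith : 0 ≤ (1 - s) / 2)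
    linarith
  nlinarith

/-- The law of `∏ᵢ ζ(yᵢ, zᵢ)` factorizes. -/
lemma lintegral_prod_chanZ_rpow (r s' s : ℝ) :
    ∫⁻ y, ∫⁻ g : NoiseIndex N → ℝ, ∏ i, ENNReal.ofReal (chanZ P r s' (y i, g (Sum.inr i)) ^ s)
      ∂(gaussPi (NoiseIndex N)) ∂(priorN P N) =
    (∫⁻ w, ENNReal.ofReal (chanZ P r s' w ^ s) ∂(P.prod (gaussianReal 0 1))) ^ N := by
  have hm : Measurable fun w => ENNReal.ofReal (chanZ P r s' w ^ s) :=
    ((measurable_chanZ r s').pow_const s).ennreal_ofReal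
  have h1 : ∀ y : Fin N → ℝ, ∫⁻ g : NoiseIndex N → ℝ,
      ∏ i, ENNReal.ofReal (chanZ P r s' (y i, g (Sum.inr i)) ^ s) ∂(gaussPi (NoiseIndex N)) =
      ∏ i, ∫⁻ z, ENNReal.ofReal (chanZ P r s' (y i, z) ^ s) ∂(gaussianReal 0 1) := by
    intro y
    have := lintegral_prod_pi (fun _ : NoiseIndex N => gaussianReal 0 1)
      (Sum.elim (fun _ _ => 1) fun i z => ENNReal.ofReal (chanZ P r s' (y i, z) ^ s)) (by
        rintro (p | i)
        · exact measurable_const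
        · exact hm.comp measurable_prodMk_left)
    simpa [Fintype.prod_sum_type] using this
  simp_rw [h1]
  have hm2 : Measurable fun y => ∫⁻ z, ENNReal.ofReal (chanZ P r s' (y, z) ^ s)
      ∂(gaussianReal 0 1) := hm.lintegral_prod_right'
  rw [priorN, lintegral_prod_pi (fun _ : Fin N => P) _ fun _ => hm2,
    lintegral_prod _ hm.aemeasurable]
  simp

lemma lintegral_exp_negH_eq {ν : Measure (Fin N → ℝ)} [IsFiniteMeasure ν] {lam q t : ℝ}
    (hB : 0 ≤ B) (hν : ∀ᵐ x ∂ν, ∀ i, |x i| ≤ B)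
    (h₁ : 0 ≤ t * lam / N) (h₂ : 0 ≤ (1 - t) * (lam * q)) {y : Fin N → ℝ} (hy : ∀ i, |y i| ≤ B)
    (g : NoiseIndex N → ℝ) :
    ∫⁻ x, ENNReal.ofReal (Real.exp
      (negH lam q t (y, (fun p => g (Sum.inl p)), fun i => g (Sum.inr i)) x)) ∂ν =
      ENNReal.ofReal (tiltInt ν (spinCoef N)
        (fun k => √(noiseVar N (t * lam / N) ((1 - t) * (lam * q)) k))
        (spikeTerm N (t * lam / N) ((1 - t) * (lam * q)) y) (fun _ => 1) g) := by
  obtain ⟨A, hD⟩ := exists_pathData hB hν h₁ h₂ h₁ h₂ (measurable_spikeTerm _ _ y)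
    (measurable_spikeTerm _ _ y) (hν.mono fun x hx => abs_spikeTerm_le hB h₁ h₂ hx hy)
    (hν.mono fun x hx => abs_spikeTerm_le hB h₁ h₂ hx hy)
  have hc : ∀ k, |√(noiseVar N (t * lam / N) ((1 - t) * (lam * q)) k)| ≤ A := fun k => by
    rw [abs_of_nonneg (Real.sqrt_nonneg _)]
    exact Real.sqrt_le_iff.2 ⟨hD.nonneg, hD.v₀_le k⟩
  have hi := integrable_tilt hD.toTiltData hc hD.meas₀ hD.bound₀ (f := fun _ => 1)
    measurable_const (M := 1) (by simp) g
  rw [tiltInt, ofReal_integral_eq_lintegral_ofReal hi (ae_of_all _ fun x => by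
    simp only [one_mul]; exact (Real.exp_pos _).le)]
  refine lintegral_congr fun x => ?_
  rw [negH_eq_tiltExp h₁ h₂, one_mul]

/-- The moment of order `s` of the partition function restricted to an overlap window. The parameter
`σ` is the Chernoff tilt with respect to the overlap with the spike. -/
lemma lintegral_restrictedZ_rpow_le (hP : ∀ᵐ x ∂P, |x| ≤ B) (hB : 0 ≤ B) (hN : 1 ≤ N)
    {lam q t ε m s σ C r rbar : ℝ} (hlam : 0 ≤ lam) (hq : 0 ≤ q) (ht : t ∈ Set.Icc (0:ℝ) 1)
    (hs : 0 < s) (hs1 : s ≤ 1) (hr : r = (1 - t) * lam * q + t * lam * |m|)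
    (hrbar : rbar = (1 - t) * lam * q + t * lam * m)
    (hC : ∫⁻ w, ENNReal.ofReal (chanZ P r (rbar + σ) w ^ s) ∂(P.prod (gaussianReal 0 1)) ≤
      ENNReal.ofReal (Real.exp (s * psiBar P r (rbar + σ) + C * s ^ 2))) :
    ∫⁻ d, restrictedZ P lam q t ε m d ^ s ∂(disorderLaw P N) ≤
      ENNReal.ofReal (Real.exp (s * N * (psiBar P r (rbar + σ) - σ * m + |σ| * ε
        - t * lam * m ^ 2 / 4 + t * lam * ε ^ 2 / 2) + s * (t * lam * B ^ 4 / 4)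
        + C * s ^ 2 * N)) := by
  have hN' : (0:ℝ) < N := by exact_mod_cast hN
  obtain ⟨ht0, ht1⟩ := ht
  have hκ : 0 ≤ t * lam := mul_nonneg ht0 hlam
  have h₁ : 0 ≤ t * lam / N := by positivity
  have h₂ : 0 ≤ (1 - t) * (lam * q) := mul_nonneg (by linarith) (by positivity)
  have hr0 : 0 ≤ r := by
    rw [hr]
    have := abs_nonneg m
    have := sub_nonneg.2 ht1
    positivity
  set D := t * lam * (-(N * m ^ 2) / 4 + N * ε ^ 2 / 2 + B ^ 4 / 4) with hDdef
  set E := |σ| * ε * N - σ * (N * m) with hEdef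
  have key : ∀ᵐ y ∂(priorN P N), ∫⁻ g : NoiseIndex N → ℝ, restrictedZ P lam q t ε m
      (y, (fun p => g (Sum.inl p)), fun i => g (Sum.inr i)) ^ s ∂(gaussPi (NoiseIndex N)) ≤
      ENNReal.ofReal (Real.exp (s * D + s * E)) * ∫⁻ g : NoiseIndex N → ℝ,
        ∏ i, ENNReal.ofReal (chanZ P r (rbar + σ) (y i, g (Sum.inr i)) ^ s)
        ∂(gaussPi (NoiseIndex N)) := by
    filter_upwards [ae_priorN hP] with y hy
    set ν := (priorN P N).restrict {x : Fin N → ℝ | overlap x y ∈ Set.Ico m (m + ε)} with hνdef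
    have hνB : ∀ᵐ x ∂ν, ∀ i, |x i| ≤ B := ae_restrict_of_ae (ae_priorN hP)
    have hνw : ∀ᵐ x ∂ν, overlap x y ∈ Set.Ico m (m + ε) :=
      ae_restrict_mem (measurableSet_window m ε y)
    have hZ : ∀ g : NoiseIndex N → ℝ, restrictedZ P lam q t ε m
        (y, (fun p => g (Sum.inl p)), fun i => g (Sum.inr i)) =
        ENNReal.ofReal (tiltInt ν (spinCoef N)
        (fun k => √(noiseVar N (t * lam / N) ((1 - t) * (lam * q)) k))
        (spikeTerm N (t * lam / N) ((1 - t) * (lam * q)) y) (fun _ => 1) g) := fun g =>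
      lintegral_exp_negH_eq hB hνB h₁ h₂ hy g
    by_cases hν0 : ν = 0
    · simp_rw [hZ]
      rw [hν0]
      simp [tiltInt, ENNReal.zero_rpow_of_pos hs]
    have hspike : ∀ x : Fin N → ℝ, spikeTerm N (t * lam / N) ((1 - t) * (lam * q)) y x =
        t * lam / N * (((∑ i, x i * y i) ^ 2 - ∑ i, (x i * y i) ^ 2) / 2) +
          (1 - t) * (lam * q) * ∑ i, x i * y i := fun x => sum_noiseVar_mul _ _ x y
    have hsum : ∀ x : Fin N → ℝ, (∀ i, |x i| ≤ B) → |∑ i, x i * y i| ≤ N * B ^ 2 := by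
      intro x hx
      refine (Finset.abs_sum_le_sum_abs _ _).trans ?_
      have : ∀ i ∈ Finset.univ, |x i * y i| ≤ B ^ 2 := fun i _ => by
        rw [abs_mul, sq]; gcongr; exacts [hx i, hy i]
      simpa using Finset.sum_le_card_nsmul _ _ _ this
    have hβ₀m : Measurable fun x : Fin N → ℝ => rbar * ∑ i, x i * y i := by fun_prop
    set D₀ := (∑ k, noiseVar N (t * lam / N) ((1 - t) * (lam * q)) k) * (B ^ 2 + B) ^ 2 +
      |rbar| * (N * B ^ 2) with hD₀
    have hD₀1 : ∀ᵐ x ∂ν, |spikeTerm N (t * lam / N) ((1 - t) * (lam * q)) y x| ≤ D₀ := by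
      filter_upwards [hνB] with x hx
      have := abs_spikeTerm_le hB h₁ h₂ hx hy
      have h5 : 0 ≤ |rbar| * (N * B ^ 2) := by positivity
      linarith
    have hD₀0 : ∀ᵐ x ∂ν, |rbar * ∑ i, x i * y i| ≤ D₀ := by
      filter_upwards [hνB] with x hx
      rw [abs_mul]
      have h6 : 0 ≤ (∑ k, noiseVar N (t * lam / N) ((1 - t) * (lam * q)) k) * (B ^ 2 + B) ^ 2 :=
        mul_nonneg (Finset.sum_nonneg fun k _ => noiseVar_nonneg h₁ h₂ k) (sq_nonneg _)
      have := mul_le_mul_of_nonneg_left (hsum x hx) (abs_nonneg rbar)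
      linarith
    obtain ⟨A, hD⟩ := exists_pathData hB hνB le_rfl hr0 h₁ h₂ hβ₀m
      (measurable_spikeTerm _ _ y) hD₀0 hD₀1
    have hcmp := hD.lintegral_rpow_le hν0 hs hs1 (D := D) (by
      filter_upwards [hνB, hνw] with x hx hxw
      filter_upwards [hνB] with x' hx'
      simp_rw [noiseVar_sub]
      rw [sum_noiseVar_mul, hspike]
      have hw := window_bounds hN hxw
      have := interpolation_bracket_le (T := ∑ i, x i * x' i) (Q := ∑ i, (x i * y i) ^ 2)
        hN' hκ hs hs1
        (sum_sq_mul_le hx hx') (by positivity) (Finset.sum_nonneg fun i _ => sq_nonneg _)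
        hw.1 hw.2
      refine le_trans (le_of_eq ?_) this
      rw [hr, hrbar]
      ring)
    calc _ = ∫⁻ g, ENNReal.ofReal (tiltInt ν (spinCoef N)
        (fun k => √(noiseVar N (t * lam / N) ((1 - t) * (lam * q)) k))
        (spikeTerm N (t * lam / N) ((1 - t) * (lam * q)) y) (fun _ => 1) g ^ s)
          ∂(gaussPi (NoiseIndex N)) := by
          refine lintegral_congr fun g => ?_
          rw [hZ, ENNReal.ofReal_rpow_of_nonneg _ hs.le]
          refine integral_nonneg fun x => ?_
          simp only [one_mul]
          exact (Real.exp_pos _).le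
      _ ≤ _ := hcmp
      _ ≤ ENNReal.ofReal (Real.exp (s * D)) * ∫⁻ g : NoiseIndex N → ℝ,
          ENNReal.ofReal (Real.exp (s * E)) *
          ∏ i, ENNReal.ofReal (chanZ P r (rbar + σ) (y i, g (Sum.inr i)) ^ s)
          ∂(gaussPi (NoiseIndex N)) := by
          gcongr with g
          rw [← ENNReal.ofReal_prod_of_nonneg fun i _ => Real.rpow_nonneg (chanZ_pos hP _ _ _).le _,
            ← ENNReal.ofReal_mul (Real.exp_pos _).le]
          refine ENNReal.ofReal_le_ofReal ?_
          rw [Real.finsetProd_rpow _ _ fun i _ => (chanZ_pos hP _ _ _).le, mul_comm s E,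
            Real.exp_mul, ← Real.mul_rpow (Real.exp_pos _).le
            (Finset.prod_nonneg fun i _ => (chanZ_pos hP _ _ _).le)]
          refine Real.rpow_le_rpow ?_ ?_ hs.le
          · refine integral_nonneg fun x => ?_
            simp only [one_mul]
            exact (Real.exp_pos _).le
          rw [← integral_exp_sum_chanExp, ← integral_const_mul]
          have hInt : Integrable (fun x => Real.exp E * Real.exp
              (∑ i, chanExp r (rbar + σ) (y i, g (Sum.inr i)) (x i))) (priorN P N) := by
            refine Integrable.const_mul ?_ _
            simp_rw [Real.exp_sum]
            exact Integrable.fintype_prod (μ := fun _ : Fin N => P) fun i =>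
              integrable_exp_chanExp hP _ _ _
          calc _ ≤ ∫ x, Real.exp E * Real.exp
                  (∑ i, chanExp r (rbar + σ) (y i, g (Sum.inr i)) (x i)) ∂ν := by
                refine integral_mono_of_nonneg (ae_of_all _ fun x => ?_)
                  (hInt.mono_measure Measure.restrict_le_self) ?_
                · simp only [one_mul]
                  exact (Real.exp_pos _).le
                · filter_upwards [hνw] with x hx
                  rw [one_mul, tiltExp_side hr0, ← Real.exp_add]
                  refine Real.exp_le_exp.2 ?_
                  have h7 : ∑ i, chanExp r (rbar + σ) (y i, g (Sum.inr i)) (x i) =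
                      ∑ i, chanExp r rbar (y i, g (Sum.inr i)) (x i) + σ * ∑ i, x i * y i := by
                    rw [Finset.mul_sum, ← Finset.sum_add_distrib]
                    refine Finset.sum_congr rfl fun i _ => ?_
                    unfold chanExp
                    ring
                  rw [h7]
                  obtain ⟨hw1, hw2⟩ := window_bounds hN hx
                  have h8 : |σ * (∑ i, x i * y i - N * m)| ≤ |σ| * ε * N := by
                    rw [abs_mul, abs_of_nonneg (by linarith : 0 ≤ ∑ i, x i * y i - N * m),
                      mul_assoc]
                    gcongr
                    linarith
                  have := (abs_le.1 h8).1
                  rw [hEdef]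
                  linarith
            _ ≤ _ := by
                refine integral_mono_measure Measure.restrict_le_self
                  (ae_of_all _ fun x => ?_) hInt
                simp only [Pi.zero_apply]
                positivity
      _ = _ := by
          rw [lintegral_const_mul', ← mul_assoc, ← ENNReal.ofReal_mul (Real.exp_pos _).le,
            ← Real.exp_add]
          exact ENNReal.ofReal_ne_top
  rw [lintegral_disorderLaw ((measurable_restrictedZ lam q t ε m).pow_const s)]
  refine (lintegral_mono_ae key).trans ?_
  rw [lintegral_const_mul' _ _ ENNReal.ofReal_ne_top, lintegral_prod_chanZ_rpow]
  refine (mul_le_mul_right (pow_le_pow_left₀ zero_le hC N) _).trans_eq ?_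
  rw [← ENNReal.ofReal_pow (Real.exp_pos _).le, ← Real.exp_nat_mul,
    ← ENNReal.ofReal_mul (Real.exp_pos _).le, ← Real.exp_add]
  congr 2
  rw [hDdef, hEdef]
  ring

end SpikedWigner

namespace SpikedWigner

/-! ### Negative moments of the full partition function -/

variable {N : ℕ} {P : Measure ℝ} [IsProbabilityMeasure P] {B : ℝ}

/-- The partition function of the null model as a function of the observation `g`. It is the density
of the law of the observation in the planted model with respect to the Gaussian measure. -/
noncomputable def nullZ (P : Measure ℝ) (N : ℕ) (α τ : ℝ) (g : NoiseIndex N → ℝ) : ℝ :=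
  tiltInt (priorN P N) (spinCoef N) (fun k => √(noiseVar N α τ k)) (fun _ => 0) (fun _ => 1) g

lemma tiltExp_spikeTerm {α τ : ℝ} (hα : 0 ≤ α) (hτ : 0 ≤ τ) (y x : Fin N → ℝ)
    (g : NoiseIndex N → ℝ) :
    tiltExp (spinCoef N) (fun k => √(noiseVar N α τ k)) (spikeTerm N α τ y) g x =
      tiltExp (spinCoef N) (fun k => √(noiseVar N α τ k)) (fun _ => 0)
        (g + fun k => √(noiseVar N α τ k) * spinCoef N k y) x := by
  unfold tiltExp spikeTerm
  rw [add_zero, ← Finset.sum_add_distrib]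
  refine Finset.sum_congr rfl fun k _ => ?_
  have := Real.mul_self_sqrt (noiseVar_nonneg (N := N) hα hτ k)
  simp only [Pi.add_apply]
  linear_combination (-(spinCoef N k x * spinCoef N k y)) * this

lemma measurable_nullZ (α τ : ℝ) : Measurable (nullZ P N α τ) :=
  measurable_tiltInt measurable_spinCoef measurable_const measurable_const _

lemma exists_pathData_null (hP : ∀ᵐ x ∂P, |x| ≤ B) (hB : 0 ≤ B) {α₀ τ₀ α τ : ℝ} (hα₀ : 0 ≤ α₀)
    (hτ₀ : 0 ≤ τ₀) (hα : 0 ≤ α) (hτ : 0 ≤ τ) :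
    ∃ A, PathData (priorN P N) (spinCoef N) (noiseVar N α₀ τ₀) (noiseVar N α τ)
      (fun _ => 0) (fun _ => 0) A :=
  exists_pathData hB (ae_priorN hP) hα₀ hτ₀ hα hτ measurable_const measurable_const (D := 0)
    (by simp) (by simp)

lemma integrable_nullZ (hP : ∀ᵐ x ∂P, |x| ≤ B) (hB : 0 ≤ B) {α τ : ℝ} (hα : 0 ≤ α)
    (hτ : 0 ≤ τ) (g : NoiseIndex N → ℝ) :
    Integrable (fun x => 1 * Real.exp (tiltExp (spinCoef N) (fun k => √(noiseVar N α τ k))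
      (fun _ => 0) g x)) (priorN P N) := by
  obtain ⟨A, hD⟩ := exists_pathData_null (N := N) hP hB hα hτ hα hτ
  exact integrable_tilt hD.toTiltData (fun k => by
    rw [abs_of_nonneg (Real.sqrt_nonneg _)]
    exact Real.sqrt_le_iff.2 ⟨hD.nonneg, hD.v₀_le k⟩) hD.meas₀ hD.bound₀ (f := fun _ => 1)
    measurable_const (M := 1) (by simp) g

lemma nullZ_pos (hP : ∀ᵐ x ∂P, |x| ≤ B) (hB : 0 ≤ B) {α τ : ℝ} (hα : 0 ≤ α)
    (hτ : 0 ≤ τ) (g : NoiseIndex N → ℝ) : 0 < nullZ P N α τ g := by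
  obtain ⟨A, hD⟩ := exists_pathData_null (N := N) hP hB hα hτ hα hτ
  exact tiltInt_one_pos (IsProbabilityMeasure.ne_zero _) hD.toTiltData (fun k => by
    rw [abs_of_nonneg (Real.sqrt_nonneg _)]
    exact Real.sqrt_le_iff.2 ⟨hD.nonneg, hD.v₀_le k⟩) hD.meas₀ hD.bound₀ g

lemma fullZ_eq_nullZ (hP : ∀ᵐ x ∂P, |x| ≤ B) (hB : 0 ≤ B) {lam q t : ℝ}
    (h₁ : 0 ≤ t * lam / N) (h₂ : 0 ≤ (1 - t) * (lam * q)) {y : Fin N → ℝ} (hy : ∀ i, |y i| ≤ B)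
    (g : NoiseIndex N → ℝ) :
    fullZ P lam q t (y, (fun p => g (Sum.inl p)), fun i => g (Sum.inr i)) =
      ENNReal.ofReal (nullZ P N (t * lam / N) ((1 - t) * (lam * q))
        (g + fun k => √(noiseVar N (t * lam / N) ((1 - t) * (lam * q)) k) * spinCoef N k y)) := by
  rw [fullZ, lintegral_exp_negH_eq hB (ae_priorN hP) h₁ h₂ hy, nullZ, tiltInt, tiltInt]
  simp_rw [tiltExp_spikeTerm h₁ h₂]

/-- Bayes' rule: the negative moments in the planted model are moments of order less than one in
the null model. -/
lemma lintegral_fullZ_rpow_neg_eq (hP : ∀ᵐ x ∂P, |x| ≤ B) (hB : 0 ≤ B) {lam q t s : ℝ}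
    (h₁ : 0 ≤ t * lam / N) (h₂ : 0 ≤ (1 - t) * (lam * q)) :
    ∫⁻ d, fullZ P lam q t d ^ (-s) ∂(disorderLaw P N) = ∫⁻ g, ENNReal.ofReal
      (nullZ P N (t * lam / N) ((1 - t) * (lam * q)) g ^ (1 - s)) ∂(gaussPi (NoiseIndex N)) := by
  set c : NoiseIndex N → ℝ := fun k => √(noiseVar N (t * lam / N) ((1 - t) * (lam * q)) k) with hc
  have hm : Measurable fun g =>
      ENNReal.ofReal (nullZ P N (t * lam / N) ((1 - t) * (lam * q)) g) ^ (-s) :=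
    (measurable_nullZ _ _).ennreal_ofReal.pow_const _
  rw [lintegral_disorderLaw ((measurable_fullZ lam q t).pow_const _)]
  calc _ = ∫⁻ y, ∫⁻ g, ENNReal.ofReal (Real.exp (tiltExp (spinCoef N) c (fun _ => 0) g y)) *
        ENNReal.ofReal (nullZ P N (t * lam / N) ((1 - t) * (lam * q)) g) ^ (-s)
          ∂(gaussPi (NoiseIndex N)) ∂(priorN P N) := by
        refine lintegral_congr_ae ((ae_priorN hP).mono fun y hy => ?_)
        dsimp only
        simp_rw [fullZ_eq_nullZ hP hB h₁ h₂ hy]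
        rw [lintegral_gaussPi_add _ hm]
        refine lintegral_congr fun g => ?_
        congr 4
        rw [tiltExp, add_zero]
        refine Finset.sum_congr rfl fun k _ => ?_
        rw [hc]
        ring
    _ = ∫⁻ g, ∫⁻ y, ENNReal.ofReal (Real.exp (tiltExp (spinCoef N) c (fun _ => 0) g y)) *
        ENNReal.ofReal (nullZ P N (t * lam / N) ((1 - t) * (lam * q)) g) ^ (-s)
          ∂(priorN P N) ∂(gaussPi (NoiseIndex N)) := by
        refine lintegral_lintegral_swap (Measurable.aemeasurable ?_)
        have h3 := measurable_tiltExp (ι := NoiseIndex N) (a := spinCoef N) measurable_spinCoef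
          (measurable_const (a := (0:ℝ))) c
        have h4 : Measurable fun p : (Fin N → ℝ) × (NoiseIndex N → ℝ) =>
            tiltExp (spinCoef N) c (fun _ => 0) p.2 p.1 := h3.comp measurable_swap
        exact (Real.measurable_exp.comp h4).ennreal_ofReal.mul (hm.comp measurable_snd)
    _ = _ := by
        refine lintegral_congr fun g => ?_
        have hpos := nullZ_pos (N := N) hP hB h₁ h₂ g
        rw [lintegral_mul_const'' _ (Measurable.aemeasurable ?_)]
        · have h5 : ∫⁻ y, ENNReal.ofReal (Real.exp (tiltExp (spinCoef N) c (fun _ => 0) g y))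
              ∂(priorN P N) =
              ENNReal.ofReal (nullZ P N (t * lam / N) ((1 - t) * (lam * q)) g) := by
            rw [nullZ, tiltInt, ofReal_integral_eq_lintegral_ofReal
              (integrable_nullZ hP hB h₁ h₂ g) (ae_of_all _ fun x => by
                simp only [one_mul]; exact (Real.exp_pos _).le)]
            simp only [one_mul, hc]
          rw [h5, ENNReal.ofReal_rpow_of_pos hpos, ← ENNReal.ofReal_mul hpos.le,
            sub_eq_add_neg 1 s, Real.rpow_add hpos, Real.rpow_one]
        · exact (Real.measurable_exp.comp (measurable_tiltExp_right measurable_spinCoef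
            measurable_const c g)).ennreal_ofReal

lemma lintegral_chanZ_zero_rpow (hP : ∀ᵐ x ∂P, |x| ≤ B) {r : ℝ} (hr : 0 ≤ r) (s : ℝ) :
    ∫⁻ w, ENNReal.ofReal (chanZ P r 0 w ^ (1 - s)) ∂(P.prod (gaussianReal 0 1)) =
      ∫⁻ w, ENNReal.ofReal (chanZ P r r w ^ (-s)) ∂(P.prod (gaussianReal 0 1)) := by
  have hm : ∀ p : ℝ, Measurable fun z => ENNReal.ofReal (obsDensity P r z ^ p) := fun p =>
    ((measurable_obsDensity r).pow_const p).ennreal_ofReal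
  have h0 : ∀ w : ℝ × ℝ, chanZ P r 0 w = obsDensity P r w.2 := by
    intro w
    simp [obsDensity, chanZ, chanExp]
  simp_rw [chanZ_diag P hr, h0]
  have h1 := lintegral_map (μ := P.prod (gaussianReal 0 1)) (hm (-s))
    (by fun_prop : Measurable fun w : ℝ × ℝ => w.2 + √r * w.1)
  have h2 := lintegral_map (μ := P.prod (gaussianReal 0 1)) (hm (1 - s)) measurable_snd
  rw [← h1, ← h2, map_observation hP hr, ← Measure.snd, Measure.snd_prod,
    lintegral_withDensity_eq_lintegral_mul _ (measurable_obsDensity r).ennreal_ofReal (hm _)]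
  refine lintegral_congr fun z => ?_
  have hpos := obsDensity_pos hP r z
  rw [Pi.mul_apply, ← ENNReal.ofReal_mul hpos.le, sub_eq_add_neg, Real.rpow_add hpos,
    Real.rpow_one]

/-- The moment of order `-s` of the partition function is governed by the replica-symmetric
potential at `q`. -/
lemma lintegral_fullZ_rpow_neg_le (hP : ∀ᵐ x ∂P, |x| ≤ B) (hB : 0 ≤ B) (hN : 1 ≤ N)
    {lam q t s C : ℝ} (hlam : 0 ≤ lam) (hq : 0 ≤ q) (ht : t ∈ Set.Icc (0:ℝ) 1)
    (hs : 0 < s) (hs1 : s < 1)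
    (hC : ∫⁻ w, ENNReal.ofReal (chanZ P (lam * q) (lam * q) w ^ (-s))
      ∂(P.prod (gaussianReal 0 1)) ≤
      ENNReal.ofReal (Real.exp (-s * psi P (lam * q) + C * s ^ 2))) :
    ∫⁻ d, fullZ P lam q t d ^ (-s) ∂(disorderLaw P N) ≤
      ENNReal.ofReal (Real.exp (-s * N * (psi P (lam * q) - t * lam * q ^ 2 / 4)
        + s * (t * lam * B ^ 4 / 4) + C * s ^ 2 * N)) := by
  have hN' : (0:ℝ) < N := by exact_mod_cast hN
  obtain ⟨ht0, ht1⟩ := ht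
  have hκ : 0 ≤ t * lam := mul_nonneg ht0 hlam
  have h₁ : 0 ≤ t * lam / N := by positivity
  have hr : 0 ≤ lam * q := by positivity
  have h₂ : 0 ≤ (1 - t) * (lam * q) := mul_nonneg (by linarith) hr
  rw [lintegral_fullZ_rpow_neg_eq hP hB h₁ h₂]
  obtain ⟨A, hD⟩ := exists_pathData_null (N := N) hP hB le_rfl hr h₁ h₂
  set D := t * lam * s * (N * q ^ 2 / 4 + B ^ 4 / 4) with hDdef
  have hcmp := hD.lintegral_rpow_le (IsProbabilityMeasure.ne_zero _) (p := 1 - s)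
    (by linarith) (by linarith) (D := D) (by
      filter_upwards [ae_priorN hP] with x hx
      filter_upwards [ae_priorN hP] with x' hx'
      simp_rw [noiseVar_sub]
      rw [sum_noiseVar_mul]
      have hQ := sum_sq_mul_le hx hx'
      set T := ∑ i, x i * x' i
      set Q := ∑ i, (x i * x' i) ^ 2
      have h3 : D - ((1 - s - 1) / 2 * ((t * lam / N - 0) * ((T ^ 2 - Q) / 2) +
          ((1 - t) * (lam * q) - lam * q) * T) + (0 - 0)) =
          s / 2 * (t * lam / (2 * N)) * ((T - N * q) ^ 2 + (N * B ^ 4 - Q)) := by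
        rw [hDdef]; field_simp; ring
      have h4 : 0 ≤ s / 2 * (t * lam / (2 * N)) * ((T - N * q) ^ 2 + (N * B ^ 4 - Q)) := by
        have := sub_nonneg.2 hQ
        positivity
      linarith)
  refine (hcmp.trans (mul_le_mul_right
    (c := ENNReal.ofReal (Real.exp (-s * psi P (lam * q) + C * s ^ 2)) ^ N) ?_ _)).trans ?_
  · have h5 : ∀ (y : Fin N → ℝ) (g : NoiseIndex N → ℝ),
        ENNReal.ofReal (tiltInt (priorN P N) (spinCoef N)
          (fun k => √(noiseVar N 0 (lam * q) k)) (fun _ => 0) (fun _ => 1) g ^ (1 - s)) =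
        ∏ i, ENNReal.ofReal (chanZ P (lam * q) 0 (y i, g (Sum.inr i)) ^ (1 - s)) := by
      intro y g
      have h6 : (fun _ : Fin N → ℝ => (0:ℝ)) = fun x => 0 * ∑ i, x i * y i := by
        ext x; rw [zero_mul]
      rw [← ENNReal.ofReal_prod_of_nonneg fun i _ => Real.rpow_nonneg (chanZ_pos hP _ _ _).le _,
        Real.finsetProd_rpow _ _ fun i _ => (chanZ_pos hP _ _ _).le, ← integral_exp_sum_chanExp,
        tiltInt, h6]
      simp_rw [tiltExp_side hr, one_mul]
    have h7 : ∫⁻ g, ENNReal.ofReal (tiltInt (priorN P N) (spinCoef N)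
          (fun k => √(noiseVar N 0 (lam * q) k)) (fun _ => 0) (fun _ => 1) g ^ (1 - s))
          ∂(gaussPi (NoiseIndex N)) = ∫⁻ y, ∫⁻ g : NoiseIndex N → ℝ,
          ∏ i, ENNReal.ofReal (chanZ P (lam * q) 0 (y i, g (Sum.inr i)) ^ (1 - s))
          ∂(gaussPi (NoiseIndex N)) ∂(priorN P N) := by
      simp_rw [← h5]
      simp
    rw [h7, lintegral_prod_chanZ_rpow, lintegral_chanZ_zero_rpow hP hr]
    exact pow_le_pow_left₀ zero_le hC N
  · rw [← ENNReal.ofReal_pow (Real.exp_pos _).le, ← Real.exp_nat_mul,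
      ← ENNReal.ofReal_mul (Real.exp_pos _).le, ← Real.exp_add]
    refine ENNReal.ofReal_le_ofReal (Real.exp_le_exp.2 ?_)
    have h8 : 0 ≤ s * D := by positivity
    have h9 : (1 - s) * D ≤ D := by linarith
    refine (add_le_add_left h9 _).trans_eq ?_
    rw [hDdef]
    ring

end SpikedWigner

namespace SpikedWigner

/-! ### The bound on the free energy at fixed overlap -/

/-- The tangent line to the exponential, in extended nonnegative form: `log z` is bounded by an
affine function of `z ^ s`. -/
lemma toENNReal_log_add_le (z : ENNReal) {s : ℝ} (hs : 0 < s) (L : ℝ) :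
    (ENNReal.log z).toENNReal + (ENNReal.ofReal (-L) + ENNReal.ofReal (1 / s)) ≤
      (-ENNReal.log z).toENNReal +
        (ENNReal.ofReal L + ENNReal.ofReal (Real.exp (-(s * L)) / s) * z ^ s) := by
  have hc : 0 < Real.exp (-(s * L)) / s := div_pos (Real.exp_pos _) hs
  rcases eq_or_ne z 0 with rfl | h0
  · simp
  rcases eq_or_ne z ⊤ with rfl | ht
  · simp [ENNReal.top_rpow_of_pos hs, ENNReal.mul_top, hc]
  obtain ⟨x, hx, rfl⟩ : ∃ x : ℝ, 0 < x ∧ ENNReal.ofReal x = z :=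
    ⟨z.toReal, ENNReal.toReal_pos h0 ht, ENNReal.ofReal_toReal ht⟩
  rw [ENNReal.log_ofReal_of_pos hx, ENNReal.ofReal_rpow_of_pos hx, ← ENNReal.ofReal_mul hc.le,
    ← EReal.coe_neg, EReal.real_coe_toENNReal, EReal.real_coe_toENNReal]
  set l := Real.log x with hl
  have hxs : x ^ s = Real.exp (s * l) := by rw [Real.rpow_def_of_pos hx, mul_comm]
  have h1 : l - L + 1 / s ≤ Real.exp (-(s * L)) / s * x ^ s := by
    rw [hxs, div_mul_eq_mul_div, ← Real.exp_add, le_div_iff₀ hs]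
    have := Real.add_one_le_exp (-(s * L) + s * l)
    have h2 : (l - L + 1 / s) * s = -(s * L) + s * l + 1 := by field_simp; ring
    rwa [h2]
  have e : ∀ a b c : ℝ, ENNReal.ofReal a + (ENNReal.ofReal b + ENNReal.ofReal c) =
      ENNReal.ofReal (max a 0 + (max b 0 + max c 0)) := by
    intro a b c
    rw [ENNReal.ofReal_add (le_max_right _ _) (by positivity),
      ENNReal.ofReal_add (le_max_right _ _) (le_max_right _ _)]
    simp [ENNReal.ofReal_max]
  rw [e, e]
  refine ENNReal.ofReal_le_ofReal ?_
  rw [max_eq_left (by positivity : 0 ≤ 1 / s),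
    max_eq_left (by positivity : 0 ≤ Real.exp (-(s * L)) / s * x ^ s)]
  have a1 : max l 0 - max (-l) 0 = l := max_zero_sub_max_neg_zero_eq_self l
  have a2 : max L 0 - max (-L) 0 = L := max_zero_sub_max_neg_zero_eq_self L
  linarith

/-- The expected logarithm is controlled by any fractional moment. -/
lemma eexpect_log_le {Ω : Type*} [MeasurableSpace Ω] {μ : Measure Ω} [IsProbabilityMeasure μ]
    {Z : Ω → ENNReal} (hZ : Measurable Z) {s L : ℝ} (hs : 0 < s)
    (h : ∫⁻ w, Z w ^ s ∂μ ≤ ENNReal.ofReal (Real.exp (s * L))) :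
    eexpect μ (fun w => ENNReal.log (Z w)) ≤ (L : EReal) := by
  unfold eexpect
  set U := ∫⁻ w, (ENNReal.log (Z w)).toENNReal ∂μ
  set V := ∫⁻ w, (-ENNReal.log (Z w)).toENNReal ∂μ
  have h1 : U + (ENNReal.ofReal (-L) + ENNReal.ofReal (1 / s)) ≤
      V + (ENNReal.ofReal L + ENNReal.ofReal (1 / s)) := by
    calc U + (ENNReal.ofReal (-L) + ENNReal.ofReal (1 / s))
        = ∫⁻ w, ((ENNReal.log (Z w)).toENNReal +
            (ENNReal.ofReal (-L) + ENNReal.ofReal (1 / s))) ∂μ := by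
          rw [lintegral_add_right _ measurable_const]; simp [U]
      _ ≤ ∫⁻ w, ((-ENNReal.log (Z w)).toENNReal + (ENNReal.ofReal L +
            ENNReal.ofReal (Real.exp (-(s * L)) / s) * Z w ^ s)) ∂μ :=
          lintegral_mono fun w => toENNReal_log_add_le (Z w) hs L
      _ = V + (ENNReal.ofReal L + ENNReal.ofReal (Real.exp (-(s * L)) / s) *
            ∫⁻ w, Z w ^ s ∂μ) := by
          have hm : Measurable fun w => Z w ^ s := hZ.pow_const s
          rw [lintegral_add_right _ (by fun_prop),
            lintegral_add_right _ (hm.const_mul _), lintegral_const_mul _ hm]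
          simp [V]
      _ ≤ V + (ENNReal.ofReal L + ENNReal.ofReal (Real.exp (-(s * L)) / s) *
            ENNReal.ofReal (Real.exp (s * L))) := by gcongr
      _ = _ := by
          rw [← ENNReal.ofReal_mul (by positivity), div_mul_eq_mul_div, ← Real.exp_add,
            neg_add_cancel, Real.exp_zero]
  rw [← add_assoc, ← add_assoc, ENNReal.add_le_add_iff_right ENNReal.ofReal_ne_top] at h1
  by_cases hV : V = ⊤
  · rw [hV]
    simp
  have hU : U ≠ ⊤ := ne_top_of_le_ne_top
    (ENNReal.add_ne_top.2 ⟨hV, ENNReal.ofReal_ne_top⟩) (le_self_add.trans h1)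
  have h2 := (ENNReal.toReal_le_toReal (ENNReal.add_ne_top.2 ⟨hU, ENNReal.ofReal_ne_top⟩)
    (ENNReal.add_ne_top.2 ⟨hV, ENNReal.ofReal_ne_top⟩)).2 h1
  rw [ENNReal.toReal_add hU ENNReal.ofReal_ne_top, ENNReal.toReal_add hV ENNReal.ofReal_ne_top,
    ENNReal.toReal_ofReal', ENNReal.toReal_ofReal'] at h2
  have a2 : max L 0 - max (-L) 0 = L := max_zero_sub_max_neg_zero_eq_self L
  rw [← ENNReal.ofReal_toReal hU, ← ENNReal.ofReal_toReal hV,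
    EReal.coe_ennreal_ofReal, EReal.coe_ennreal_ofReal, max_eq_left ENNReal.toReal_nonneg,
    max_eq_left ENNReal.toReal_nonneg, ← EReal.coe_sub, EReal.coe_le_coe_iff]
  linarith

variable {N : ℕ} {P : Measure ℝ} [IsProbabilityMeasure P] {B : ℝ}

lemma franzParisi_le_of_moment (hN : 1 ≤ N) {lam q t ε m s a : ℝ} (hs : 0 < s)
    (h : ∫⁻ d, restrictedZ P lam q t ε m d ^ s ∂(disorderLaw P N) ≤
      ENNReal.ofReal (Real.exp (s * (N * a)))) :
    franzParisi P N lam q t ε m ≤ (a : EReal) := by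
  have hN' : (0:ℝ) < N := by exact_mod_cast hN
  have h1 := eexpect_log_le (measurable_restrictedZ lam q t ε m) hs h
  have h2 : (0 : EReal) ≤ ((1 / (N:ℝ) : ℝ) : EReal) := by exact_mod_cast (by positivity)
  refine (mul_le_mul_of_nonneg_left h1 h2).trans_eq ?_
  rw [← EReal.coe_mul]
  congr 1
  field_simp

/-- The moment bound with an optimized Chernoff tilt. -/
lemma exists_lintegral_restrictedZ_rpow_le (hP : ∀ᵐ x ∂P, |x| ≤ B) (hB : 1 ≤ B) (R : ℝ) :
    ∃ C : ℝ, 0 ≤ C ∧ ∀ N : ℕ, 1 ≤ N → ∀ lam q t ε m s r rbar : ℝ, 0 ≤ lam → 0 ≤ q →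
      t ∈ Set.Icc (0:ℝ) 1 → 0 ≤ ε → 0 < s → s ≤ 1 → r = (1 - t) * lam * q + t * lam * |m| →
      rbar = (1 - t) * lam * q + t * lam * m → |r| + |m| + B ^ 2 ≤ R →
      ∫⁻ d, restrictedZ P lam q t ε m d ^ s ∂(disorderLaw P N) ≤
        ENNReal.ofReal (Real.exp (s * N * (psiBar P r rbar - t * lam * m ^ 2 / 4
          - 1 / (4 * B ^ 4) * (m - chanOverlap P r rbar) ^ 2 + (1 + lam) * ε ^ 2)
          + s * (lam * B ^ 4 / 4) + C * s ^ 2 * N)) := by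
  obtain ⟨C, hC, hbound⟩ := exists_rpow_chanZ_bound hP R
  refine ⟨C, hC, fun N hN lam q t ε m s r rbar hlam hq ht hε hs hs1 hr hrbar hR => ?_⟩
  have hB0 : 0 ≤ B := by linarith
  have hB4 : 1 ≤ B ^ 4 := one_le_pow₀ hB
  have hN' : (0:ℝ) < N := by exact_mod_cast hN
  set D := chanOverlap P r rbar with hD
  set σ := (m - D) / (2 * B ^ 4) with hσ
  have hD2 : |D| ≤ B ^ 2 := abs_chanOverlap_le hP r rbar
  have ht' := sub_nonneg.2 ht.2
  have hκ : 0 ≤ t * lam := mul_nonneg ht.1 hlam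
  have hle : |rbar| ≤ |r| := by
    have h0 : 0 ≤ (1 - t) * lam * q := by positivity
    have h1 : 0 ≤ t * lam * |m| := by positivity
    rw [abs_of_nonneg (by rw [hr]; linarith : 0 ≤ r), hr, hrbar]
    calc _ ≤ |(1 - t) * lam * q| + |t * lam * m| := abs_add_le _ _
      _ = _ := by rw [abs_of_nonneg h0, abs_mul, abs_of_nonneg hκ]
  have hσle : |σ| ≤ |m| + B ^ 2 := by
    rw [hσ, abs_div, abs_of_pos (by positivity : 0 < 2 * B ^ 4)]
    refine (div_le_self (abs_nonneg _) (by linarith)).trans ?_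
    linarith [abs_sub m D]
  have hm := lintegral_restrictedZ_rpow_le hP hB0 hN (C := C) (σ := σ) (ε := ε) hlam hq ht hs hs1
    hr hrbar (hbound r (rbar + σ) (by linarith [abs_nonneg m, sq_nonneg B])
      ((abs_add_le _ _).trans (by linarith)) s (by rw [abs_of_pos hs]; exact hs1))
  refine hm.trans (ENNReal.ofReal_le_ofReal (Real.exp_le_exp.2 ?_))
  have hpsi := (psiBar_add_bounds hP r rbar σ).2
  have hmD : m - D = 2 * B ^ 4 * σ := by rw [hσ]; field_simp
  have hsq : 1 / (4 * B ^ 4) * (m - D) ^ 2 = σ ^ 2 * B ^ 4 := by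
    rw [hmD]; field_simp; ring
  have hcross : |σ| * ε ≤ σ ^ 2 * B ^ 4 / 2 + ε ^ 2 / 2 := by
    rw [← sq_abs σ]
    nlinarith [sq_nonneg (|σ| - ε), sq_nonneg (|σ|)]
  have hκε : t * lam * ε ^ 2 / 2 ≤ lam * ε ^ 2 / 2 := by
    have : t * lam ≤ lam := by nlinarith [ht.2]
    gcongr
  have hκB : t * lam * B ^ 4 / 4 ≤ lam * B ^ 4 / 4 := by
    have : t * lam ≤ lam := by nlinarith [ht.2]
    gcongr
  have main : psiBar P r (rbar + σ) - σ * m + |σ| * ε - t * lam * m ^ 2 / 4 + t * lam * ε ^ 2 / 2 ≤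
      psiBar P r rbar - t * lam * m ^ 2 / 4 - 1 / (4 * B ^ 4) * (m - D) ^ 2
        + (1 + lam) * ε ^ 2 := by
    rw [hsq]
    have h3 : σ * m = σ * D + 2 * (σ ^ 2 * B ^ 4) := by
      have : m = D + 2 * B ^ 4 * σ := by linarith
      rw [this]; ring
    have h4 : 0 ≤ lam * ε ^ 2 := by positivity
    linarith [sq_nonneg ε, hpsi]
  have h5 := mul_le_mul_of_nonneg_left main (by positivity : 0 ≤ s * N)
  have h6 := mul_le_mul_of_nonneg_left hκB hs.le
  linarith

lemma franzParisi_le (hP : ∀ᵐ x ∂P, |x| ≤ B) (hB : 1 ≤ B) (hN : 1 ≤ N)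
    {lam q t ε m r rbar : ℝ} (hlam : 0 ≤ lam) (hq : 0 ≤ q) (ht : t ∈ Set.Icc (0:ℝ) 1)
    (hε : 0 ≤ ε) (hr : r = (1 - t) * lam * q + t * lam * |m|)
    (hrbar : rbar = (1 - t) * lam * q + t * lam * m) :
    franzParisi P N lam q t ε m ≤ ((psiBar P r rbar - t * lam * m ^ 2 / 4
      - 1 / (4 * B ^ 4) * (m - chanOverlap P r rbar) ^ 2 + (1 + lam) * ε ^ 2
      + lam * B ^ 4 / 4 / N : ℝ) : EReal) := by
  have hN' : (0:ℝ) < N := by exact_mod_cast hN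
  obtain ⟨C, hC, hb⟩ := exists_lintegral_restrictedZ_rpow_le hP hB (|r| + |m| + B ^ 2)
  set a := psiBar P r rbar - t * lam * m ^ 2 / 4
      - 1 / (4 * B ^ 4) * (m - chanOverlap P r rbar) ^ 2 + (1 + lam) * ε ^ 2 with ha
  have key : ∀ s : ℝ, 0 < s → s ≤ 1 →
      franzParisi P N lam q t ε m ≤ ((a + lam * B ^ 4 / 4 / N + C * s : ℝ) : EReal) := by
    intro s hs hs1
    refine franzParisi_le_of_moment hN hs ((hb N hN lam q t ε m s r rbar hlam hq ht hε hs hs1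
      hr hrbar le_rfl).trans_eq ?_)
    rw [← ha]
    congr 2
    field_simp
  refine le_of_forall_gt_imp_ge_of_dense fun x hx => ?_
  obtain ⟨z, hz1, hz2⟩ := EReal.lt_iff_exists_real_btwn.1 hx
  rw [EReal.coe_lt_coe_iff] at hz1
  set δ := z - (a + lam * B ^ 4 / 4 / N) with hδ
  have hδ0 : 0 < δ := sub_pos.2 hz1
  refine ((key (min 1 (δ / (C + 1))) (lt_min one_pos (by positivity)) (min_le_left _ _)).trans
    ?_).trans hz2.le
  rw [EReal.coe_le_coe_iff]
  have h1 : C * min 1 (δ / (C + 1)) ≤ (C + 1) * (δ / (C + 1)) :=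
    mul_le_mul (by linarith) (min_le_right _ _) (le_min zero_le_one (by positivity)) (by positivity)
  rw [mul_div_cancel₀ _ (by positivity)] at h1
  linarith

end SpikedWigner

namespace SpikedWigner

/-! ### From gaps of the fixed-overlap bound to probabilities -/

variable {N : ℕ} {P : Measure ℝ} {B : ℝ}

/-- The exponential rate in the fixed-overlap bound at overlap `m`, relative to the lower bound
`ψ(λ q) - t λ q² / 4` on the free energy. -/
noncomputable def overlapGap (P : Measure ℝ) (B lam q t m : ℝ) : ℝ :=
  psiBar P ((1 - t) * lam * q + t * lam * |m|) ((1 - t) * lam * q + t * lam * m)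
    - t * lam * m ^ 2 / 4
    - 1 / (4 * B ^ 4) * (m - chanOverlap P ((1 - t) * lam * q + t * lam * |m|)
      ((1 - t) * lam * q + t * lam * m)) ^ 2
    - (psi P (lam * q) - t * lam * q ^ 2 / 4)

lemma abs_overlap_le (hN : 1 ≤ N) {x y : Fin N → ℝ} (hx : ∀ i, |x i| ≤ B) (hy : ∀ i, |y i| ≤ B) :
    |overlap x y| ≤ B ^ 2 := by
  have hN' : (0:ℝ) < N := by exact_mod_cast hN
  rw [overlap, abs_div, abs_of_pos hN', div_le_iff₀ hN', mul_comm]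
  refine (Finset.abs_sum_le_sum_abs _ _).trans ?_
  have : ∀ i ∈ Finset.univ, |x i * y i| ≤ B ^ 2 := fun i _ => by
    rw [abs_mul, sq]
    exact mul_le_mul (hx i) (hy i) (abs_nonneg _) ((abs_nonneg _).trans (hx i))
  simpa using Finset.sum_le_card_nsmul _ _ _ this

lemma lintegral_biUnion_finset_le {X κ : Type*} [MeasurableSpace X] {μ : Measure X}
    (F : Finset κ) (s : κ → Set X) (f : X → ENNReal) :
    ∫⁻ x in ⋃ k ∈ F, s k, f x ∂μ ≤ ∑ k ∈ F, ∫⁻ x in s k, f x ∂μ := by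
  classical
  induction F using Finset.induction_on with
  | empty => simp
  | insert k F hk ih =>
    rw [Finset.sum_insert hk, Finset.set_biUnion_insert]
    exact (lintegral_union_le f _ _).trans (add_le_add le_rfl ih)

lemma rpow_sum_le_sum_rpow {κ : Type*} (F : Finset κ) (f : κ → ENNReal) {s : ℝ} (hs : 0 < s)
    (hs1 : s ≤ 1) : (∑ k ∈ F, f k) ^ s ≤ ∑ k ∈ F, f k ^ s :=
  Finset.le_sum_of_subadditive (fun z : ENNReal => z ^ s) (ENNReal.zero_rpow_of_pos hs).le
    (fun a b => ENNReal.rpow_add_le_add_rpow a b hs.le hs1) F f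

lemma gibbsAvg_indicator_eq (lam q t : ℝ) (d : Disorder N) {S : Set ℝ} (hS : MeasurableSet S) :
    gibbsAvg P lam q t d (fun x => S.indicator (fun _ => (1:ℝ)) (overlap x d.1)) =
      ((∫⁻ x in {x | overlap x d.1 ∈ S}, ENNReal.ofReal (Real.exp (negH lam q t d x))
        ∂(priorN P N)) / fullZ P lam q t d).toReal := by
  have hm : Measurable fun x => Real.exp (negH lam q t d x) :=
    ((measurable_negH lam q t).comp measurable_prodMk_left).exp
  have hSm : MeasurableSet {x : Fin N → ℝ | overlap x d.1 ∈ S} :=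
    (measurable_overlap.comp (by fun_prop : Measurable fun x : Fin N → ℝ => (x, d.1))) hS
  rw [gibbsAvg, ENNReal.toReal_div, fullZ]
  congr 1
  · rw [← integral_eq_lintegral_of_nonneg_ae (ae_of_all _ fun x => (Real.exp_pos _).le)
      hm.aestronglyMeasurable, ← integral_indicator hSm]
    refine integral_congr_ae (ae_of_all _ fun x => ?_)
    by_cases hx : overlap x d.1 ∈ S <;> simp [Set.indicator, hx]
  · exact integral_eq_lintegral_of_nonneg_ae (ae_of_all _ fun x => (Real.exp_pos _).le)
      hm.aestronglyMeasurable

lemma ofReal_overlapProb_le (lam q t : ℝ) {S : Set ℝ} (hS : MeasurableSet S) :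
    ENNReal.ofReal (overlapProb P N lam q t S) ≤ ∫⁻ d : Disorder N,
      (∫⁻ x in {x | overlap x d.1 ∈ S}, ENNReal.ofReal (Real.exp (negH lam q t d x))
        ∂(priorN P N)) / fullZ P lam q t d ∂(disorderLaw P N) := by
  unfold overlapProb
  refine (ENNReal.ofReal_le_ofReal (le_abs_self _)).trans ?_
  rw [← Real.norm_eq_abs, ofReal_norm]
  refine (enorm_integral_le_lintegral_enorm _).trans (lintegral_mono fun d => ?_)
  rw [gibbsAvg_indicator_eq lam q t d hS, Real.enorm_eq_ofReal ENNReal.toReal_nonneg]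
  exact ENNReal.ofReal_toReal_le

variable [IsProbabilityMeasure P]

/-- Covering a set of overlaps by windows. Only overlaps of absolute value at most `B ^ 2`
occur. -/
lemma lintegral_overlap_le_sum (hP : ∀ᵐ x ∂P, |x| ≤ B) (hN : 1 ≤ N) {κ : Type*} (F : Finset κ)
    (m : κ → ℝ) (η : ℝ) (S : Set ℝ) {y : Fin N → ℝ} (hy : ∀ i, |y i| ≤ B)
    (hcov : ∀ R ∈ S, |R| ≤ B ^ 2 → ∃ k ∈ F, R ∈ Set.Ico (m k) (m k + η))
    (f : (Fin N → ℝ) → ENNReal) :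
    ∫⁻ x in {x | overlap x y ∈ S}, f x ∂(priorN P N) ≤
      ∑ k ∈ F, ∫⁻ x in {x | overlap x y ∈ Set.Ico (m k) (m k + η)}, f x ∂(priorN P N) := by
  refine le_trans (lintegral_mono_set' ?_) (lintegral_biUnion_finset_le F _ f)
  filter_upwards [ae_priorN hP] with x hx hxS
  obtain ⟨k, hk, hk2⟩ := hcov _ hxS (abs_overlap_le hN hx hy)
  exact Set.mem_biUnion hk hk2

lemma exists_moment_bounds (hP : ∀ᵐ x ∂P, |x| ≤ B) (hB : 1 ≤ B) {lam q : ℝ} (hlam : 0 ≤ lam)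
    (hq : 0 ≤ q) (M : ℝ) : ∃ C : ℝ, 0 ≤ C ∧ ∀ N : ℕ, 1 ≤ N → ∀ t ∈ Set.Icc (0:ℝ) 1,
      ∀ s : ℝ, 0 < s → s < 1 →
      (∀ m ε : ℝ, |m| ≤ M → 0 ≤ ε → ∫⁻ d, restrictedZ P lam q t ε m d ^ s ∂(disorderLaw P N) ≤
        ENNReal.ofReal (Real.exp (s * N * (overlapGap P B lam q t m +
          (psi P (lam * q) - t * lam * q ^ 2 / 4) + (1 + lam) * ε ^ 2) + C * s + C * s ^ 2 * N))) ∧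
      ∫⁻ d, fullZ P lam q t d ^ (-s) ∂(disorderLaw P N) ≤
        ENNReal.ofReal (Real.exp (-(s * N * (psi P (lam * q) - t * lam * q ^ 2 / 4))
          + C * s + C * s ^ 2 * N)) := by
  obtain ⟨C₁, hC₁, h₁⟩ := exists_lintegral_restrictedZ_rpow_le hP hB (lam * q + lam * M + M + B ^ 2)
  obtain ⟨C₂, hC₂, h₂⟩ := exists_rpow_chanZ_bound hP (lam * q)
  have hB0 : 0 ≤ B := by linarith
  have hlq : 0 ≤ lam * q := mul_nonneg hlam hq
  refine ⟨C₁ + C₂ + lam * B ^ 4 / 4, by positivity, fun N hN t ht s hs hs1 => ⟨?_, ?_⟩⟩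
  · intro m ε hm hε
    have ht' := sub_nonneg.2 ht.2
    have ht0 := ht.1
    have hr0 : 0 ≤ (1 - t) * lam * q + t * lam * |m| := by positivity
    refine (h₁ N hN lam q t ε m s _ _ hlam hq ht hε hs hs1.le rfl rfl ?_).trans
      (ENNReal.ofReal_le_ofReal (Real.exp_le_exp.2 ?_))
    · rw [abs_of_nonneg hr0]
      have e1 : t * (lam * |m|) ≤ 1 * (lam * M) := by
        have := ht.2
        gcongr
      have e2 : (1 - t) * (lam * q) ≤ 1 * (lam * q) := by
        gcongr
        linarith
      linarith
    · unfold overlapGap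
      have e3 : 0 ≤ (C₂ + lam * B ^ 4 / 4) * s ^ 2 * N + (C₁ + C₂) * s := by positivity
      linarith
  · refine (lintegral_fullZ_rpow_neg_le hP hB0 hN hlam hq ht hs hs1 (C := C₂) ?_).trans
      (ENNReal.ofReal_le_ofReal (Real.exp_le_exp.2 ?_))
    · have := h₂ (lam * q) (lam * q) (abs_of_nonneg hlq).le (abs_of_nonneg hlq).le (-s)
        (by rw [abs_neg, abs_of_pos hs]; exact hs1.le)
      rwa [neg_sq] at this
    · have e3 : 0 ≤ (C₁ + lam * B ^ 4 / 4) * s ^ 2 * N + (C₁ + C₂) * s := by positivity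
      have e4 : s * (t * lam * B ^ 4 / 4) ≤ s * (lam * B ^ 4 / 4) := by
        have : t * lam ≤ lam := by nlinarith [ht.2]
        gcongr
      linarith

/-- A gap of the rate over a window of fixed length is a gap of the Franz–Parisi potential: the
window is divided into short ones, at a cost vanishing with `N`. -/
lemma franzParisi_le_of_gap (hP : ∀ᵐ x ∂P, |x| ≤ B) (hB : 1 ≤ B) {lam q : ℝ} (hlam : 0 ≤ lam)
    (hq : 0 ≤ q) {ε δ : ℝ} (hε : 0 < ε) (hε1 : ε ≤ 1) (hδ : 0 < δ) :
    ∃ N₀ : ℕ, 1 ≤ N₀ ∧ ∀ N : ℕ, N₀ ≤ N → ∀ t ∈ Set.Icc (0:ℝ) 1, ∀ m a : ℝ,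
      (∀ m' ∈ Set.Ico m (m + ε), |m'| ≤ B ^ 2 + 1 → overlapGap P B lam q t m' ≤ -a) →
      franzParisi P N lam q t ε m ≤
        ((psi P (lam * q) - t * lam * q ^ 2 / 4 - a + δ : ℝ) : EReal) := by
  obtain ⟨C, hC, hb⟩ := exists_moment_bounds hP hB hlam hq (B ^ 2 + 1)
  obtain ⟨n, hn⟩ := exists_nat_gt ((1 + lam) / (δ / 4))
  have hn0 : (0:ℝ) < n := lt_of_le_of_lt (by positivity) hn
  have hn1 : (1:ℝ) ≤ n := by exact_mod_cast (Nat.cast_pos.1 hn0)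
  set s := min (1 / 2) (δ / 4 / (C + 1)) with hs
  have hs0 : 0 < s := lt_min (by norm_num) (by positivity)
  have hs1 : s < 1 := (min_le_left _ _).trans_lt (by norm_num)
  have hCs : C * s ≤ δ / 4 := by
    have : C * s ≤ (C + 1) * (δ / 4 / (C + 1)) :=
      mul_le_mul (by linarith) (min_le_right _ _) hs0.le (by positivity)
    rwa [mul_div_cancel₀ _ (by positivity)] at this
  obtain ⟨N₁, hN₁⟩ := exists_nat_gt (C / (δ / 4))
  obtain ⟨N₂, hN₂⟩ := exists_nat_gt (Real.log n / (s * (δ / 4)))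
  refine ⟨max 1 (max N₁ N₂), le_max_left _ _, fun N hN t ht m a hgap => ?_⟩
  have hN1 : 1 ≤ N := (le_max_left _ _).trans hN
  have hNN₁ : C ≤ N * (δ / 4) := by
    have h1 : (N₁:ℝ) ≤ N := by exact_mod_cast ((le_max_left _ _).trans (le_max_right _ _)).trans hN
    rw [div_lt_iff₀ (by positivity)] at hN₁
    nlinarith
  have hNN₂ : Real.log n ≤ N * (s * (δ / 4)) := by
    have h1 : (N₂:ℝ) ≤ N := by exact_mod_cast ((le_max_right _ _).trans (le_max_right _ _)).trans hN
    rw [div_lt_iff₀ (by positivity)] at hN₂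
    have : 0 < s * (δ / 4) := by positivity
    nlinarith
  set η := ε / n with hη
  have hη0 : 0 < η := by positivity
  have hηn : n * η = ε := by rw [hη]; field_simp
  have hηsq : (1 + lam) * η ^ 2 ≤ δ / 4 := by
    rw [div_lt_iff₀ (by positivity)] at hn
    have h1 : η ≤ 1 / n := by rw [hη]; gcongr
    have h2 : η ^ 2 ≤ 1 / n := by
      have : η ≤ 1 := h1.trans ((div_le_one hn0).2 hn1)
      nlinarith
    calc (1 + lam) * η ^ 2 ≤ (1 + lam) * (1 / n) := by gcongr
      _ ≤ δ / 4 := by rw [mul_one_div, div_le_iff₀ hn0]; linarith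
  set b := psi P (lam * q) - t * lam * q ^ 2 / 4 with hbdef
  classical
  set F : Finset ℕ := (Finset.range n).filter fun k => |m + k * η| ≤ B ^ 2 + 1 with hF
  refine franzParisi_le_of_moment hN1 hs0 ?_
  calc ∫⁻ d, restrictedZ P lam q t ε m d ^ s ∂(disorderLaw P N)
      ≤ ∫⁻ d, ∑ k ∈ F, restrictedZ P lam q t η (m + k * η) d ^ s ∂(disorderLaw P N) := by
        refine lintegral_mono_ae ((ae_disorder hP).mono fun d hd => ?_)
        refine le_trans (ENNReal.rpow_le_rpow ?_ hs0.le) (rpow_sum_le_sum_rpow F _ hs0 hs1.le)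
        refine lintegral_overlap_le_sum hP hN1 F (fun k => m + k * η) η _ hd ?_ _
        intro R hR hRB
        have h0 : 0 ≤ (R - m) / η := div_nonneg (by linarith [hR.1]) hη0.le
        have h1 := Nat.floor_le h0
        have h2 := Nat.lt_floor_add_one ((R - m) / η)
        rw [le_div_iff₀ hη0] at h1
        rw [div_lt_iff₀ hη0] at h2
        refine ⟨⌊(R - m) / η⌋₊, Finset.mem_filter.2 ⟨Finset.mem_range.2 ?_, ?_⟩, ?_, ?_⟩
        · rw [Nat.floor_lt h0, div_lt_iff₀ hη0, hηn]
          linarith [hR.2]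
        · have hη1 : η ≤ 1 := (div_le_self hε.le hn1).trans hε1
          rw [abs_le] at hRB ⊢
          constructor <;> linarith
        · linarith
        · linarith
    _ = ∑ k ∈ F, ∫⁻ d, restrictedZ P lam q t η (m + k * η) d ^ s ∂(disorderLaw P N) :=
        lintegral_finsetSum _ fun k _ => (measurable_restrictedZ _ _ _ _ _).pow_const s
    _ ≤ ∑ k ∈ F, ENNReal.ofReal (Real.exp (s * N * (-a + b + δ / 4) + C * s + C * s ^ 2 * N)) := by
        refine Finset.sum_le_sum fun k hk => ?_
        obtain ⟨hk1, hk2⟩ := Finset.mem_filter.1 hk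
        refine ((hb N hN1 t ht s hs0 hs1).1 (m + k * η) η hk2 hη0.le).trans
          (ENNReal.ofReal_le_ofReal (Real.exp_le_exp.2 ?_))
        have hk3 : (k:ℝ) + 1 ≤ n := by exact_mod_cast Finset.mem_range.1 hk1
        have hg := hgap (m + k * η) ⟨by nlinarith [Nat.cast_nonneg (α := ℝ) k], by nlinarith⟩ hk2
        gcongr
    _ ≤ n * ENNReal.ofReal (Real.exp (s * N * (-a + b + δ / 4) + C * s + C * s ^ 2 * N)) := by
        rw [Finset.sum_const, nsmul_eq_mul]
        gcongr
        exact (Finset.card_filter_le _ _).trans_eq (Finset.card_range n)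
    _ ≤ _ := by
        rw [← ENNReal.ofReal_natCast, ← ENNReal.ofReal_mul hn0.le]
        refine ENNReal.ofReal_le_ofReal ?_
        have e0 : (n:ℝ) * Real.exp (s * N * (-a + b + δ / 4) + C * s + C * s ^ 2 * N) =
            Real.exp (Real.log n + (s * N * (-a + b + δ / 4) + C * s + C * s ^ 2 * N)) := by
          rw [Real.exp_add (Real.log n), Real.exp_log hn0]
        rw [e0]
        refine Real.exp_le_exp.2 ?_
        have e1 : C * s ^ 2 * N ≤ δ / 4 * (s * N) := by
          calc C * s ^ 2 * N = C * s * (s * N) := by ring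
            _ ≤ _ := by gcongr
        have e2 : C * s ≤ N * (δ / 4) * s := by gcongr
        linarith

/-! ### Exponential decay of the overlap probabilities -/

lemma overlapProb_le_one (lam q t : ℝ) {S : Set ℝ} (hS : MeasurableSet S) :
    overlapProb P N lam q t S ≤ 1 := by
  rw [← ENNReal.ofReal_le_one]
  refine (ofReal_overlapProb_le lam q t hS).trans ?_
  refine (lintegral_mono (g := fun _ => 1) fun d => ?_).trans (by simp)
  exact (ENNReal.div_le_div_right (setLIntegral_le_lintegral _ _) _).trans ENNReal.div_self_le_one

/-- By Bayes' rule in fractional form and the Cauchy–Schwarz inequality, the probability of a set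
of overlaps is a sum over a cover by windows of exponentials of the rate. -/
lemma ofReal_overlapProb_le_sum (hP : ∀ᵐ x ∂P, |x| ≤ B) (hN : 1 ≤ N) {lam q t s b C : ℝ}
    {κ : Type*} (F : Finset κ) (m : κ → ℝ) (η : ℝ) (g : κ → ℝ) {S : Set ℝ}
    (hS : MeasurableSet S) (hs : 0 < s) (hs1 : s ≤ 1)
    (hcov : ∀ R ∈ S, |R| ≤ B ^ 2 → ∃ k ∈ F, R ∈ Set.Ico (m k) (m k + η))
    (hnum : ∀ k ∈ F, ∫⁻ d, restrictedZ P lam q t η (m k) d ^ (s * 2) ∂(disorderLaw P N) ≤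
      ENNReal.ofReal (Real.exp (2 * (g k + b))))
    (hden : ∫⁻ d, fullZ P lam q t d ^ (-(s * 2)) ∂(disorderLaw P N) ≤
      ENNReal.ofReal (Real.exp (2 * (C - b)))) :
    ENNReal.ofReal (overlapProb P N lam q t S) ≤
      ∑ k ∈ F, ENNReal.ofReal (Real.exp (g k + C)) := by
  have hhalf : ∀ a : ℝ, ENNReal.ofReal (Real.exp (2 * a)) ^ (1 / (2:ℝ)) =
      ENNReal.ofReal (Real.exp a) := by
    intro a
    rw [ENNReal.ofReal_rpow_of_pos (Real.exp_pos _), ← Real.exp_mul]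
    congr 2
    ring
  calc _ ≤ ∫⁻ d : Disorder N, (∫⁻ x in {x | overlap x d.1 ∈ S},
        ENNReal.ofReal (Real.exp (negH lam q t d x)) ∂(priorN P N)) / fullZ P lam q t d
        ∂(disorderLaw P N) := ofReal_overlapProb_le lam q t hS
    _ ≤ ∫⁻ d, ∑ k ∈ F, restrictedZ P lam q t η (m k) d ^ s * fullZ P lam q t d ^ (-s)
        ∂(disorderLaw P N) := by
        refine lintegral_mono_ae ((ae_disorder hP).mono fun d hd => ?_)
        set z := ∫⁻ x in {x | overlap x d.1 ∈ S}, ENNReal.ofReal (Real.exp (negH lam q t d x))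
          ∂(priorN P N) with hz
        have h1 : z / fullZ P lam q t d ≤ 1 :=
          (ENNReal.div_le_div_right (setLIntegral_le_lintegral _ _) _).trans
            ENNReal.div_self_le_one
        have h2 : z / fullZ P lam q t d ≤ (z / fullZ P lam q t d) ^ s := by
          have := ENNReal.rpow_le_rpow_of_exponent_ge h1 hs1
          rwa [ENNReal.rpow_one] at this
        refine h2.trans ?_
        rw [div_eq_mul_inv, ENNReal.mul_rpow_of_nonneg _ _ hs.le, ENNReal.inv_rpow,
          ← ENNReal.rpow_neg, ← Finset.sum_mul]
        gcongr
        refine le_trans (ENNReal.rpow_le_rpow ?_ hs.le) (rpow_sum_le_sum_rpow F _ hs hs1)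
        exact lintegral_overlap_le_sum hP hN F m η S hd hcov _
    _ = ∑ k ∈ F, ∫⁻ d, restrictedZ P lam q t η (m k) d ^ s * fullZ P lam q t d ^ (-s)
        ∂(disorderLaw P N) :=
        lintegral_finsetSum _ fun k _ => ((measurable_restrictedZ _ _ _ _ _).pow_const s).mul
          ((measurable_fullZ _ _ _).pow_const _)
    _ ≤ _ := by
        refine Finset.sum_le_sum fun k hk => ?_
        have h := ENNReal.lintegral_mul_le_Lp_mul_Lq (disorderLaw P N)
          (Real.HolderConjugate.two_two)
          (((measurable_restrictedZ (P := P) (N := N) lam q t η (m k)).pow_const s).aemeasurable)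
          (((measurable_fullZ (P := P) (N := N) lam q t).pow_const (-s)).aemeasurable)
        refine h.trans ?_
        simp_rw [← ENNReal.rpow_mul, neg_mul]
        calc _ ≤ ENNReal.ofReal (Real.exp (2 * (g k + b))) ^ (1 / (2:ℝ)) *
              ENNReal.ofReal (Real.exp (2 * (C - b))) ^ (1 / (2:ℝ)) := by
              gcongr
              exact hnum k hk
          _ = _ := by
              rw [hhalf, hhalf, ← ENNReal.ofReal_mul (Real.exp_pos _).le, ← Real.exp_add]
              congr 2
              ring

lemma summable_exp_neg_mul_abs {w : ℝ} (hw : 0 < w) :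
    Summable fun k : ℤ => Real.exp (-(w * |(k:ℝ)|)) := by
  have h : Summable fun n : ℕ => Real.exp (-(w * n)) := by
    have := Real.summable_exp_nat_mul_iff.2 (neg_lt_zero.2 hw)
    refine this.congr fun n => ?_
    congr 1
    ring
  refine Summable.of_nat_of_neg (h.congr fun n => ?_) (h.congr fun n => ?_) <;> simp

/-- If the rate is at most `-c₀ (τ + (m + q)²)` on the relevant overlaps, these have probability at
most `K exp(-c₁ τ² N)`. The order of the moments is a multiple of `τ`, the windows have length of
order `√τ`, and the quadratic term makes the sum over the windows converge uniformly. -/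
lemma exists_overlapProb_le (hP : ∀ᵐ x ∂P, |x| ≤ B) (hB : 1 ≤ B) {lam q : ℝ} (hlam : 0 ≤ lam)
    (hq : 0 ≤ q) {c₀ ε : ℝ} (hc₀ : 0 < c₀) (hε : 0 < ε) :
    ∃ K c₁ : ℝ, 0 ≤ K ∧ 0 < c₁ ∧ ∀ t ∈ Set.Icc (0:ℝ) 1, ∀ τ ∈ Set.Icc (0:ℝ) 1,
      ∀ S S' : Set ℝ, MeasurableSet S → (∀ R ∈ S, ∀ m, m ≤ R → R < m + ε → m ∈ S') →
      (∀ m ∈ S', |m| ≤ B ^ 2 + 1 → overlapGap P B lam q t m ≤ -(c₀ * (τ + (m + q) ^ 2))) →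
      ∀ N : ℕ, 1 ≤ N → overlapProb P N lam q t S ≤ K * Real.exp (-(c₁ * τ ^ 2 * N)) := by
  obtain ⟨C, hC, hb⟩ := exists_moment_bounds hP hB hlam hq (B ^ 2 + 1)
  -- `κ` is the length of a window relative to `√τ`, and `s₀` the order of the moments relative to
  -- `τ`. They are so small that either error is at most a quarter of the gap `c₀ * τ`.
  set κ := min (min ε 1) (c₀ / 4 / (1 + lam)) with hκ
  have hκ0 : 0 < κ := lt_min (lt_min hε one_pos) (by positivity)
  have hκε : κ ≤ ε := (min_le_left _ _).trans (min_le_left _ _)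
  have hκ1 : κ ≤ 1 := (min_le_left _ _).trans (min_le_right _ _)
  have hκc : (1 + lam) * κ ^ 2 ≤ c₀ / 4 := by
    have h1 : (1 + lam) * κ ≤ c₀ / 4 := by
      have := min_le_right (min ε 1) (c₀ / 4 / (1 + lam))
      rw [← hκ, le_div_iff₀ (by positivity)] at this
      linarith
    have h2 : κ ^ 2 ≤ κ := by nlinarith
    have := mul_le_mul_of_nonneg_left h2 (by positivity : 0 ≤ 1 + lam)
    linarith
  set s₀ := min (1 / 4) (c₀ / 16 / (C + 1)) with hs₀
  have hs₀0 : 0 < s₀ := lt_min (by norm_num) (by positivity)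
  have hs₀4 : s₀ ≤ 1 / 4 := min_le_left _ _
  have hCs : 4 * C * s₀ ≤ c₀ / 4 := by
    have := min_le_right (1 / 4) (c₀ / 16 / (C + 1))
    rw [← hs₀, le_div_iff₀ (by positivity)] at this
    linarith
  set w := s₀ * c₀ * κ ^ 2 with hw
  have hw0 : 0 < w := by positivity
  set W := ∑' k : ℤ, Real.exp (-(w * |(k:ℝ)|)) with hW
  have hW0 : 0 ≤ W := tsum_nonneg fun k => (Real.exp_pos _).le
  set c₁ := s₀ * c₀ / 2 with hc₁
  have hc₁0 : 0 < c₁ := by positivity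
  refine ⟨Real.exp (2 * C * s₀) * W + Real.exp c₁, c₁, by positivity, hc₁0,
    fun t ht τ hτ S S' hS hSS' hgap N hN => ?_⟩
  have hN' : (0:ℝ) < N := by exact_mod_cast hN
  rw [add_mul]
  -- For `τ ^ 2 * N < 1` the trivial bound suffices.
  rcases lt_or_ge (τ ^ 2 * N) 1 with hsmall | hlarge
  · refine (overlapProb_le_one lam q t hS).trans ?_
    have h1 : 1 ≤ Real.exp c₁ * Real.exp (-(c₁ * τ ^ 2 * N)) := by
      rw [← Real.exp_add]
      refine Real.one_le_exp ?_
      nlinarith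
    have h2 : 0 ≤ Real.exp (2 * C * s₀) * W * Real.exp (-(c₁ * τ ^ 2 * N)) := by positivity
    linarith
  have hτ0 : 0 < τ := by
    rcases hτ.1.eq_or_lt with h | h
    · rw [← h] at hlarge; norm_num at hlarge
    · exact h
  have hsq := Real.sq_sqrt hτ0.le
  set η := κ * √τ with hη
  have hη0 : 0 < η := by positivity
  have hsq1 : √τ ≤ 1 := Real.sqrt_le_one.2 hτ.2
  have hηκ : η ≤ κ := mul_le_of_le_one_right hκ0.le hsq1
  have hη2 : η ^ 2 = κ ^ 2 * τ := by rw [hη, mul_pow, hsq]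
  set s := s₀ * τ with hs
  have hs0 : 0 < s := by positivity
  have hs4 : s ≤ 1 / 4 := (mul_le_of_le_one_right hs₀0.le hτ.2).trans hs₀4
  classical
  obtain ⟨n, hn⟩ := exists_int_gt ((B ^ 2 + q) / η + 1)
  set m : ℤ → ℝ := fun k => -q + k * η with hm
  set F : Finset ℤ := (Finset.Icc (-n) n).filter fun k => m k ∈ S' ∧ |m k| ≤ B ^ 2 + 1 with hF
  set b := s * N * (psi P (lam * q) - t * lam * q ^ 2 / 4) with hbdef
  set g : ℤ → ℝ := fun k => s * N * (-(c₀ * (τ + (m k + q) ^ 2)) + (1 + lam) * η ^ 2) + C * s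
    + 2 * C * s ^ 2 * N with hg
  have hmain := ofReal_overlapProb_le_sum hP hN (lam := lam) (q := q) (t := t) (s := s) (b := b)
    (C := C * s + 2 * C * s ^ 2 * N) F m η g hS hs0 (by linarith) ?_ ?_ ?_
  · rw [← ENNReal.ofReal_sum_of_nonneg fun k _ => (Real.exp_pos _).le] at hmain
    have hmain' := (ENNReal.ofReal_le_ofReal_iff
      (Finset.sum_nonneg fun k _ => (Real.exp_pos _).le)).1 hmain
    refine hmain'.trans ?_
    calc _ ≤ ∑ k ∈ F, Real.exp (2 * C * s₀) * Real.exp (-(c₁ * τ ^ 2 * N)) *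
          Real.exp (-(w * |(k:ℝ)|)) := by
          refine Finset.sum_le_sum fun k _ => ?_
          rw [← Real.exp_add, ← Real.exp_add]
          refine Real.exp_le_exp.2 ?_
          have hk : |(k:ℝ)| ≤ (k:ℝ) ^ 2 := by
            have : |k| ≤ k ^ 2 := by
              rw [← sq_abs]
              exact Int.le_self_sq _
            exact_mod_cast this
          have e1 : (m k + q) ^ 2 = κ ^ 2 * τ * (k:ℝ) ^ 2 := by
            rw [← hη2, hm]; ring
          have e2 : g k + (C * s + 2 * C * s ^ 2 * N) =
              s₀ * (τ ^ 2 * N) * (-c₀ + (1 + lam) * κ ^ 2 + 4 * C * s₀) -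
                w * (τ ^ 2 * N) * (k:ℝ) ^ 2 + 2 * C * s₀ * τ := by
            rw [hg]
            simp only
            rw [e1, hη2, hs, hw]
            ring
          rw [e2]
          have e3 : s₀ * (τ ^ 2 * N) * (-c₀ + (1 + lam) * κ ^ 2 + 4 * C * s₀) ≤
              s₀ * (τ ^ 2 * N) * (-c₀ / 2) := by
            gcongr
            linarith
          have e4 : w * |(k:ℝ)| ≤ w * (τ ^ 2 * N) * (k:ℝ) ^ 2 := by
            calc w * |(k:ℝ)| ≤ w * (k:ℝ) ^ 2 := by gcongr
              _ = w * 1 * (k:ℝ) ^ 2 := by ring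
              _ ≤ _ := by gcongr
          have e5 : 2 * C * s₀ * τ ≤ 2 * C * s₀ := mul_le_of_le_one_right (by positivity) hτ.2
          rw [hc₁]
          linarith
      _ ≤ Real.exp (2 * C * s₀) * Real.exp (-(c₁ * τ ^ 2 * N)) * W := by
          rw [← Finset.mul_sum]
          gcongr
          exact (summable_exp_neg_mul_abs hw0).sum_le_tsum _ fun k _ => (Real.exp_pos _).le
      _ ≤ _ := by
          have : 0 ≤ Real.exp c₁ * Real.exp (-(c₁ * τ ^ 2 * N)) := by positivity
          linarith
  · intro R hR hRB
    have h1 := Int.floor_le ((R + q) / η)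
    have h2 := Int.lt_floor_add_one ((R + q) / η)
    rw [abs_le] at hRB
    have h3 : (R + q) / η ≤ (B ^ 2 + q) / η := by gcongr; exact hRB.2
    have h4 : -((B ^ 2 + q) / η) ≤ (R + q) / η := by
      rw [← neg_div]; gcongr; linarith
    set k := ⌊(R + q) / η⌋ with hk
    have hkn : k ∈ Finset.Icc (-n) n := by
      rw [Finset.mem_Icc]
      constructor
      · have : (-n:ℝ) < k := by linarith
        exact_mod_cast this.le
      · have : (k:ℝ) < n := by linarith
        exact_mod_cast this.le
    rw [le_div_iff₀ hη0] at h1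
    rw [div_lt_iff₀ hη0] at h2
    have h5 : m k ≤ R := by simp only [hm]; linarith
    have h6 : R < m k + η := by simp only [hm]; linarith
    refine ⟨k, Finset.mem_filter.2 ⟨hkn, hSS' R hR _ h5 (by linarith), ?_⟩, h5, h6⟩
    rw [abs_le]
    constructor <;> linarith
  · intro k hk
    obtain ⟨-, hk1, hk2⟩ := Finset.mem_filter.1 hk
    refine ((hb N hN t ht (s * 2) (by linarith) (by linarith)).1 (m k) η hk2 hη0.le).trans
      (ENNReal.ofReal_le_ofReal (Real.exp_le_exp.2 ?_))
    have h7 := mul_le_mul_of_nonneg_left (hgap (m k) hk1 hk2) (by positivity : 0 ≤ s * 2 * N)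
    rw [hg, hbdef]
    simp only
    linarith
  · refine (hb N hN t ht (s * 2) (by linarith) (by linarith)).2.trans
      (ENNReal.ofReal_le_ofReal (Real.exp_le_exp.2 (le_of_eq ?_)))
    rw [hbdef]
    ring

end SpikedWigner

namespace SpikedWigner

/-! ### The maximizer of the replica-symmetric potential -/

variable {P : Measure ℝ} {B : ℝ}

lemma IsRSMaximizer.phiRS_eq {lam q : ℝ} (h : IsRSMaximizer P lam q) :
    phiRS P lam = rsPotential P lam q := by
  have hg : IsGreatest (rsPotential P lam '' Set.Ici 0) (rsPotential P lam q) := by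
    refine ⟨⟨q, h.1, rfl⟩, ?_⟩
    rintro _ ⟨q', hq', rfl⟩
    exact h.2 q' hq'
  exact hg.csSup_eq

/-- The value at `m = q` of the variational formula along the interpolation path. -/
lemma IsRSMaximizer.le_phiRSt {lam q t : ℝ} (hlam : 0 ≤ lam)
    (h : IsRSMaximizer P lam q) (ht : t ∈ Set.Icc (0:ℝ) 1) :
    psi P (lam * q) - t * lam * q ^ 2 / 4 ≤ phiRSt P lam q t := by
  have ht' := sub_nonneg.2 ht.2
  have ht0 := ht.1
  have hq := h.1
  refine le_csSup ⟨rsPotential P lam q + lam * (1 - t) * q ^ 2 / 4, ?_⟩ ⟨q, h.1, ?_⟩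
  · rintro _ ⟨m, hm, rfl⟩
    have hm0 : 0 ≤ m := hm
    have h1 := h.2 ((1 - t) * q + t * m) (by positivity)
    have e1 : lam * ((1 - t) * q + t * m) = (1 - t) * lam * q + t * lam * m := by ring
    rw [rsPotential, e1] at h1
    have h2 : 0 ≤ lam * (t * (1 - t) * (q - m) ^ 2) := by positivity
    simp only
    nlinarith
  · simp only
    congr 1
    congr 1
    ring

lemma pos_of_lambdaC_lt {lam q : ℝ} (hlam : lam ∈ regularSet P) (h : lambdaC P < (lam : EReal))
    (hq : IsQStar P lam q) : 0 < q := by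
  refine hq.1.1.lt_of_ne fun h0 => ?_
  refine absurd h (not_lt.2 (le_sSup ⟨lam, ⟨hlam.1, hlam.2.1, ?_⟩, rfl⟩))
  rw [h0]
  exact hq

variable [IsProbabilityMeasure P]

lemma rsPotential_zero (P : Measure ℝ) [IsProbabilityMeasure P] (lam : ℝ) :
    rsPotential P lam 0 = 0 := by
  simp [rsPotential, psi, psiBar]

lemma continuous_rsPotential (hP : ∀ᵐ x ∂P, |x| ≤ B) (lam : ℝ) :
    Continuous (rsPotential P lam) := by
  have := continuous_psi hP
  unfold rsPotential
  fun_prop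

/-- `ψ` increases with slope at most `B² / 2`. -/
lemma psi_le_mul (hP : ∀ᵐ x ∂P, |x| ≤ B) (hB : 0 ≤ B) {r : ℝ} (hr : 0 ≤ r) :
    psi P r ≤ B ^ 2 / 2 * r := by
  have h := Convex.image_sub_le_mul_sub_of_deriv_le (convex_Ici (0:ℝ))
    (continuous_psi hP).continuousOn (C := B ^ 2 / 2)
    (fun x hx => by
      rw [interior_Ici] at hx
      exact (hasDerivAt_psi hP hB hx).differentiableAt.differentiableWithinAt)
    (fun x hx => by
      rw [interior_Ici] at hx
      rw [(hasDerivAt_psi hP hB hx).deriv]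
      linarith [(abs_le.1 (abs_chanOverlap_le hP x x)).2]) 0 (Set.mem_Ici.2 le_rfl) r
      (Set.mem_Ici.2 hr) hr
  have h0 : psi P 0 = 0 := by simp [psi, psiBar]
  rw [h0] at h
  linarith

lemma rsPotential_le (hP : ∀ᵐ x ∂P, |x| ≤ B) (hB : 0 ≤ B) {lam q : ℝ} (hlam : 0 ≤ lam)
    (hq : 0 ≤ q) : rsPotential P lam q ≤ lam * q * (2 * B ^ 2 - q) / 4 := by
  have := psi_le_mul hP hB (mul_nonneg hlam hq)
  unfold rsPotential
  linarith

lemma exists_isRSMaximizer (hP : ∀ᵐ x ∂P, |x| ≤ B) (hB : 0 ≤ B) {lam : ℝ} (hlam : 0 ≤ lam) :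
    ∃ q, IsRSMaximizer P lam q := by
  have hne : (Set.Icc (0:ℝ) (2 * B ^ 2)).Nonempty := ⟨0, by simp; positivity⟩
  obtain ⟨q, hq, hmax⟩ := isCompact_Icc.exists_isMaxOn hne
    (continuous_rsPotential hP lam).continuousOn
  refine ⟨q, hq.1, fun q' hq' => ?_⟩
  rcases le_or_gt q' (2 * B ^ 2) with h | h
  · exact hmax ⟨hq', h⟩
  · have h0 : rsPotential P lam 0 ≤ rsPotential P lam q := hmax ⟨le_rfl, by positivity⟩
    rw [rsPotential_zero] at h0
    refine (rsPotential_le hP hB hlam hq').trans (le_trans ?_ h0)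
    have : lam * q' * (2 * B ^ 2 - q') ≤ 0 :=
      mul_nonpos_of_nonneg_of_nonpos (by positivity) (by linarith)
    linarith

lemma bddAbove_rsPotential (hP : ∀ᵐ x ∂P, |x| ≤ B) (hB : 0 ≤ B) {lam : ℝ} (hlam : 0 ≤ lam) :
    BddAbove (rsPotential P lam '' Set.Ici 0) := by
  obtain ⟨q, hq⟩ := exists_isRSMaximizer hP hB hlam
  refine ⟨rsPotential P lam q, ?_⟩
  rintro _ ⟨q', hq', rfl⟩
  exact hq.2 q' hq'

lemma rsPotential_le_phiRS (hP : ∀ᵐ x ∂P, |x| ≤ B) (hB : 0 ≤ B) {lam q : ℝ} (hlam : 0 ≤ lam)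
    (hq : 0 ≤ q) : rsPotential P lam q ≤ phiRS P lam :=
  le_csSup (bddAbove_rsPotential hP hB hlam) ⟨q, hq, rfl⟩

/-- The competitor `λ q / (λ + h)` at `λ + h`, for which the argument of `ψ` does not change. -/
lemma psi_sub_le_phiRS_add (hP : ∀ᵐ x ∂P, |x| ≤ B) (hB : 0 ≤ B) {lam q h : ℝ} (hlam : 0 ≤ lam)
    (hq : 0 ≤ q) (hh : 0 < lam + h) :
    psi P (lam * q) - lam ^ 2 * q ^ 2 / (4 * (lam + h)) ≤ phiRS P (lam + h) := by
  have := rsPotential_le_phiRS hP hB hh.le (q := lam * q / (lam + h)) (by positivity)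
  have e : rsPotential P (lam + h) (lam * q / (lam + h)) =
      psi P (lam * q) - lam ^ 2 * q ^ 2 / (4 * (lam + h)) := by
    rw [rsPotential, mul_div_cancel₀ _ hh.ne']
    field_simp
  rwa [e] at this

/-- The envelope theorem: `φ_RS' = q² / 4` for every maximizer `q`. -/
lemma IsRSMaximizer.deriv_phiRS (hP : ∀ᵐ x ∂P, |x| ≤ B) (hB : 0 ≤ B) {lam q : ℝ}
    (hlam : 0 < lam) (h : IsRSMaximizer P lam q) (hd : DifferentiableAt ℝ (phiRS P) lam) :
    deriv (phiRS P) lam = q ^ 2 / 4 := by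
  have hmin : IsLocalMin (fun l => phiRS P l + lam ^ 2 * q ^ 2 / 4 * l⁻¹) lam := by
    filter_upwards [lt_mem_nhds hlam] with l hl
    have h1 := psi_sub_le_phiRS_add hP hB hlam.le h.1 (h := l - lam) (by linarith)
    rw [add_sub_cancel] at h1
    have h2 : phiRS P lam + lam ^ 2 * q ^ 2 / 4 * lam⁻¹ = psi P (lam * q) := by
      rw [h.phiRS_eq, rsPotential]; field_simp; ring
    have h3 : lam ^ 2 * q ^ 2 / (4 * l) = lam ^ 2 * q ^ 2 / 4 * l⁻¹ := by field_simp
    rw [h2]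
    linarith
  have hder := hd.hasDerivAt.add ((hasDerivAt_inv hlam.ne').const_mul (lam ^ 2 * q ^ 2 / 4))
  have := hmin.hasDerivAt_eq_zero hder
  have e : lam ^ 2 * q ^ 2 / 4 * -(lam ^ 2)⁻¹ = -(q ^ 2 / 4) := by field_simp
  rw [e] at this
  linarith

lemma exists_isQStar (hP : ∀ᵐ x ∂P, |x| ≤ B) (hB : 0 ≤ B) {lam : ℝ} (hlam : 0 < lam)
    (hd : DifferentiableAt ℝ (phiRS P) lam) : ∃ q, IsQStar P lam q := by
  obtain ⟨q, hq⟩ := exists_isRSMaximizer hP hB hlam.le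
  refine ⟨q, hq, fun q' hq' => ?_⟩
  have h1 := hq.deriv_phiRS hP hB hlam hd
  have h2 := hq'.deriv_phiRS hP hB hlam hd
  exact (pow_left_inj₀ hq'.1 hq.1 two_ne_zero).1 (by linarith)

/-- The fixed-point equation at a maximizer. -/
lemma IsRSMaximizer.chanOverlap_eq (hP : ∀ᵐ x ∂P, |x| ≤ B) (hB : 0 ≤ B) {lam q : ℝ}
    (hlam : 0 < lam) (h : IsRSMaximizer P lam q) : chanOverlap P (lam * q) (lam * q) = q := by
  rcases h.1.eq_or_lt with h0 | hq
  · rw [← h0, mul_zero]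
    refine le_antisymm ?_ (chanOverlap_diag_nonneg hP le_rfl)
    by_contra! hd
    -- A positive overlap at `0` would make `ψ` grow linearly, faster than the quadratic penalty.
    have hcont : Continuous fun r => chanOverlap P r r :=
      (continuous_chanOverlap hP).comp (f := fun r : ℝ => (r, r)) (by fun_prop)
    obtain ⟨δ, hδ, hball⟩ := Metric.eventually_nhds_iff.1
      (hcont.continuousAt.eventually (lt_mem_nhds (half_lt_self hd)))
    set d := chanOverlap P 0 0
    set u := min (δ / (2 * lam)) (d / 2) with hu
    have hu0 : 0 < u := lt_min (by positivity) (by positivity)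
    have hlu : 0 < lam * u := by positivity
    obtain ⟨c, hc, hceq⟩ := exists_hasDerivAt_eq_slope (psi P) (fun r => chanOverlap P r r / 2)
      hlu (continuous_psi hP).continuousOn fun x hx => hasDerivAt_psi hP hB hx.1
    have hcd : d / 2 < chanOverlap P c c := by
      refine hball ?_
      rw [Real.dist_eq, sub_zero, abs_of_pos hc.1]
      refine hc.2.trans_le ?_
      have : u ≤ δ / (2 * lam) := min_le_left _ _
      rw [le_div_iff₀ (by positivity)] at this
      linarith
    have hmax := h.2 u hu0.le
    rw [← h0, rsPotential_zero, rsPotential] at hmax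
    have h00 : psi P 0 = 0 := by simp [psi, psiBar]
    rw [h00, sub_zero, sub_zero, eq_div_iff hlu.ne'] at hceq
    have hud : u ≤ d / 2 := min_le_right _ _
    nlinarith [mul_pos hlu hu0]
  · have hlq : 0 < lam * q := by positivity
    have hloc : IsLocalMax (rsPotential P lam) q := by
      filter_upwards [lt_mem_nhds hq] with q' hq'
      exact h.2 q' hq'.le
    have hder : HasDerivAt (rsPotential P lam)
        (chanOverlap P (lam * q) (lam * q) / 2 * lam - lam * (2 * q) / 4) q := by
      have h1 := (hasDerivAt_psi hP hB hlq).comp q ((hasDerivAt_id q).const_mul lam)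
      have h2 := ((hasDerivAt_pow 2 q).const_mul lam).div_const 4
      refine (h1.sub h2).congr_deriv ?_
      simp
    have := hloc.hasDerivAt_eq_zero hder
    have h3 : lam * (chanOverlap P (lam * q) (lam * q) - q) = 0 := by linarith
    have := (mul_eq_zero.1 h3).resolve_left hlam.ne'
    linarith

/-- A second order expansion of `φ_RS` makes its maximizer nondegenerate, in the variable `q²`. -/
lemma exists_rsPotential_le_sub_sq (hP : ∀ᵐ x ∂P, |x| ≤ B) (hB : 0 ≤ B) {lam q : ℝ}
    (hlam : lam ∈ regularSet P) (h : IsRSMaximizer P lam q) (Q : ℝ) :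
    ∃ c, 0 < c ∧ ∀ u, 0 ≤ u → u ≤ Q →
      rsPotential P lam u ≤ rsPotential P lam q - c * (q ^ 2 - u ^ 2) ^ 2 := by
  obtain ⟨hlam0, hd, b, hb⟩ := hlam
  obtain ⟨δ, hδ, hball⟩ := Metric.eventually_nhds_iff.1 (hb.def one_pos)
  rw [h.deriv_phiRS hP hB hlam0 hd] at hball
  set L := |b| / 2 + 1 + Q ^ 2 / (2 * lam) with hL
  have hL0 : 0 < L := by positivity
  set V := q ^ 2 + Q ^ 2 + 1 with hV
  have hV0 : 0 < V := by positivity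
  set a := min (1 / (8 * L)) (min (δ / (2 * V)) (lam / (2 * V))) with ha
  have ha0 : 0 < a := lt_min (by positivity) (lt_min (by positivity) (by positivity))
  have ha1 : a * (8 * L) ≤ 1 := (le_div_iff₀ (by positivity)).1 (min_le_left _ _)
  have ha2 : a * (2 * V) ≤ δ :=
    (le_div_iff₀ (by positivity)).1 ((min_le_right _ _).trans (min_le_left _ _))
  have ha3 : a * (2 * V) ≤ lam :=
    (le_div_iff₀ (by positivity)).1 ((min_le_right _ _).trans (min_le_right _ _))
  refine ⟨a / 8, by positivity, fun u hu huQ => ?_⟩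
  set v := q ^ 2 - u ^ 2 with hv
  have huQ2 : u ^ 2 ≤ Q ^ 2 := pow_le_pow_left₀ hu huQ 2
  have hvV : |v| ≤ V := by
    rw [abs_le]
    constructor <;> linarith [sq_nonneg q, sq_nonneg u, sq_nonneg Q]
  -- The optimal perturbation of `λ` is proportional to `u² - q²`.
  set e := -(a * v) with he
  have heV : |e| ≤ a * V := by
    rw [he, abs_neg, abs_mul, abs_of_pos ha0]; gcongr
  have heδ : |e| < δ := by
    have : 0 < a * V := by positivity
    linarith
  have hel : |e| ≤ lam / 2 := by linarith
  have hle : lam / 2 ≤ lam + e := by linarith [(abs_le.1 hel).1]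
  have hle0 : 0 < lam + e := by linarith
  have h1 := hball (y := e) (by rwa [Real.dist_eq, sub_zero])
  rw [Real.norm_eq_abs, Real.norm_eq_abs, one_mul, abs_of_nonneg (sq_nonneg e)] at h1
  have h1' := (abs_le.1 h1).2
  have h2 := psi_sub_le_phiRS_add hP hB hlam0.le hu hle0
  have h3 : lam ^ 2 * u ^ 2 / (4 * (lam + e)) =
      lam * u ^ 2 / 4 - e * u ^ 2 / 4 + e ^ 2 * u ^ 2 / (4 * (lam + e)) := by
    field_simp; ring
  have h4 : e ^ 2 * u ^ 2 / (4 * (lam + e)) ≤ e ^ 2 * (Q ^ 2 / (2 * lam)) := by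
    rw [mul_div_assoc]
    exact mul_le_mul_of_nonneg_left (div_le_div₀ (sq_nonneg Q) huQ2 (by positivity) (by linarith))
      (sq_nonneg e)
  have h5 : b / 2 * e ^ 2 ≤ |b| / 2 * e ^ 2 := by
    gcongr
    exact le_abs_self b
  rw [h.phiRS_eq] at h1'
  have h6 : rsPotential P lam u ≤ rsPotential P lam q + e * v / 4 + L * e ^ 2 := by
    have h7 : rsPotential P lam u = psi P (lam * u) - lam * u ^ 2 / 4 := rfl
    rw [h7, hL, hv]
    linarith
  have h8 : L * e ^ 2 ≤ a * v ^ 2 / 8 := by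
    rw [he]
    have := mul_le_mul_of_nonneg_right ha1 (by positivity : 0 ≤ a * v ^ 2)
    linarith
  have h9 : e * v = -(a * v ^ 2) := by rw [he]; ring
  rw [h9] at h6
  linarith

lemma eq_zero_of_lt_lambdaC {lam q : ℝ} (hlam : 0 < lam) (h : (lam : EReal) < lambdaC P)
    (hq : IsQStar P lam q) : q = 0 := by
  obtain ⟨_, ⟨l, ⟨hl0, -, hl⟩, rfl⟩, hlt⟩ := lt_sSup_iff.1 h
  rw [EReal.coe_lt_coe_iff] at hlt
  refine (hq.2 0 ⟨le_rfl, fun q' hq' => ?_⟩).symm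
  have h1 := hl.1.2 (lam * q' / l) (by positivity)
  rw [rsPotential_zero, rsPotential, mul_div_cancel₀ _ hl0.ne'] at h1
  rw [rsPotential_zero, rsPotential]
  have h2 : l * (lam * q' / l) ^ 2 / 4 ≤ lam * q' ^ 2 / 4 := by
    have h3 : l * (lam * q' / l) ^ 2 = lam / l * (lam * q' ^ 2) := by field_simp
    have h4 : lam / l ≤ 1 := (div_le_one hl0).2 hlt.le
    have h5 : lam / l * (lam * q' ^ 2) ≤ 1 * (lam * q' ^ 2) := by gcongr
    linarith
  linarith

/-! ### The rate function at suboptimal overlaps -/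

lemma psiBar_zero_lt_psi (hP : ∀ᵐ x ∂P, |x| ≤ B) {r : ℝ} (hr : 0 < r)
    (hD : 0 < chanOverlap P r r) : psiBar P r 0 < psi P r := by
  set d := chanOverlap P r r
  have hB4 : 0 ≤ B ^ 4 := by positivity
  -- Slightly below `r` the convex function `ψ̄(r, ·)` is strictly smaller than at the endpoint `r`.
  set η := min r (d / (B ^ 4 + 1)) with hη
  have hη0 : 0 < η := lt_min hr (by positivity)
  have hηr : η ≤ r := min_le_left _ _
  have hηd : η * (B ^ 4 + 1) ≤ d := (le_div_iff₀ (by positivity)).1 (min_le_right _ _)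
  have h1 := (psiBar_add_bounds hP r r (-η)).2
  have h2 : psiBar P r (r + -η) < psi P r := by
    have : -η * d + (-η) ^ 2 * B ^ 4 / 2 < 0 := by nlinarith [mul_pos hη0 hD]
    have h3 : psi P r = psiBar P r r := rfl
    rw [h3]
    linarith
  set β := r / (2 * r - η) with hβ
  have hden : 0 < 2 * r - η := by linarith
  have hβ0 : 0 < β := by positivity
  have hβ1 : β ≤ 1 := (div_le_one hden).2 (by linarith)
  have h3 := psiBar_convex hP r (-r) (r + -η) hβ0.le hβ1
  have h4 : (1 - β) * -r + β * (r + -η) = 0 := by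
    have : β * (2 * r - η) = r := div_mul_cancel₀ _ hden.ne'
    linarith
  rw [h4] at h3
  have h5 := mul_le_mul_of_nonneg_left (psiBar_antidiag_le hP hr.le) (by linarith : 0 ≤ 1 - β)
  have h6 := mul_lt_mul_of_pos_left h2 hβ0
  linarith

/-- Away from the endpoints, `ψ̄(r, ·)` is smaller than `ψ(r)` by an amount linear in the distance
to the endpoints. -/
lemma psiBar_le_psi_sub (hP : ∀ᵐ x ∂P, |x| ≤ B) {r s : ℝ} (hr : 0 < r) (hs : |s| ≤ r) :
    psiBar P r s ≤ psi P r - (r - |s|) / r * (psi P r - psiBar P r 0) := by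
  have hα0 : 0 ≤ |s| / r := by positivity
  have hα1 : |s| / r ≤ 1 := (div_le_one hr).2 hs
  have e1 : (r - |s|) / r = 1 - |s| / r := by field_simp
  have key : ∀ e : ℝ, psiBar P r e ≤ psi P r → |s| / r * e = s →
      psiBar P r s ≤ psi P r - (r - |s|) / r * (psi P r - psiBar P r 0) := by
    intro e he hes
    have h := psiBar_convex hP r 0 e hα0 hα1
    rw [mul_zero, zero_add, hes] at h
    have := mul_le_mul_of_nonneg_left he hα0
    rw [e1]
    linarith
  rcases le_total 0 s with h | h
  · exact key r le_rfl (by rw [abs_of_nonneg h]; field_simp)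
  · exact key (-r) (psiBar_antidiag_le hP hr.le) (by rw [abs_of_nonpos h]; field_simp)

end SpikedWigner

namespace SpikedWigner

/-! ### The gap of the rate function at suboptimal overlaps -/

lemma exists_pos_le_neg_of_isCompact {X : Type*} [TopologicalSpace X] {s : Set X}
    (hs : IsCompact s) {f : X → ℝ} (hf : Continuous f) (h : ∀ p ∈ s, f p < 0) :
    ∃ c, 0 < c ∧ ∀ p ∈ s, f p ≤ -c := by
  rcases s.eq_empty_or_nonempty with rfl | hne
  · exact ⟨1, one_pos, by simp⟩
  · obtain ⟨p, hp, hmax⟩ := hs.exists_isMaxOn hne hf.continuousOn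
    exact ⟨-f p, by linarith [h p hp], fun p' hp' => by rw [neg_neg]; exact hmax hp'⟩

variable {P : Measure ℝ} {B : ℝ}

/-- The rate function as a sum of nonpositive terms, at a maximizer `q`. -/
lemma overlapGap_eq (B lam q t m : ℝ) :
    overlapGap P B lam q t m =
      (psiBar P (lam * ((1 - t) * q + t * |m|)) (lam * ((1 - t) * q + t * m))
        - psi P (lam * ((1 - t) * q + t * |m|)))
      - 1 / (4 * B ^ 4) * (m - chanOverlap P (lam * ((1 - t) * q + t * |m|))
        (lam * ((1 - t) * q + t * m))) ^ 2
      - lam / 4 * (t * (1 - t) * (|m| - q) ^ 2)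
      - (rsPotential P lam q - rsPotential P lam ((1 - t) * q + t * |m|)) := by
  have e1 : (1 - t) * lam * q + t * lam * |m| = lam * ((1 - t) * q + t * |m|) := by ring
  have e2 : (1 - t) * lam * q + t * lam * m = lam * ((1 - t) * q + t * m) := by ring
  rw [overlapGap, rsPotential, rsPotential, e1, e2]
  linear_combination (lam * t / 4) * sq_abs m

lemma abs_interpolated_le {q t m : ℝ} (hq : 0 ≤ q) (ht : t ∈ Set.Icc (0:ℝ) 1) :
    |(1 - t) * q + t * m| ≤ (1 - t) * q + t * |m| := by
  have := sub_nonneg.2 ht.2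
  refine (abs_add_le _ _).trans_eq ?_
  rw [abs_of_nonneg (by positivity), abs_mul, abs_of_nonneg ht.1]

variable [IsProbabilityMeasure P]

lemma continuous_overlapGap (hP : ∀ᵐ x ∂P, |x| ≤ B) (lam q : ℝ) :
    Continuous fun p : ℝ × ℝ => overlapGap P B lam q p.1 p.2 := by
  unfold overlapGap
  have h1 : Continuous fun p : ℝ × ℝ => ((1 - p.1) * lam * q + p.1 * lam * |p.2|,
      (1 - p.1) * lam * q + p.1 * lam * p.2) := by fun_prop
  have h2 := (continuous_psiBar hP).comp h1
  have h3 := (continuous_chanOverlap hP).comp h1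
  simp only [Function.comp_def] at h2 h3
  fun_prop

/-- The rate vanishes only at the overlap `q`, and at `-q` at the end of the path if the prior is
symmetric. -/
lemma overlapGap_neg (hP : ∀ᵐ x ∂P, |x| ≤ B) (hB : 1 ≤ B) {lam q t m : ℝ} (hlam : 0 < lam)
    (hq : IsQStar P lam q) (ht : t ∈ Set.Icc (0:ℝ) 1) (hm : m ≠ q)
    (hcase : ¬ IsSymmetricPrior P ∨ q = 0 ∨ t < 1 ∨ |m| ≠ q) :
    overlapGap P B lam q t m < 0 := by
  by_contra! hneg
  have hB0 : 0 ≤ B := by linarith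
  have hq0 := hq.1.1
  have ht' := sub_nonneg.2 ht.2
  have ht0 := ht.1
  rw [overlapGap_eq] at hneg
  have hu := abs_interpolated_le (m := m) hq0 ht
  set u := (1 - t) * q + t * |m| with hudef
  set v := (1 - t) * q + t * m with hvdef
  have hu0 : 0 ≤ u := (abs_nonneg _).trans hu
  have hle : |lam * v| ≤ lam * u := by rw [abs_mul, abs_of_pos hlam]; gcongr
  have a1 := psiBar_le_psi hP (by positivity) hle
  have a2 : 0 ≤ 1 / (4 * B ^ 4) * (m - chanOverlap P (lam * u) (lam * v)) ^ 2 := by positivity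
  have a3 : 0 ≤ lam / 4 * (t * (1 - t) * (|m| - q) ^ 2) := by positivity
  have a4 := hq.1.2 u hu0
  have huq : u = q := hq.2 u ⟨hu0, fun q' hq' => (hq.1.2 q' hq').trans (by linarith)⟩
  have hmD : m = chanOverlap P (lam * u) (lam * v) := by
    have : 1 / (4 * B ^ 4) * (m - chanOverlap P (lam * u) (lam * v)) ^ 2 = 0 := by linarith
    have hB4 : 0 < 1 / (4 * B ^ 4) := by positivity
    have := pow_eq_zero_iff two_ne_zero |>.1 ((mul_eq_zero.1 this).resolve_left hB4.ne')
    linarith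
  have hpsi : psi P (lam * u) ≤ psiBar P (lam * u) (lam * v) := by linarith
  rw [huq] at hmD hpsi hle
  rcases ht0.eq_or_lt with h0 | htpos
  · have hv : v = q := by rw [hvdef, ← h0]; ring
    rw [hv, hq.1.chanOverlap_eq hP hB0 hlam] at hmD
    exact hm hmD
  have habs : |m| = q := by
    have h1 : t * (|m| - q) = 0 := by rw [← sub_eq_zero.2 huq, hudef]; ring
    have := (mul_eq_zero.1 h1).resolve_left htpos.ne'
    linarith
  have hmq : m = -q := by
    rcases abs_choice m with h | h
    · exact absurd (h.symm.trans habs) hm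
    · linarith
  have hqpos : 0 < q := by
    refine hq0.lt_of_ne fun h => hm ?_
    rw [hmq, ← h, neg_zero]
  have hr : 0 < lam * q := by positivity
  have hzero := psiBar_zero_lt_psi hP hr (by rw [hq.1.chanOverlap_eq hP hB0 hlam]; exact hqpos)
  have hv : lam * v = lam * q - 2 * t * (lam * q) := by rw [hvdef, hmq]; ring
  have hend : lam * q - |lam * v| ≤ 0 := by
    have h1 := psiBar_le_psi_sub hP hr hle
    have h2 : (lam * q - |lam * v|) / (lam * q) * (psi P (lam * q) - psiBar P (lam * q) 0) ≤ 0 := by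
      linarith
    by_contra! h3
    exact absurd h2 (not_le.2 (mul_pos (div_pos h3 hr) (sub_pos.2 hzero)))
  have ht1 : t = 1 := by
    by_contra hne
    have hlt : t < 1 := lt_of_le_of_ne ht.2 hne
    have : |lam * v| < lam * q := by
      have := mul_pos htpos hr
      have := mul_pos (sub_pos.2 hlt) hr
      rw [hv, abs_lt]
      constructor <;> nlinarith
    linarith
  rcases hcase with h | h | h | h
  · have h1 := psiBar_antidiag_lt hP h hr
    have h2 : lam * v = -(lam * q) := by rw [hv, ht1]; ring
    rw [h2] at hpsi
    linarith
  · exact hqpos.ne' h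
  · exact h.ne ht1
  · exact h habs

lemma isCompact_suboptimal {f : ℝ → ℝ} (hf : Continuous f) (M ε : ℝ) :
    IsCompact ((Set.Icc (0:ℝ) 1 ×ˢ Set.Icc (-M) M) ∩ {p : ℝ × ℝ | ε ≤ |f p.2|}) :=
  (isCompact_Icc.prod isCompact_Icc).inter_right
    (isClosed_le continuous_const (hf.comp continuous_snd).abs)

lemma add_sq_le {M m q τ : ℝ} (hm : |m| ≤ M) (hτ : τ ≤ 1) :
    τ + (m + q) ^ 2 ≤ 1 + (M + |q|) ^ 2 := by
  have h1 : |m + q| ≤ M + |q| := (abs_add_le _ _).trans (by linarith)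
  have := pow_le_pow_left₀ (abs_nonneg _) h1 2
  rw [sq_abs] at this
  linarith

/-- The gap is uniform if the spike cannot be confused with its reflection. -/
lemma exists_overlapGap_le (hP : ∀ᵐ x ∂P, |x| ≤ B) (hB : 1 ≤ B) {lam q ε : ℝ} (hlam : 0 < lam)
    (hq : IsQStar P lam q) (hε : 0 < ε) (M : ℝ) (hcase : ¬ IsSymmetricPrior P ∨ q = 0) :
    ∃ c, 0 < c ∧ ∀ t ∈ Set.Icc (0:ℝ) 1, ∀ m, |m| ≤ M → ε ≤ |m - q| →
      overlapGap P B lam q t m ≤ -(c * (1 + (m + q) ^ 2)) := by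
  obtain ⟨c, hc, hX⟩ := exists_pos_le_neg_of_isCompact
    (isCompact_suboptimal (f := fun m => m - q) (by fun_prop) M ε)
    (continuous_overlapGap hP lam q) (fun p hp => by
      refine overlapGap_neg hP hB hlam hq hp.1.1 (fun h => ?_) (hcase.imp_right Or.inl)
      have h2 : ε ≤ |p.2 - q| := hp.2
      rw [h, sub_self, abs_zero] at h2
      linarith)
  refine ⟨c / (1 + (M + |q|) ^ 2), by positivity, fun t ht m hm hmq => ?_⟩
  refine (hX (t, m) ⟨⟨ht, abs_le.1 hm⟩, hmq⟩).trans (neg_le_neg ?_)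
  rw [div_mul_eq_mul_div, div_le_iff₀ (by positivity)]
  exact mul_le_mul_of_nonneg_left (add_sq_le hm le_rfl) hc.le

/-- The gap is uniform at the end of the path, up to reflection. -/
lemma exists_overlapGap_one_le (hP : ∀ᵐ x ∂P, |x| ≤ B) (hB : 1 ≤ B) {lam q ε : ℝ} (hlam : 0 < lam)
    (hq : IsQStar P lam q) (hε : 0 < ε) (M : ℝ) :
    ∃ c, 0 < c ∧ ∀ m, |m| ≤ M → ε ≤ |(|m| - q)| →
      overlapGap P B lam q 1 m ≤ -(c * (1 + (m + q) ^ 2)) := by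
  obtain ⟨c, hc, hX⟩ := exists_pos_le_neg_of_isCompact
    (isCompact_suboptimal (f := fun m => |m| - q) (by fun_prop) M ε)
    (f := fun p => overlapGap P B lam q p.1 p.2)
    (continuous_overlapGap hP lam q) (fun p hp => by
      have hne : |p.2| ≠ q := fun h => by
        have h2 : ε ≤ |(|p.2| - q)| := hp.2
        rw [h, sub_self, abs_zero] at h2
        linarith
      refine overlapGap_neg hP hB hlam hq hp.1.1 (fun h => hne ?_)
        (Or.inr (Or.inr (Or.inr hne)))
      rw [h, abs_of_nonneg hq.1.1])
  refine ⟨c / (1 + (M + |q|) ^ 2), by positivity, fun m hm hmq => ?_⟩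
  refine (hX (1, m) ⟨⟨Set.right_mem_Icc.2 zero_le_one, abs_le.1 hm⟩, hmq⟩).trans (neg_le_neg ?_)
  rw [div_mul_eq_mul_div, div_le_iff₀ (by positivity)]
  exact mul_le_mul_of_nonneg_left (add_sq_le hm le_rfl) hc.le

/-- Near the end of the path and the overlap `-q`, the rate is bounded by the loss of the side
channel, of order `1 - t`, and by the nondegeneracy of the maximizer `q`. -/
lemma exists_overlapGap_local_le (hP : ∀ᵐ x ∂P, |x| ≤ B) (hB : 1 ≤ B) {lam q : ℝ}
    (hlam : lam ∈ regularSet P) (hq : IsQStar P lam q) (hq0 : 0 < q) :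
    ∃ c, 0 < c ∧ ∀ᶠ p : ℝ × ℝ in 𝓝 (1, -q), p.1 ≤ 1 →
      overlapGap P B lam q p.1 p.2 ≤ -(c * ((1 - p.1) + (p.2 + q) ^ 2)) := by
  have hB0 : 0 ≤ B := by linarith
  have hlam0 := hlam.1
  have hr : 0 < lam * q := by positivity
  have hzero := psiBar_zero_lt_psi hP hr
    (by rw [hq.1.chanOverlap_eq hP hB0 hlam0]; exact hq0)
  obtain ⟨c, hc, hquad⟩ := exists_rsPotential_le_sub_sq hP hB0 hlam hq.1 (2 * q)
  set g := psi P (lam * q) - psiBar P (lam * q) 0 with hg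
  have hg0 : 0 < g := sub_pos.2 hzero
  refine ⟨min (g / 2) (c * q ^ 2 / 4), lt_min (by positivity) (by positivity), ?_⟩
  have hucont : Continuous fun p : ℝ × ℝ => (1 - p.1) * q + p.1 * |p.2| := by fun_prop
  have hu1 : (1 - ((1:ℝ), -q).1) * q + ((1:ℝ), -q).1 * |((1:ℝ), -q).2| = q := by
    simp [abs_of_pos hq0]
  have e1 : ∀ᶠ p : ℝ × ℝ in 𝓝 (1, -q), g / 2 < psi P (lam * ((1 - p.1) * q + p.1 * |p.2|)) -
      psiBar P (lam * ((1 - p.1) * q + p.1 * |p.2|)) 0 := by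
    have hcont : Continuous fun p : ℝ × ℝ => psi P (lam * ((1 - p.1) * q + p.1 * |p.2|)) -
        psiBar P (lam * ((1 - p.1) * q + p.1 * |p.2|)) 0 :=
      ((continuous_psi hP).comp (hucont.const_mul lam)).sub
        ((continuous_psiBar hP).comp ((hucont.const_mul lam).prodMk continuous_const))
    refine hcont.continuousAt.eventually (lt_mem_nhds ?_)
    dsimp only
    rw [hu1]
    linarith
  have e2 : ∀ᶠ p : ℝ × ℝ in 𝓝 (1, -q), (1 - p.1) * q + p.1 * |p.2| < 2 * q := by
    refine hucont.continuousAt.eventually (gt_mem_nhds ?_)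
    dsimp only
    rw [hu1]
    linarith
  have e3 : ∀ᶠ p : ℝ × ℝ in 𝓝 (1, -q), (1 - p.1) * q + p.1 * p.2 < 0 := by
    refine (by fun_prop : Continuous fun p : ℝ × ℝ =>
      (1 - p.1) * q + p.1 * p.2).continuousAt.eventually (gt_mem_nhds ?_)
    simp [hq0]
  have e4 : ∀ᶠ p : ℝ × ℝ in 𝓝 (1, -q), 1 / 2 < p.1 :=
    continuous_fst.continuousAt.eventually (lt_mem_nhds (by norm_num))
  have e5 : ∀ᶠ p : ℝ × ℝ in 𝓝 (1, -q), p.2 < 0 :=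
    continuous_snd.continuousAt.eventually (gt_mem_nhds (by simpa using hq0))
  filter_upwards [e1, e2, e3, e4, e5] with ⟨t, m⟩ h1 h2 h3 h4 h5 ht
  simp only at h1 h2 h3 h4 h5 ht ⊢
  rw [overlapGap_eq]
  have htI : t ∈ Set.Icc (0:ℝ) 1 := ⟨by linarith, ht⟩
  have habs := abs_interpolated_le (m := m) hq0.le htI
  rw [abs_of_neg h5] at habs h1 h2 ⊢
  set u := (1 - t) * q + t * -m with hu
  set v := (1 - t) * q + t * m with hv
  have huv : u + v = 2 * (1 - t) * q := by rw [hu, hv]; ring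
  have hu0 : 0 < u := by
    have := abs_pos.2 h3.ne
    linarith
  have ht' := sub_nonneg.2 ht
  have hle : |lam * v| ≤ lam * u := by rw [abs_mul, abs_of_pos hlam0]; gcongr
  have a1 := psiBar_le_psi_sub hP (by positivity) hle
  have a2 : 0 ≤ 1 / (4 * B ^ 4) * (m - chanOverlap P (lam * u) (lam * v)) ^ 2 := by positivity
  have ht0 := htI.1
  have a3 : 0 ≤ lam / 4 * (t * (1 - t) * (-m - q) ^ 2) := by positivity
  have a4 := hquad u hu0.le h2.le
  have b1 : (1 - t) * (g / 2) ≤ (lam * u - |lam * v|) / (lam * u) *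
      (psi P (lam * u) - psiBar P (lam * u) 0) := by
    have b2 : 1 - t ≤ (lam * u - |lam * v|) / (lam * u) := by
      rw [abs_of_neg (mul_neg_of_pos_of_neg hlam0 h3), sub_neg_eq_add, ← mul_add, huv,
        le_div_iff₀ (by positivity)]
      have : (1 - t) * (lam * u) ≤ (1 - t) * (lam * (2 * q)) := by gcongr
      linarith
    have b3 : 0 ≤ (lam * u - |lam * v|) / (lam * u) := le_trans ht' b2
    exact mul_le_mul b2 h1.le (by positivity) b3
  have b4 : c * q ^ 2 / 4 * (m + q) ^ 2 ≤ c * (q ^ 2 - u ^ 2) ^ 2 := by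
    have e : (q ^ 2 - u ^ 2) ^ 2 = (q + u) ^ 2 * (t ^ 2 * (m + q) ^ 2) := by rw [hu]; ring
    have f1 : q ^ 2 ≤ (q + u) ^ 2 := pow_le_pow_left₀ hq0.le (by linarith) 2
    have f2 : (1 / 2) ^ 2 ≤ t ^ 2 := pow_le_pow_left₀ (by norm_num) h4.le 2
    rw [e]
    calc c * q ^ 2 / 4 * (m + q) ^ 2 = c * (q ^ 2 * ((1 / 2) ^ 2 * (m + q) ^ 2)) := by ring
      _ ≤ _ := by gcongr
  have m1 : min (g / 2) (c * q ^ 2 / 4) * (1 - t) ≤ g / 2 * (1 - t) := by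
    gcongr
    exact min_le_left _ _
  have m2 : min (g / 2) (c * q ^ 2 / 4) * (m + q) ^ 2 ≤ c * q ^ 2 / 4 * (m + q) ^ 2 := by
    gcongr
    exact min_le_right _ _
  linarith

/-- The gap in the presence of the reflected optimum: it closes at `(t, m) = (1, -q)` only. -/
lemma exists_overlapGap_le_of_pos (hP : ∀ᵐ x ∂P, |x| ≤ B) (hB : 1 ≤ B) {lam q ε : ℝ}
    (hlam : lam ∈ regularSet P) (hq : IsQStar P lam q) (hq0 : 0 < q) (hε : 0 < ε) (M : ℝ) :
    ∃ c, 0 < c ∧ ∀ t ∈ Set.Icc (0:ℝ) 1, ∀ m, |m| ≤ M → ε ≤ |m - q| →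
      overlapGap P B lam q t m ≤ -(c * ((1 - t) + (m + q) ^ 2)) := by
  obtain ⟨c₁, hc₁, hloc⟩ := exists_overlapGap_local_le hP hB hlam hq hq0
  obtain ⟨V, hV, hVo, hVmem⟩ := eventually_nhds_iff.1 hloc
  obtain ⟨c₂, hc₂, hX⟩ := exists_pos_le_neg_of_isCompact
    ((isCompact_suboptimal (f := fun m => m - q) (by fun_prop) M ε).diff hVo)
    (continuous_overlapGap hP lam q) (fun p hp => by
      have hne : p.2 ≠ q := fun h => by
        have h2 : ε ≤ |p.2 - q| := hp.1.2
        rw [h, sub_self, abs_zero] at h2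
        linarith
      refine overlapGap_neg hP hB hlam.1 hq hp.1.1.1 hne (Or.inr (Or.inr ?_))
      by_contra! h
      refine hp.2 ?_
      have h1 : p.1 = 1 := le_antisymm hp.1.1.1.2 h.1
      have h2 : p.2 = -q := by
        rcases abs_choice p.2 with h3 | h3
        · exact absurd (h3.symm.trans h.2) hne
        · linarith [h.2]
      have : p = (1, -q) := Prod.ext h1 h2
      rwa [this])
  refine ⟨min c₁ (c₂ / (1 + (M + |q|) ^ 2)), lt_min hc₁ (by positivity), fun t ht m hm hmq => ?_⟩
  have hpos : 0 ≤ (1 - t) + (m + q) ^ 2 := add_nonneg (sub_nonneg.2 ht.2) (sq_nonneg _)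
  by_cases hmem : (t, m) ∈ V
  · refine (hV (t, m) hmem ht.2).trans (neg_le_neg ?_)
    exact mul_le_mul_of_nonneg_right (min_le_left _ _) hpos
  · refine (hX (t, m) ⟨⟨⟨ht, abs_le.1 hm⟩, hmq⟩, hmem⟩).trans (neg_le_neg ?_)
    refine (mul_le_mul_of_nonneg_right (min_le_right _ _) hpos).trans ?_
    rw [div_mul_eq_mul_div, div_le_iff₀ (by positivity)]
    exact mul_le_mul_of_nonneg_left (add_sq_le hm (by linarith [ht.1])) hc₂.le

end SpikedWigner

namespace SpikedWigner

/-! ### Energy gap and convergence of the overlap -/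

variable {P : Measure ℝ} [IsProbabilityMeasure P] {B : ℝ}

/-- Half of the gap is given up to absorb the errors vanishing with `N`. -/
lemma franzParisi_le_of_overlapGap_le (hP : ∀ᵐ x ∂P, |x| ≤ B) (hB : 1 ≤ B) {lam q ε c : ℝ}
    (hlam : 0 ≤ lam) (hq : IsRSMaximizer P lam q) (hε : 0 < ε) (hc : 0 < c) {τ : ℝ → ℝ}
    (hτ : ∀ t ∈ Set.Icc (0:ℝ) 1, 0 ≤ τ t)
    (hgap : ∀ t ∈ Set.Icc (0:ℝ) 1, ∀ m, |m| ≤ B ^ 2 + 1 → ε / 2 ≤ |m - q| →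
      overlapGap P B lam q t m ≤ -(c * (τ t + (m + q) ^ 2))) :
    (∀ θ : ℝ, 0 < θ → ∃ N₀ : ℕ, ∀ N : ℕ, N₀ ≤ N → ∀ t ∈ Set.Icc (0 : ℝ) 1, θ ≤ c / 2 * τ t →
      ∀ m : ℝ, ε ≤ |m - q| → franzParisi P N lam q t (min (ε / 2) 1) m ≤
        ((phiRSt P lam q t - c / 2 * τ t : ℝ) : EReal)) ∧
    (∀ δ : ℝ, 0 < δ → ∃ N₀ : ℕ, ∀ N : ℕ, N₀ ≤ N → ∀ t ∈ Set.Icc (0 : ℝ) 1,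
      ∀ m : ℝ, ε ≤ |m - q| → franzParisi P N lam q t (min (ε / 2) 1) m ≤
        ((phiRSt P lam q t - c / 2 * τ t + δ : ℝ) : EReal)) := by
  have key : ∀ δ : ℝ, 0 < δ → ∃ N₀ : ℕ, ∀ N : ℕ, N₀ ≤ N → ∀ t ∈ Set.Icc (0 : ℝ) 1,
      ∀ m : ℝ, ε ≤ |m - q| → franzParisi P N lam q t (min (ε / 2) 1) m ≤
        ((phiRSt P lam q t - c * τ t + δ : ℝ) : EReal) := by
    intro δ hδ
    obtain ⟨N₀, -, h⟩ := franzParisi_le_of_gap hP hB hlam hq.1 (ε := min (ε / 2) 1)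
      (lt_min (by positivity) one_pos) (min_le_right _ _) hδ
    refine ⟨N₀, fun N hN t ht m hm => (h N hN t ht m (c * τ t) fun m' hm' hm'B => ?_).trans ?_⟩
    · have h1 : m' - m < ε / 2 := by
        have := min_le_left (ε / 2) 1
        linarith [hm'.2]
      have h2 : |m - q| ≤ |m' - q| + |m' - m| := by
        have := abs_sub_abs_le_abs_sub (m - q) (m' - q)
        rw [sub_sub_sub_cancel_right, abs_sub_comm m m'] at this
        linarith
      rw [abs_of_nonneg (sub_nonneg.2 hm'.1)] at h2
      refine (hgap t ht m' hm'B (by linarith)).trans ?_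
      have : 0 ≤ c * (m' + q) ^ 2 := by positivity
      linarith
    · rw [EReal.coe_le_coe_iff]
      linarith [hq.le_phiRSt hlam ht]
  constructor
  · intro θ hθ
    obtain ⟨N₀, h⟩ := key θ hθ
    refine ⟨N₀, fun N hN t ht hθt m hm => (h N hN t ht m hm).trans ?_⟩
    rw [EReal.coe_le_coe_iff]
    linarith
  · intro δ hδ
    obtain ⟨N₀, h⟩ := key δ hδ
    refine ⟨N₀, fun N hN t ht m hm => (h N hN t ht m hm).trans ?_⟩
    rw [EReal.coe_le_coe_iff]
    have := mul_nonneg hc.le (hτ t ht)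
    linarith

lemma half_le_abs_sub {f : ℝ → ℝ} (hf : ∀ x y, |f x - f y| ≤ |x - y|) {ε R m q : ℝ}
    (hR : ε ≤ |f R - q|) (h₁ : m ≤ R) (h₂ : R < m + ε / 2) : ε / 2 ≤ |f m - q| := by
  have h3 := hf R m
  rw [abs_of_nonneg (sub_nonneg.2 h₁)] at h3
  have h4 := abs_sub_abs_le_abs_sub (f R - q) (f m - q)
  rw [sub_sub_sub_cancel_right] at h4
  linarith

lemma exists_overlapProb_le_of_overlapGap_le (hP : ∀ᵐ x ∂P, |x| ≤ B) (hB : 1 ≤ B) {lam q ε c : ℝ}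
    (hlam : 0 ≤ lam) (hq : 0 ≤ q) (hε : 0 < ε) (hc : 0 < c) {τ : ℝ → ℝ}
    (hτ : ∀ t ∈ Set.Icc (0:ℝ) 1, τ t ∈ Set.Icc (0:ℝ) 1)
    (hgap : ∀ t ∈ Set.Icc (0:ℝ) 1, ∀ m, |m| ≤ B ^ 2 + 1 → ε / 2 ≤ |m - q| →
      overlapGap P B lam q t m ≤ -(c * (τ t + (m + q) ^ 2))) :
    ∃ K c₁ : ℝ, 0 ≤ K ∧ 0 < c₁ ∧ ∀ t ∈ Set.Icc (0:ℝ) 1, ∀ N : ℕ, 1 ≤ N →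
      overlapProb P N lam q t {R : ℝ | ε ≤ |R - q|} ≤ K * Real.exp (-(c₁ * τ t ^ 2 * N)) := by
  obtain ⟨K, c₁, hK, hc₁, h⟩ := exists_overlapProb_le hP hB hlam hq hc (half_pos hε)
  refine ⟨K, c₁, hK, hc₁, fun t ht N hN => h t ht (τ t) (hτ t ht) _ {m | ε / 2 ≤ |m - q|}
    (measurableSet_le measurable_const (by fun_prop)) ?_ (fun m hm hmB => hgap t ht m hmB hm) N hN⟩
  exact fun R hR m h₁ h₂ => half_le_abs_sub (f := fun x => x) (fun _ _ => le_rfl) hR h₁ h₂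

lemma exists_overlapProb_one_le (hP : ∀ᵐ x ∂P, |x| ≤ B) (hB : 1 ≤ B) {lam q ε : ℝ}
    (hlam : 0 < lam) (hq : IsQStar P lam q) (hε : 0 < ε) :
    ∃ K c₁ : ℝ, 0 ≤ K ∧ 0 < c₁ ∧ ∀ N : ℕ, 1 ≤ N →
      overlapProb P N lam q 1 {R : ℝ | ε ≤ |(|R| - q)|} ≤ K * Real.exp (-(c₁ * N)) := by
  obtain ⟨c, hc, hgap⟩ := exists_overlapGap_one_le hP hB hlam hq (half_pos hε) (B ^ 2 + 1)
  obtain ⟨K, c₁, hK, hc₁, h⟩ := exists_overlapProb_le hP hB hlam.le hq.1.1 hc (half_pos hε)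
  refine ⟨K, c₁, hK, hc₁, fun N hN => ?_⟩
  have := h 1 (Set.right_mem_Icc.2 zero_le_one) 1 (Set.right_mem_Icc.2 zero_le_one)
    {R : ℝ | ε ≤ |(|R| - q)|} {m | ε / 2 ≤ |(|m| - q)|}
    (measurableSet_le measurable_const (by fun_prop))
    (fun R hR m h₁ h₂ => half_le_abs_sub (f := fun x => |x|) abs_abs_sub_abs_le_abs_sub hR h₁ h₂)
    (fun m hm hmB => hgap m hmB hm) N hN
  simpa using this

lemma tendsto_mul_pow_div_pow (c : ℝ) (n : ℕ) :
    Tendsto (fun t : ℝ => c * (1 - t) ^ n / (1 - t) ^ n) (𝓝[<] 1) (𝓝 c) := by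
  refine tendsto_const_nhds.congr' ?_
  filter_upwards [self_mem_nhdsWithin] with t ht
  have : 0 < 1 - t := sub_pos.2 ht
  field_simp

end SpikedWigner

theorem mainTheorem9 (P : MeasureTheory.Measure ℝ) [MeasureTheory.IsProbabilityMeasure P]
    (hP : ∃ B : ℝ, ∀ᵐ x ∂P, |x| ≤ B) :
    -- the bound on the free energy at fixed overlap
    (∃ K : ℝ, 0 < K ∧ ∀ lam : ℝ, 0 ≤ lam → ∃ K' : ℝ, 0 < K' ∧
      ∀ q : ℝ, SpikedWigner.IsRSMaximizer P lam q →
      ∀ m ε t : ℝ, 0 < ε → t ∈ Set.Icc (0 : ℝ) 1 → ∀ N : ℕ, 1 ≤ N →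
      ∀ r rbar : ℝ, r = (1 - t) * lam * q + t * lam * |m| →
        rbar = (1 - t) * lam * q + t * lam * m →
        SpikedWigner.franzParisi P N lam q t ε m ≤
          ((SpikedWigner.psiBar P r rbar - t * lam * m ^ 2 / 4
            - K * (m - deriv (fun s : ℝ => SpikedWigner.psiBar P r s) rbar) ^ 2
            + K' * ε ^ 2 + K' / N : ℝ) : EReal)) ∧
    ∀ lam ∈ SpikedWigner.regularSet P, ∃ q : ℝ, SpikedWigner.IsQStar P lam q ∧ ∀ ε : ℝ, 0 < ε →
      -- the energy gap at suboptimal overlap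
      (∃ ε' : ℝ, 0 < ε' ∧ ∃ c : ℝ → ℝ,
        (∀ t ∈ Set.Icc (0 : ℝ) 1, 0 ≤ c t) ∧
        (∀ t ∈ Set.Ico (0 : ℝ) 1, 0 < c t) ∧
        ((lam : EReal) < SpikedWigner.lambdaC P ∨ ¬ SpikedWigner.IsSymmetricPrior P →
          ∃ c₀ : ℝ, 0 < c₀ ∧ ∀ t ∈ Set.Icc (0 : ℝ) 1, c₀ ≤ c t) ∧
        (SpikedWigner.lambdaC P < (lam : EReal) ∧ SpikedWigner.IsSymmetricPrior P →
          ∃ c₀ : ℝ, 0 < c₀ ∧ Tendsto (fun t : ℝ => c t / (1 - t)) (𝓝[<] 1) (𝓝 c₀)) ∧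
        (∀ θ : ℝ, 0 < θ → ∃ N₀ : ℕ, ∀ N : ℕ, N₀ ≤ N → ∀ t ∈ Set.Icc (0 : ℝ) 1, θ ≤ c t →
          ∀ m : ℝ, ε ≤ |m - q| →
          SpikedWigner.franzParisi P N lam q t ε' m ≤
            ((SpikedWigner.phiRSt P lam q t - c t : ℝ) : EReal)) ∧
        (∀ δ : ℝ, 0 < δ → ∃ N₀ : ℕ, ∀ N : ℕ, N₀ ≤ N → ∀ t ∈ Set.Icc (0 : ℝ) 1,
          ∀ m : ℝ, ε ≤ |m - q| →
          SpikedWigner.franzParisi P N lam q t ε' m ≤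
            ((SpikedWigner.phiRSt P lam q t - c t + δ : ℝ) : EReal))) ∧
      -- convergence in probability of the overlap
      (∃ K : ℝ, 0 ≤ K ∧
        (∃ c : ℝ → ℝ,
          (∀ t ∈ Set.Icc (0 : ℝ) 1, 0 ≤ c t) ∧
          (∀ t ∈ Set.Ico (0 : ℝ) 1, 0 < c t) ∧
          ((lam : EReal) < SpikedWigner.lambdaC P ∨ ¬ SpikedWigner.IsSymmetricPrior P →
            ∃ c₀ : ℝ, 0 < c₀ ∧ ∀ t ∈ Set.Icc (0 : ℝ) 1, c₀ ≤ c t) ∧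
          (SpikedWigner.lambdaC P < (lam : EReal) ∧ SpikedWigner.IsSymmetricPrior P →
            ∃ c₀ : ℝ, 0 < c₀ ∧ Tendsto (fun t : ℝ => c t / (1 - t) ^ 2) (𝓝[<] 1) (𝓝 c₀)) ∧
          (∀ t ∈ Set.Icc (0 : ℝ) 1, ∀ N : ℕ, 1 ≤ N →
            SpikedWigner.overlapProb P N lam q t {R : ℝ | ε ≤ |R - q|} ≤
              K * Real.exp (-(c t * N)))) ∧
        (SpikedWigner.lambdaC P < (lam : EReal) ∧ SpikedWigner.IsSymmetricPrior P →
          ∃ c : ℝ, 0 < c ∧ ∀ N : ℕ, 1 ≤ N →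
            SpikedWigner.overlapProb P N lam q 1 {R : ℝ | ε ≤ |(|R| - q)|} ≤
              K * Real.exp (-(c * N)))) := by
  obtain ⟨B₀, hB₀⟩ := hP
  obtain ⟨B, hB, hP⟩ : ∃ B : ℝ, 1 ≤ B ∧ ∀ᵐ x ∂P, |x| ≤ B :=
    ⟨max B₀ 1, le_max_right _ _, hB₀.mono fun x hx => hx.trans (le_max_left _ _)⟩
  have hB0 : 0 ≤ B := by linarith
  refine ⟨⟨1 / (4 * B ^ 4), by positivity, fun lam hlam => ⟨1 + lam + lam * B ^ 4, by positivity,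
    fun q hq m ε t hε ht N hN r rbar hr hrbar => ?_⟩⟩, fun lam hlam => ?_⟩
  · refine (SpikedWigner.franzParisi_le hP hB hN hlam hq.1 ht hε.le hr hrbar).trans ?_
    rw [EReal.coe_le_coe_iff, SpikedWigner.deriv_psiBar hP]
    have h1 : lam * B ^ 4 / 4 / N ≤ (1 + lam + lam * B ^ 4) / N := by
      gcongr
      have : 0 ≤ lam * B ^ 4 := by positivity
      linarith
    have h2 : 0 ≤ lam * B ^ 4 * ε ^ 2 := by positivity
    linarith
  obtain ⟨q, hq⟩ := SpikedWigner.exists_isQStar hP hB0 hlam.1 hlam.2.1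
  refine ⟨q, hq, fun ε hε => ?_⟩
  have hlam0 := hlam.1
  by_cases hcase : ¬ SpikedWigner.IsSymmetricPrior P ∨ q = 0
  · have hvac : ¬ (SpikedWigner.lambdaC P < (lam : EReal) ∧ SpikedWigner.IsSymmetricPrior P) := by
      rintro ⟨h1, h2⟩
      exact hcase.elim (fun h => h h2) (SpikedWigner.pos_of_lambdaC_lt hlam h1 hq).ne'
    obtain ⟨c, hc, hgap⟩ := SpikedWigner.exists_overlapGap_le hP hB hlam0 hq (half_pos hε)
      (B ^ 2 + 1) hcase
    obtain ⟨h4, h5⟩ := SpikedWigner.franzParisi_le_of_overlapGap_le hP hB hlam0.le hq.1 hε hc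
      (τ := fun _ => 1) (fun _ _ => zero_le_one) hgap
    obtain ⟨K, c₁, hK, hc₁, hprob⟩ := SpikedWigner.exists_overlapProb_le_of_overlapGap_le hP hB
      hlam0.le hq.1.1 hε hc (τ := fun _ => 1) (fun _ _ => ⟨zero_le_one, le_rfl⟩) hgap
    refine ⟨⟨min (ε / 2) 1, lt_min (by positivity) one_pos, fun _ => c / 2 * 1,
      fun _ _ => by positivity, fun _ _ => by positivity,
      fun _ => ⟨c / 2 * 1, by positivity, fun _ _ => le_rfl⟩, fun h => absurd h hvac, h4, h5⟩,
      K, hK, ⟨fun _ => c₁ * 1 ^ 2, fun _ _ => by positivity, fun _ _ => by positivity,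
      fun _ => ⟨c₁ * 1 ^ 2, by positivity, fun _ _ => le_rfl⟩, fun h => absurd h hvac, hprob⟩,
      fun h => absurd h hvac⟩
  · push Not at hcase
    obtain ⟨hsym, hq0⟩ := hcase
    have hqpos : 0 < q := lt_of_le_of_ne hq.1.1 hq0.symm
    have hvac : ¬ ((lam : EReal) < SpikedWigner.lambdaC P ∨ ¬ SpikedWigner.IsSymmetricPrior P) :=
      fun h => h.elim (fun h => hq0 (SpikedWigner.eq_zero_of_lt_lambdaC hlam0 h hq))
        fun h => h hsym
    obtain ⟨c, hc, hgap⟩ := SpikedWigner.exists_overlapGap_le_of_pos hP hB hlam hq hqpos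
      (half_pos hε) (B ^ 2 + 1)
    have hτ : ∀ t ∈ Set.Icc (0:ℝ) 1, 1 - t ∈ Set.Icc (0:ℝ) 1 := fun t ht =>
      ⟨by linarith [ht.2], by linarith [ht.1]⟩
    have hτpos : ∀ t ∈ Set.Ico (0:ℝ) 1, 0 < 1 - t := fun t ht => sub_pos.2 ht.2
    obtain ⟨h4, h5⟩ := SpikedWigner.franzParisi_le_of_overlapGap_le hP hB hlam0.le hq.1 hε hc
      (τ := fun t => 1 - t) (fun t ht => (hτ t ht).1) hgap
    obtain ⟨K, c₁, hK, hc₁, hprob⟩ := SpikedWigner.exists_overlapProb_le_of_overlapGap_le hP hB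
      hlam0.le hq.1.1 hε hc (τ := fun t => 1 - t) hτ hgap
    obtain ⟨K₂, c₂, hK₂, hc₂, hprob₂⟩ := SpikedWigner.exists_overlapProb_one_le hP hB hlam0 hq hε
    refine ⟨⟨min (ε / 2) 1, lt_min (by positivity) one_pos, fun t => c / 2 * (1 - t),
      fun t ht => mul_nonneg (by positivity) (hτ t ht).1,
      fun t ht => mul_pos (by positivity) (hτpos t ht), fun h => absurd h hvac,
      fun _ => ⟨c / 2, by positivity, ?_⟩, h4, h5⟩,
      max K K₂, le_max_of_le_left hK, ⟨fun t => c₁ * (1 - t) ^ 2, fun t _ => by positivity,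
      fun t ht => mul_pos hc₁ (pow_pos (hτpos t ht) 2), fun h => absurd h hvac,
      fun _ => ⟨c₁, hc₁, SpikedWigner.tendsto_mul_pow_div_pow c₁ 2⟩,
      fun t ht N hN => (hprob t ht N hN).trans ?_⟩,
      fun _ => ⟨c₂, hc₂, fun N hN => (hprob₂ N hN).trans ?_⟩⟩
    · simpa using SpikedWigner.tendsto_mul_pow_div_pow (c / 2) 1
    · gcongr
      exact le_max_left _ _
    · gcongr
      exact le_max_right _ _
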